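/- Let $M$ be a smooth finite-dimensional manifold (Hausdorff, second countable, without boundary), $\pi:E\to M$ a smooth real vector bundle of finite rank, and $\mathcal M=\Pi E$ the supermanifold $(M,\mathcal O_{\mathcal M})$ with $\mathcal O_{\mathcal M}=\Gamma_{\Lambda E^*}$. Write $\mathcal T_{\mathcal M}$ and $\mathcal T_E$ for the sheaves of (super)derivations of $\mathcal O_{\mathcal M}$ and $C^\infty_E$. A connection on $\mathcal M$ is an even, $\mathbb R$-bilinear morphism of sheaves $(X,Y)\mapsto\nabla_XY$ from $\mathcal T_{\mathcal M}\times\mathcal T_{\mathcal M}$ to $\mathcal T_{\mathcal M}$ that is $\mathcal O_{\mathcal M}$-linear in $X$ and satisfies $\nabla_X(fY)=X(f)Y+(-1)^{|X||f|}f\nabla_XY$ for homogeneous $X$, $f$; a connection on $E$ is the same notion for $C^\infty_E$, $\mathcal T_E$ (where all parities are even). For $U\subset M$ open let $\mathcal F(U)=\Gamma_{\mathbb R\oplus E^*}(U)\subset\mathcal O_{\mathcal M}(U)$ be the superfunctions of $\mathbb Z$-degree at most one, $pr:\mathcal O_{\mathcal M}\to\mathcal F$ the projection, and $\psi(s_0+s_1)(e)=s_0(\pi(e))+s_1(\pi(e))(e)$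 the identification of $\mathcal F(U)$ with the smooth functions on $\pi^{-1}(U)$ that are affine on every fibre. Let $\mathcal L_{\bar 0}(U)$ be the set of even superderivations over $U$ that preserve $\mathcal F$, and let $\mathcal L'_{\bar 0}(U)$ be the set of derivations of $C^\infty_E$ over $\pi^{-1}(U)$ that map pullbacks of smooth functions on the base to such pullbacks and fibrewise linear functions to fibrewise linear functions. Then: 1. For every open $U$ and every $X\in\mathcal L_{\bar 0}(U)$ there is exactly one $X'\in\mathcal L'_{\bar 0}(U)$ with $X'\circ\psi=\psi\circ X$ on $\mathcal F$ over all open subsets of $U$, and every $X'\in\mathcal L'_{\bar 0}(U)$ arises so from exactly one $X\in\mathcal L_{\bar 0}(U)$. Write $X'=\Psi(X)$. 2. For every open $U$ and every even superderivation $D$ over $U$ there is exactly one $p(D)\in\mathcal L_{\bar 0}(U)$ with $p(D)=pr\circ D$ on $\mathcal F$ over all open subsets of $U$. 3. Every connection $\nabla$ on $\mathcal M$ induces a well-defined connection on $E$: there is exactly one connection $\nabla^{TE}$ on $E$ such that $$\nabla^{TE}_{\Psi(X)}\Psi(Y)=\Psi\big(p(\nabla_XY)\big)\qquad\text{for all open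 } U\subset M,\ X,Y\in\mathcal L_{\bar 0}(U).$$ 4. If $X',Y'\in\mathcal T_E(\pi^{-1}(U))$ and $h,k\in C^\infty_E(\pi^{-1}(U))$ (auxiliary functions) are such that $hX'=\Psi(X)$ and $kY'=\Psi(Y)$ with $X,Y\in\mathcal L_{\bar 0}(U)$, then $$hk\,\nabla^{TE}_{X'}Y'=\Psi\big(p(\nabla_XY)\big)-h\,X'(k)\,Y'.$$ -/

import Mathlib

open Bundle TopologicalSpace
open scoped Manifold ContDiff

set_option linter.unusedSectionVars false

noncomputable section

universe u v

/-- The Koszul sign `(-1)^{pq}` of two parities. -/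
def koszul (p q : ZMod 2) : ℝ := if p = 1 ∧ q = 1 then -1 else 1

/-- A sheaf of real supercommutative superalgebras on `X`, given as a sheaf of sections of a family
of superalgebras `fiber x`, `x : X` (with even part `parity x 0` and odd part `parity x 1`). -/
structure SuperSheaf (X : Type u) [TopologicalSpace X] where
  fiber : X → Type v
  [ring : ∀ x, Ring (fiber x)]
  [algebra : ∀ x, Algebra ℝ (fiber x)]
  parity : ∀ x, ZMod 2 → Submodule ℝ (fiber x)
  parity_disjoint : ∀ x, Disjoint (parity x 0) (parity x 1)
  parity_mul_mem : ∀ x p q a b, a ∈ parity x p → b ∈ parity x q → a * b ∈ parity x (p + q)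
  parity_mul_comm : ∀ x p q a b, a ∈ parity x p → b ∈ parity x q → a * b = koszul p q • (b * a)
  sec : ∀ U : Opens X, Subalgebra ℝ (∀ x : U, fiber x)
  res_mem : ∀ (U W : Opens X) (h : W ≤ U) (f : ∀ x : U, fiber x), f ∈ sec U →
    (fun x : W => f ⟨x, h x.2⟩) ∈ sec W
  locality : ∀ (U : Opens X) (f : ∀ x : U, fiber x),
    (∀ x : U, ∃ (W : Opens X) (h : W ≤ U), x.1 ∈ W ∧ (fun y : W => f ⟨y, h y.2⟩) ∈ sec W) →
    f ∈ sec U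
  decomp : ∀ (U : Opens X) (f : ∀ x : U, fiber x), f ∈ sec U →
    ∃ f₀ ∈ sec U, ∃ f₁ ∈ sec U, 
      (∀ x : U, f₀ x ∈ parity x 0) ∧ (∀ x : U, f₁ x ∈ parity x 1) ∧ f = f₀ + f₁

attribute [instance] SuperSheaf.ring SuperSheaf.algebra

namespace SuperSheaf

variable {X : Type u} [TopologicalSpace X] (O : SuperSheaf.{u, v} X)

/-- The superalgebra of sections over `U`. -/
def Sec (U : Opens X) : Type (max u v) := O.sec U

instance (U : Opens X) : Ring (O.Sec U) := inferInstanceAs (Ring (O.sec U))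

instance (U : Opens X) : Algebra ℝ (O.Sec U) := inferInstanceAs (Algebra ℝ (O.sec U))

/-- Sections over `U` that are homogeneous of parity `p`. -/
def par (U : Opens X) (p : ZMod 2) : Submodule ℝ (O.Sec U) where
  carrier := {f | ∀ x : U, f.1 x ∈ O.parity x p}
  add_mem' hf hg x := (O.parity x p).add_mem (hf x) (hg x)
  zero_mem' x := (O.parity x p).zero_mem
  smul_mem' c _ hf x := (O.parity x p).smul_mem c (hf x)

/-- Restriction of sections to a smaller open set. -/
def res {U W : Opens X} (h : W ≤ U) : O.Sec U →ₐ[ℝ] O.Sec W where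
  toFun f := ⟨fun x => f.1 ⟨x, h x.2⟩, O.res_mem U W h f.1 f.2⟩
  map_one' := rfl
  map_mul' _ _ := rfl
  map_zero' := rfl
  map_add' _ _ := rfl
  commutes' _ := rfl

/-- Families of `ℝ`-linear operators on the sections over the open subsets of `U`. -/
abbrev Ops (U : Opens X) : Type (max u v) := ∀ W : Set.Iic U, O.Sec W.1 →ₗ[ℝ] O.Sec W.1

/-- Superderivations, homogeneous of parity `p`, of the restriction of the sheaf to `U`: families of
operators that commute with restrictions, shift the parity by `p`, and satisfy the graded Leibniz
rule. -/
def der (U : Opens X) (p : ZMod 2) : Submodule ℝ (O.Ops U) where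
  carrier := {D |
    (∀ (W W' : Set.Iic U) (h : W'.1 ≤ W.1) (f : O.Sec W.1), O.res h (D W f) = D W' (O.res h f)) ∧
    (∀ (W : Set.Iic U) (q : ZMod 2), ∀ f ∈ O.par W.1 q, D W f ∈ O.par W.1 (p + q)) ∧
    (∀ (W : Set.Iic U) (q : ZMod 2), ∀ f ∈ O.par W.1 q, ∀ g : O.Sec W.1,
      D W (f * g) = D W f * g + koszul p q • (f * D W g))}
  add_mem' := by
    rintro D D' ⟨h1, h2, h3⟩ ⟨h1', h2', h3'⟩
    refine ⟨fun W W' h f => ?_, fun W q f hf => ?_, fun W q f hf g => ?_⟩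
    · simp [h1, h1']
    · exact Submodule.add_mem _ (h2 W q f hf) (h2' W q f hf)
    · simp only [Pi.add_apply, LinearMap.add_apply, h3 W q f hf g, h3' W q f hf g, add_mul, mul_add,
        smul_add]
      abel
  zero_mem' := by
    refine ⟨fun W W' h f => ?_, fun W q f hf => ?_, fun W q f hf g => ?_⟩
    · simp
    · exact Submodule.zero_mem _
    · simp
  smul_mem' := by
    rintro c D ⟨h1, h2, h3⟩
    refine ⟨fun W W' h f => ?_, fun W q f hf => ?_, fun W q f hf g => ?_⟩
    · simp [h1]
    · exact Submodule.smul_mem _ c (h2 W q f hf)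
    · simp only [Pi.smul_apply, LinearMap.smul_apply, h3 W q f hf g, smul_add, smul_mul_assoc,
        mul_smul_comm, smul_comm c]

/-- Sections over `U` of the tangent sheaf: sums of an even and an odd superderivation. -/
def tan (U : Opens X) : Submodule ℝ (O.Ops U) := O.der U 0 ⊔ O.der U 1

/-- The real vector space of vector fields over `U`. -/
def Vect (U : Opens X) : Type (max u v) := O.tan U

instance (U : Opens X) : AddCommGroup (O.Vect U) := inferInstanceAs (AddCommGroup (O.tan U))

instance (U : Opens X) : Module ℝ (O.Vect U) := inferInstanceAs (Module ℝ (O.tan U))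

variable {O}

/-- The value `X(f)` of a vector field `X` over `U` on a section `f` over `W ⊆ U`. -/
def app {U W : Opens X} (D : O.Vect U) (h : W ≤ U) : O.Sec W →ₗ[ℝ] O.Sec W := D.1 ⟨W, h⟩

theorem der_le_tan (U : Opens X) (p : ZMod 2) : O.der U p ≤ O.tan U := by
  fin_cases p
  · exact le_sup_left
  · exact le_sup_right

/-- Restriction of families of operators. -/
def resOps {U W : Opens X} (h : W ≤ U) : O.Ops U →ₗ[ℝ] O.Ops W where
  toFun D W' := D ⟨W'.1, le_trans W'.2 h⟩
  map_add' _ _ := rfl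
  map_smul' _ _ := rfl

theorem resOps_der {U W : Opens X} (h : W ≤ U) (p : ZMod 2) :
    O.der U p ≤ (O.der W p).comap (resOps h) := by
  rintro D ⟨h1, h2, h3⟩
  exact ⟨fun W W' hW f => h1 ⟨W.1, W.2.trans h⟩ ⟨W'.1, W'.2.trans h⟩ hW f,
    fun W q f hf => h2 ⟨W.1, W.2.trans h⟩ q f hf, fun W q f hf g => h3 ⟨W.1, W.2.trans h⟩ q f hf g⟩

theorem resOps_tan {U W : Opens X} (h : W ≤ U) :
    O.tan U ≤ (O.tan W).comap (resOps h) :=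
  sup_le ((resOps_der h 0).trans (Submodule.comap_mono (der_le_tan W 0)))
    ((resOps_der h 1).trans (Submodule.comap_mono (der_le_tan W 1)))

/-- Restriction of vector fields. -/
def resVect {U W : Opens X} (h : W ≤ U) : O.Vect U →ₗ[ℝ] O.Vect W :=
  (resOps h).restrict (fun _ hD => resOps_tan h hD)

/-- Left multiplication of a family of operators by a section. -/
def mulOps {U : Opens X} (f : O.Sec U) : O.Ops U →ₗ[ℝ] O.Ops U where
  toFun D W := (LinearMap.mulLeft ℝ (O.res W.2 f)).comp (D W)
  map_add' D D' := by ext W g : 2; simp [mul_add]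
  map_smul' c D := by ext W g : 2; simp

theorem mulOps_apply {U : Opens X} (f : O.Sec U) (D : O.Ops U) (W : Set.Iic U) (g : O.Sec W.1) :
    mulOps f D W g = O.res W.2 f * D W g := rfl

theorem koszul_add_left (p q r : ZMod 2) : koszul (p + q) r = koszul p r * koszul q r := by
  have h : ∀ a : ZMod 2, a = 0 ∨ a = 1 := by decide
  have h2 : (1 + 1 : ZMod 2) = 0 := by decide
  rcases h p with rfl | rfl <;> rcases h q with rfl | rfl <;> rcases h r with rfl | rfl <;>
    simp [koszul, h2]

theorem mulOps_der {U : Opens X} {q : ZMod 2} {f : O.Sec U} (hf : f ∈ O.par U q) (p : ZMod 2) :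
    O.der U p ≤ (O.der U (q + p)).comap (mulOps f) := by
  rintro D ⟨h1, h2, h3⟩
  have hres : ∀ W : Set.Iic U, O.res W.2 f ∈ O.par W.1 q := fun W x => hf ⟨x.1, W.2 x.2⟩
  refine ⟨fun W W' h g => ?_, fun W r g hg => ?_, fun W r g hg k => ?_⟩
  · rw [mulOps_apply, mulOps_apply, map_mul, h1]
    rfl
  · intro x
    rw [mulOps_apply, add_assoc]
    exact O.parity_mul_mem _ _ _ _ _ (hres W x) (h2 W r g hg x)
  · have hc : O.res W.2 f * g = koszul q r • (g * O.res W.2 f) := by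
      apply Subtype.ext
      funext x
      exact O.parity_mul_comm _ _ _ _ _ (hres W x) (hg x)
    rw [mulOps_apply, mulOps_apply, mulOps_apply, h3 W r g hg k, mul_add, mul_smul_comm,
      ← mul_assoc, ← mul_assoc, hc, koszul_add_left, smul_mul_assoc, smul_smul, mul_assoc g,
      mul_comm (koszul p r)]

theorem exists_parts {U : Opens X} (f : O.Sec U) :
    ∃ f₀ ∈ O.par U 0, ∃ f₁ ∈ O.par U 1, f = f₀ + f₁ := by
  obtain ⟨f₀, hf₀, f₁, hf₁, hp₀, hp₁, hf⟩ := O.decomp U f.1 f.2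
  exact ⟨(⟨f₀, hf₀⟩ : O.sec U), hp₀, (⟨f₁, hf₁⟩ : O.sec U), hp₁, Subtype.ext hf⟩

theorem mulOps_tan {U : Opens X} (f : O.Sec U) : O.tan U ≤ (O.tan U).comap (mulOps f) := by
  obtain ⟨f₀, hf₀, f₁, hf₁, rfl⟩ := exists_parts f
  have key : ∀ D : O.Ops U, mulOps (f₀ + f₁) D = mulOps f₀ D + mulOps f₁ D := by
    intro D
    ext W g : 2
    simp only [Pi.add_apply, LinearMap.add_apply, mulOps_apply, map_add, add_mul]
  have hder : ∀ p, O.der U p ≤ (O.tan U).comap (mulOps (f₀ + f₁)) := by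
    intro p D hD
    rw [Submodule.mem_comap, key]
    exact Submodule.add_mem _ (der_le_tan _ _ (mulOps_der hf₀ p hD))
      (der_le_tan _ _ (mulOps_der hf₁ p hD))
  exact sup_le (hder 0) (hder 1)

/-- The vector field `f X`. -/
def mulVect {U : Opens X} (f : O.Sec U) : O.Vect U →ₗ[ℝ] O.Vect U :=
  (mulOps f).restrict (fun _ hD => mulOps_tan f hD)

variable (O)

/-- A connection on the tangent sheaf: an even morphism of sheaves `(X, Y) ↦ ∇_X Y` that is
`ℝ`-bilinear, linear over the structure sheaf in `X`, and satisfies the graded Leibniz rule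
`∇_X (f Y) = X(f) Y + (-1)^{|X||f|} f ∇_X Y`. -/
structure IsConnection (nabla : ∀ U : Opens X, O.Vect U →ₗ[ℝ] O.Vect U →ₗ[ℝ] O.Vect U) :
    Prop where
  res_nabla : ∀ (U W : Opens X) (h : W ≤ U) (D D' : O.Vect U),
    resVect h (nabla U D D') = nabla W (resVect h D) (resVect h D')
  even : ∀ (U : Opens X) (p q : ZMod 2) (D D' : O.Vect U), D.1 ∈ O.der U p → D'.1 ∈ O.der U q →
    (nabla U D D').1 ∈ O.der U (p + q)
  mul_left : ∀ (U : Opens X) (f : O.Sec U) (D D' : O.Vect U),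
    nabla U (mulVect f D) D' = mulVect f (nabla U D D')
  leibniz : ∀ (U : Opens X) (p q : ZMod 2) (f : O.Sec U) (D D' : O.Vect U),
    D.1 ∈ O.der U p → f ∈ O.par U q →
    nabla U D (mulVect f D') =
      mulVect (app D le_rfl f) D' + koszul p q • mulVect f (nabla U D D')

/-- The connections on the tangent sheaf. -/
def Connection :=
  {nabla : ∀ U : Opens X, O.Vect U →ₗ[ℝ] O.Vect U →ₗ[ℝ] O.Vect U // O.IsConnection nabla}

end SuperSheaf

section Manifold

theorem contMDiffAt_restrict_iff {E H N : Type*} [NormedAddCommGroup E] [NormedSpace ℝ E]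
    [TopologicalSpace H] {I : ModelWithCorners ℝ E H} [TopologicalSpace N] [ChartedSpace H N]
    {U W : Opens N} (h : W ≤ U) (f : U → ℝ) (x : W) :
    ContMDiffAt I 𝓘(ℝ, ℝ) ∞ (fun y : W => f ⟨y, h y.2⟩) x ↔
      ContMDiffAt I 𝓘(ℝ, ℝ) ∞ f ⟨x, h x.2⟩ := by
  classical
  let g : N → ℝ := fun y => if hy : y ∈ U then f ⟨y, hy⟩ else 0
  have h1 : (fun y : W => f ⟨y, h y.2⟩) = fun y : W => g y := by
    funext y
    have : y.1 ∈ U := h y.2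
    simp [g, this]
  have h2 : f = fun y : U => g y := by
    funext y
    simp [g]
  rw [h1]
  conv_rhs => rw [h2]
  rw [contMDiffAt_subtype_iff, contMDiffAt_subtype_iff]

/-- The sheaf of smooth functions of a manifold, as a purely even sheaf of superalgebras. -/
def smoothFunctions {E H : Type*} [NormedAddCommGroup E] [NormedSpace ℝ E] [TopologicalSpace H]
    (I : ModelWithCorners ℝ E H) (N : Type u) [TopologicalSpace N] [ChartedSpace H N] :
    SuperSheaf.{u, 0} N where
  fiber _ := ℝ
  parity _ p := if p = 0 then ⊤ else ⊥
  parity_disjoint _ := by simp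
  parity_mul_mem x p q a b ha hb := by
    have h : ∀ a : ZMod 2, a = 0 ∨ a = 1 := by decide
    rcases h p with rfl | rfl <;> rcases h q with rfl | rfl <;> simp_all
  parity_mul_comm x p q a b ha hb := by
    have h : ∀ a : ZMod 2, a = 0 ∨ a = 1 := by decide
    rcases h p with rfl | rfl <;> rcases h q with rfl | rfl <;> simp_all [koszul, mul_comm]
  sec U :=
    { carrier := {f | ContMDiff I 𝓘(ℝ, ℝ) ∞ f}
      mul_mem' := fun hf hg => ContMDiff.mul hf hg
      add_mem' := fun hf hg => ContMDiff.add hf hg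
      algebraMap_mem' := fun _ => contMDiff_const }
  res_mem U W h f hf x := (contMDiffAt_restrict_iff h f x).2 (hf _)
  locality U f hf x := by
    obtain ⟨W, h, hx, hW⟩ := hf x
    exact (contMDiffAt_restrict_iff h f ⟨x, hx⟩).1 (hW _)
  decomp U f hf := ⟨f, hf, 0, contMDiff_const, by simp, by simp, by simp⟩

end Manifold

section Bundle

variable (B : Type*) [NormedAddCommGroup B] [NormedSpace ℝ B]
  (F : Type*) [NormedAddCommGroup F] [NormedSpace ℝ F] [FiniteDimensional ℝ F]
  {M : Type*} [TopologicalSpace M] [ChartedSpace B M]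
  (V : M → Type*) [TopologicalSpace (TotalSpace F V)]
  [∀ x, AddCommGroup (V x)] [∀ x, Module ℝ (V x)] [∀ x, TopologicalSpace (V x)]
  [FiberBundle F V] [VectorBundle ℝ F V]

/-- The fibre at `x` of the exterior algebra bundle `Λ E*` of the dual bundle. -/
abbrev ExtFiber (x : M) := ExteriorAlgebra ℝ (Module.Dual ℝ (V x))

/-- The local trivialization of `Λ E*` at `x₀` that is induced by that of `E`. -/
def extTriv (x₀ x : M) : ExtFiber V x →ₐ[ℝ] ExteriorAlgebra ℝ (Module.Dual ℝ F) :=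
  ExteriorAlgebra.map ((trivializationAt F V x₀).symmL ℝ x).toLinearMap.dualMap

/-- Smoothness of a section of `Λ E*` over `U`: in the local trivializations all coordinates
(values of linear functionals on the finite-dimensional model fibre) are smooth. -/
def IsSmoothExt (U : Opens M) (s : ∀ x : U, ExtFiber V x.1) : Prop :=
  ∀ (x₀ : M) (ℓ : Module.Dual ℝ (ExteriorAlgebra ℝ (Module.Dual ℝ F))) (x : U),
    x.1 ∈ (trivializationAt F V x₀).baseSet →
    ContMDiffAt 𝓘(ℝ, B) 𝓘(ℝ, ℝ) ∞ (fun y : U => ℓ (extTriv F V x₀ y (s y))) x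

theorem IsSmoothExt.mul {U : Opens M} {s t : ∀ x : U, ExtFiber V x.1}
    (hs : IsSmoothExt B F V U s) (ht : IsSmoothExt B F V U t) :
    IsSmoothExt B F V U (s * t) := by
  classical
  intro x₀ ℓ x hx
  let b := (Module.finBasis ℝ (Module.Dual ℝ F)).ExteriorAlgebra
  have key : ∀ y : U, ℓ (extTriv F V x₀ y ((s * t) y)) =
      ∑ i, ∑ j, b.coord i (extTriv F V x₀ y (s y)) * (b.coord j (extTriv F V x₀ y (t y)) *
        ℓ (b i * b j)) := by
    intro y
    rw [Pi.mul_apply, map_mul]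
    conv_lhs => rw [← b.sum_repr (extTriv F V x₀ y (s y)), ← b.sum_repr (extTriv F V x₀ y (t y))]
    simp only [Finset.sum_mul, Finset.mul_sum, Module.Basis.coord_apply, map_sum, smul_mul_smul_comm,
      map_smul, smul_eq_mul]
    rw [Finset.sum_comm]
    refine Finset.sum_congr rfl fun i _ => Finset.sum_congr rfl fun j _ => ?_
    ring
  simp only [key]
  exact ContMDiffAt.sum fun i _ => ContMDiffAt.sum fun j _ =>
    (hs x₀ (b.coord i) x hx).mul ((ht x₀ (b.coord j) x hx).mul contMDiffAt_const)

theorem extTriv_involute (x₀ x : M) (a : ExtFiber V x) :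
    extTriv F V x₀ x (CliffordAlgebra.involute a) =
      CliffordAlgebra.involute (extTriv F V x₀ x a) := by
  have h : (extTriv F V x₀ x).comp CliffordAlgebra.involute =
      (CliffordAlgebra.involute (Q := (0 : QuadraticForm ℝ (Module.Dual ℝ F)))).comp
        (extTriv F V x₀ x) := by
    apply ExteriorAlgebra.hom_ext
    ext m : 1
    have h1 : CliffordAlgebra.involute (ExteriorAlgebra.ι ℝ m) = -(ExteriorAlgebra.ι ℝ m) :=
      CliffordAlgebra.involute_ι m
    have h2 : ∀ m' : Module.Dual ℝ F,
        CliffordAlgebra.involute (ExteriorAlgebra.ι ℝ m') = -(ExteriorAlgebra.ι ℝ m') :=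
      fun m' => CliffordAlgebra.involute_ι m'
    simp only [AlgHom.comp_toLinearMap, LinearMap.comp_apply, AlgHom.toLinearMap_apply, h1, map_neg,
      extTriv, ExteriorAlgebra.map_apply_ι, h2]
  exact DFunLike.congr_fun h a

theorem exists_parity_parts (x : M) (a : ExtFiber V x) :
    (1 / 2 : ℝ) • (a + CliffordAlgebra.involute a) ∈
        CliffordAlgebra.evenOdd (0 : QuadraticForm ℝ (Module.Dual ℝ (V x))) 0 ∧
      (1 / 2 : ℝ) • (a - CliffordAlgebra.involute a) ∈
        CliffordAlgebra.evenOdd (0 : QuadraticForm ℝ (Module.Dual ℝ (V x))) 1 := by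
  have h : a ∈ CliffordAlgebra.evenOdd (0 : QuadraticForm ℝ (Module.Dual ℝ (V x))) 0 ⊔
      CliffordAlgebra.evenOdd (0 : QuadraticForm ℝ (Module.Dual ℝ (V x))) 1 := by
    rw [(CliffordAlgebra.evenOdd_isCompl _).sup_eq_top]
    trivial
  obtain ⟨b, hb, c, hc, rfl⟩ := Submodule.mem_sup.1 h
  rw [map_add, CliffordAlgebra.involute_eq_of_mem_even hb,
    CliffordAlgebra.involute_eq_of_mem_odd hc]
  constructor
  · convert hb using 1
    module
  · convert hc using 1
    module

/-- The sheaf of superfunctions of `Π E`: smooth sections of `Λ E*`, with its usual parity. -/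
def superFunctions : SuperSheaf M where
  fiber x := ExtFiber V x
  parity x := CliffordAlgebra.evenOdd (0 : QuadraticForm ℝ (Module.Dual ℝ (V x)))
  parity_disjoint x := (CliffordAlgebra.evenOdd_isCompl _).disjoint
  parity_mul_mem x p q a b ha hb := SetLike.mul_mem_graded ha hb
  parity_mul_comm x p q a b ha hb := by
    have h := CliffordAlgebra.map_mul_map_of_isOrtho_of_mem_evenOdd
      (Qₙ := (0 : QuadraticForm ℝ (Module.Dual ℝ (V x))))
      (QuadraticMap.Isometry.id _) (QuadraticMap.Isometry.id _)
      (fun _ _ => by simp [QuadraticMap.IsOrtho]) a b ha hb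
    simp only [CliffordAlgebra.map_id, AlgHom.coe_id, id_eq] at h
    rw [h]
    have h' : ∀ a : ZMod 2, a = 0 ∨ a = 1 := by decide
    rcases h' p with rfl | rfl <;> rcases h' q with rfl | rfl <;> simp [koszul]
  sec U :=
    { carrier := {s | IsSmoothExt B F V U s}
      mul_mem' := fun hs ht => hs.mul B F V ht
      add_mem' := fun hs ht x₀ ℓ x hx => by
        have h := (hs x₀ ℓ x hx).add (ht x₀ ℓ x hx)
        refine h.congr_of_eventuallyEq (Filter.Eventually.of_forall fun y => ?_)
        simp
      algebraMap_mem' := fun r x₀ ℓ x hx => by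
        simpa using contMDiffAt_const }
  res_mem U W h s hs x₀ ℓ x hx := (contMDiffAt_restrict_iff h _ x).2 (hs x₀ ℓ _ hx)
  locality U s hs x₀ ℓ x hx := by
    obtain ⟨W, h, hxW, hW⟩ := hs x
    exact (contMDiffAt_restrict_iff h
      (fun y : U => ℓ (extTriv F V x₀ y (s y))) ⟨x, hxW⟩).1 (hW x₀ ℓ ⟨x, hxW⟩ hx)
  decomp U s hs := by
    have hinv : IsSmoothExt B F V U (fun x => CliffordAlgebra.involute (s x)) := by
      intro x₀ ℓ x hx
      simp only [extTriv_involute]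
      exact hs x₀ (ℓ.comp (CliffordAlgebra.involute
          (Q := (0 : QuadraticForm ℝ (Module.Dual ℝ F)))).toLinearMap) x hx
    refine ⟨fun x => (1 / 2 : ℝ) • (s x + CliffordAlgebra.involute (s x)), ?_,
      fun x => (1 / 2 : ℝ) • (s x - CliffordAlgebra.involute (s x)), ?_,
      fun x : U => (exists_parity_parts V x.1 (s x)).1,
      fun x : U => (exists_parity_parts V x.1 (s x)).2, ?_⟩
    · intro x₀ ℓ x hx
      have h := (contMDiffAt_const (c := (1 / 2 : ℝ))).mul ((hs x₀ ℓ x hx).add (hinv x₀ ℓ x hx))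
      refine h.congr_of_eventuallyEq (Filter.Eventually.of_forall fun y => ?_)
      simp only [map_smul, map_add, smul_eq_mul, Pi.mul_apply, Pi.add_apply]
    · intro x₀ ℓ x hx
      have h := (contMDiffAt_const (c := (1 / 2 : ℝ))).mul ((hs x₀ ℓ x hx).sub (hinv x₀ ℓ x hx))
      refine h.congr_of_eventuallyEq (Filter.Eventually.of_forall fun y => ?_)
      simp only [map_smul, map_sub, smul_eq_mul, Pi.mul_apply]
    · funext x
      simp only [Pi.add_apply]
      module

/-- The sheaf of smooth functions on the total space of `E`. -/
abbrev totalFunctions : SuperSheaf (TotalSpace F V) :=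
  smoothFunctions (𝓘(ℝ, B).prod 𝓘(ℝ, F)) (TotalSpace F V)

/-- The open subset `π⁻¹(U)` of the total space. -/
def above (U : Opens M) : Opens (TotalSpace F V) :=
  ⟨TotalSpace.proj ⁻¹' U, U.2.preimage (FiberBundle.continuous_proj F V)⟩

/-- The bundle projection `π⁻¹(U) → U`. -/
def projAbove {U : Opens M} (e : above F V U) : U := ⟨e.1.proj, e.2⟩

theorem above_mono {U W : Opens M} (h : W ≤ U) : above F V W ≤ above F V U := fun _ he => h he

/-- The projection `pr` of `Λ E*` onto `ℝ ⊕ E*`, fibrewise. -/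
def prFiber (x : M) : ExtFiber V x →ₗ[ℝ] ExtFiber V x :=
  Algebra.linearMap ℝ (ExtFiber V x) ∘ₗ ExteriorAlgebra.algebraMapInv.toLinearMap +
    ExteriorAlgebra.ι ℝ ∘ₗ ExteriorAlgebra.ιInv

/-- Superfunctions over `U` of `ℤ`-degree at most one, i.e. sections of `ℝ ⊕ E*`. -/
def IsDegLeOne {U : Opens M} (s : (superFunctions B F V).Sec U) : Prop :=
  ∀ x : U, ∃ (c : ℝ) (φ : Module.Dual ℝ (V x.1)),
    s.1 x = algebraMap ℝ (ExtFiber V x.1) c + ExteriorAlgebra.ι ℝ φ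

variable [IsManifold 𝓘(ℝ, B) ∞ M] [ContMDiffVectorBundle ∞ F V 𝓘(ℝ, B)]

theorem algebraMapInv_extTriv (x₀ x : M) (a : ExtFiber V x) :
    ExteriorAlgebra.algebraMapInv (extTriv F V x₀ x a) = ExteriorAlgebra.algebraMapInv a := by
  have h : ExteriorAlgebra.algebraMapInv.comp (extTriv F V x₀ x) =
      ExteriorAlgebra.algebraMapInv := by
    apply ExteriorAlgebra.hom_ext
    ext m : 1
    simp [extTriv, ExteriorAlgebra.algebraMapInv]
  exact DFunLike.congr_fun h a

theorem psi_smooth {U : Opens M} (s : (superFunctions B F V).Sec U) :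
    ContMDiff (𝓘(ℝ, B).prod 𝓘(ℝ, F)) 𝓘(ℝ, ℝ) ∞ (fun e : above F V U =>
      ExteriorAlgebra.algebraMapInv (s.1 (projAbove F V e)) +
        (ExteriorAlgebra.ιInv (s.1 (projAbove F V e)) : Module.Dual ℝ (V e.1.proj)) e.1.snd) := by
  intro e₀
  set x₀ : M := e₀.1.proj with hx₀
  set φ := trivializationAt F V x₀ with hφ
  have hx₀φ : x₀ ∈ φ.baseSet := FiberBundle.mem_baseSet_trivializationAt' x₀
  let b := Module.finBasis ℝ F
  -- the projection to the base, on the open subset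
  have hproj : ContMDiffAt (𝓘(ℝ, B).prod 𝓘(ℝ, F)) 𝓘(ℝ, B) ∞
      (fun e : above F V U => projAbove F V e) e₀ := by
    rw [← ContMDiffAt.subtypeVal_comp_iff]
    exact (Bundle.contMDiffAt_proj V).comp e₀ contMDiff_subtype_val.contMDiffAt
  -- the fibre coordinate
  have hfib : ContMDiffAt (𝓘(ℝ, B).prod 𝓘(ℝ, F)) 𝓘(ℝ, F) ∞
      (fun e : above F V U => (φ e.1).2) e₀ := by
    have hmem : e₀.1 ∈ φ.source := by
      rw [φ.mem_source]; exact hx₀φ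
    exact ((φ.contMDiffAt_iff hmem).1 contMDiff_subtype_val.contMDiffAt).2
  have hcoef : ∀ ℓ : Module.Dual ℝ (ExteriorAlgebra ℝ (Module.Dual ℝ F)),
      ContMDiffAt (𝓘(ℝ, B).prod 𝓘(ℝ, F)) 𝓘(ℝ, ℝ) ∞
        (fun e : above F V U => ℓ (extTriv F V x₀ e.1.proj (s.1 (projAbove F V e)))) e₀ := by
    intro ℓ
    exact ContMDiffAt.comp (g := fun y : U => ℓ (extTriv F V x₀ y (s.1 y))) e₀
      (s.2 x₀ ℓ ⟨e₀.1.proj, e₀.2⟩ hx₀φ) hproj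
  have hmain := (hcoef ExteriorAlgebra.algebraMapInv.toLinearMap).add
    (ContMDiffAt.sum (t := Finset.univ) fun i _ => (hcoef
      ((LinearMap.applyₗ (b i) : Module.Dual ℝ F →ₗ[ℝ] ℝ) ∘ₗ ExteriorAlgebra.ιInv)).mul
      ((LinearMap.toContinuousLinearMap (b.coord i)).contMDiff.contMDiffAt.comp e₀ hfib))
  refine hmain.congr_of_eventuallyEq ?_
  have hev : ∀ᶠ e : above F V U in nhds e₀, e.1.proj ∈ φ.baseSet :=
    ((FiberBundle.continuous_proj F V).comp continuous_subtype_val).continuousAt.eventually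
      (φ.open_baseSet.mem_nhds hx₀φ)
  filter_upwards [hev] with e he
  have h1 : e.1.snd = φ.symmL ℝ e.1.proj (φ e.1).2 := by
    have := φ.symmL_continuousLinearMapAt (R := ℝ) he e.1.snd
    rw [Trivialization.continuousLinearMapAt_apply_of_mem ℝ φ he] at this
    exact this.symm
  have h2 : ∀ w : F, (ExteriorAlgebra.ιInv (extTriv F V x₀ e.1.proj (s.1 (projAbove F V e))) :
      Module.Dual ℝ F) w = (ExteriorAlgebra.ιInv (s.1 (projAbove F V e)) :
        Module.Dual ℝ (V e.1.proj)) (φ.symmL ℝ e.1.proj w) := by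
    intro w
    have := DFunLike.congr_fun (ExteriorAlgebra.ιInv_comp_map
      (φ.symmL ℝ e.1.proj).toLinearMap.dualMap) (s.1 (projAbove F V e))
    exact DFunLike.congr_fun this w
  have h3 := algebraMapInv_extTriv F V x₀ e.1.proj (s.1 (projAbove F V e))
  have h4 : ∀ (L : Module.Dual ℝ F) (w : F), L w = ∑ i, L (b i) * b.coord i w := by
    intro L w
    calc L w = L (∑ i, b.repr w i • b i) := by rw [b.sum_repr]
      _ = _ := by
        rw [map_sum]
        exact Finset.sum_congr rfl fun i _ => by
          rw [map_smul, smul_eq_mul, mul_comm, Module.Basis.coord_apply]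
  exact congrArg₂ (· + ·) h3.symm ((congrArg _ h1).trans ((h2 _).symm.trans (h4 _ _)))

/-- The function `e ↦ s₀(π(e)) + s₁(π(e))(e)` on `π⁻¹(U)`, where `s₀` and `s₁` are the components of
the superfunction `s` in degrees zero and one; on superfunctions of degree at most one it is the
identification with the fibrewise affine functions. -/
def psi {U : Opens M} (s : (superFunctions B F V).Sec U) :
    (totalFunctions B F V).Sec (above F V U) :=
  ⟨fun e => ExteriorAlgebra.algebraMapInv (s.1 (projAbove F V e)) +
    (ExteriorAlgebra.ιInv (s.1 (projAbove F V e)) : Module.Dual ℝ (V e.1.proj)) e.1.snd,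
    psi_smooth B F V s⟩

/-- Functions on `π⁻¹(U)` that are pulled back from smooth functions on `U`: the even part of the
sheaf of fibrewise affine functions. -/
def IsBasic {U : Opens M} (g : (totalFunctions B F V).Sec (above F V U)) : Prop :=
  ∃ w : (smoothFunctions 𝓘(ℝ, B) M).Sec U, ∀ e : above F V U, g.1 e = w.1 (projAbove F V e)

/-- Smooth functions on `π⁻¹(U)` that are linear on every fibre: the odd part of the sheaf of
fibrewise affine functions. -/
def IsFibreLinear {U : Opens M} (g : (totalFunctions B F V).Sec (above F V U)) : Prop :=
  ∀ x : U, ∃ φ : Module.Dual ℝ (V x.1), ∀ v : V x.1, g.1 ⟨⟨x.1, v⟩, x.2⟩ = φ v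

/-- Even superderivations over `U` that preserve the superfunctions of degree at most one. -/
def IsEvenLinear {U : Opens M} (D : (superFunctions B F V).Vect U) : Prop :=
  D.1 ∈ (superFunctions B F V).der U 0 ∧
    ∀ (W : Opens M) (h : W ≤ U) (s : (superFunctions B F V).Sec W),
      IsDegLeOne B F V s → IsDegLeOne B F V (SuperSheaf.app D h s)

/-- Vector fields on `π⁻¹(U)` that preserve the fibrewise affine functions together with their
parity (basic functions being even and fibrewise linear functions being odd). -/
def IsEvenLinearAbove {U : Opens M} (D : (totalFunctions B F V).Vect (above F V U)) : Prop :=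
  ∀ (W : Opens M) (h : W ≤ U) (g : (totalFunctions B F V).Sec (above F V W)),
    (IsBasic B F V g → IsBasic B F V (SuperSheaf.app D (above_mono F V h) g)) ∧
    (IsFibreLinear B F V g → IsFibreLinear B F V (SuperSheaf.app D (above_mono F V h) g))

/-- The vector field `D'` on `π⁻¹(U)` acts on the fibrewise affine functions as the superderivation
`D` acts on the superfunctions of degree at most one: `D' (ψ s) = ψ (D s)`. -/
def PsiRelated {U : Opens M} (D : (superFunctions B F V).Vect U)
    (D' : (totalFunctions B F V).Vect (above F V U)) : Prop :=
  ∀ (W : Opens M) (h : W ≤ U) (s : (superFunctions B F V).Sec W), IsDegLeOne B F V s →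
    SuperSheaf.app D' (above_mono F V h) (psi B F V s) = psi B F V (SuperSheaf.app D h s)

/-- `Z = p(D)`: the superderivation `Z` is even, preserves the superfunctions of degree at most one,
and acts on these as `pr ∘ D`. -/
def IsProjOf {U : Opens M} (Z D : (superFunctions B F V).Vect U) : Prop :=
  IsEvenLinear B F V Z ∧
    ∀ (W : Opens M) (h : W ≤ U) (s : (superFunctions B F V).Sec W), IsDegLeOne B F V s →
      ∀ x : W, (SuperSheaf.app Z h s).1 x = prFiber V x.1 ((SuperSheaf.app D h s).1 x)

/-- A connection on the total space `E` is induced by a connection on `Π E` if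
`∇'_{X'} Y' = Ψ(p(∇_X Y))` whenever `X' = Ψ(X)` and `Y' = Ψ(Y)`, where `X`, `Y` are even
superderivations that preserve the superfunctions of degree at most one and `Ψ` is the transport
of such superderivations to `E`. -/
def IsInducedBy (conn' : (totalFunctions B F V).Connection)
    (conn : (superFunctions B F V).Connection) : Prop :=
  ∀ (U : Opens M) (X Y Z : (superFunctions B F V).Vect U)
    (X' Y' : (totalFunctions B F V).Vect (above F V U)),
    IsEvenLinear B F V X → IsEvenLinear B F V Y →
    IsEvenLinearAbove B F V X' → IsEvenLinearAbove B F V Y' →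
    PsiRelated B F V X X' → PsiRelated B F V Y Y' → IsProjOf B F V Z (conn.1 U X Y) →
    IsEvenLinearAbove B F V (conn'.1 (above F V U) X' Y') ∧
      PsiRelated B F V Z (conn'.1 (above F V U) X' Y')

end Bundle

end

open Bundle TopologicalSpace
open scoped Manifold ContDiff

noncomputable section

universe u v

/-! ### Calculus of sections and vector fields on an abstract super sheaf. -/

namespace SuperSheaf

variable {X : Type u} [TopologicalSpace X] {O : SuperSheaf.{u, v} X}

/-! The proof compares coordinates. Where `M` has a chart and `E` a trivialization, `Π E` has
coordinates `x_i, η_j` and `E` has fibrewise affine coordinates `x_i, y_j`; the map `ψ` sends the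
first system to the second (`psiHom_superFrame_coord`). On either side a homogeneous vector field is
determined by its values on the coordinates, and these can be prescribed freely with the right
parities (`Frame`). Behind this is the chain rule for functions of the `x_i`, proved by Hadamard's
lemma once for all even pullbacks (`EvenPullback.app_hom`).

The map `ψ` forgets degrees two and higher. Modulo these degrees the exterior algebra is a trivial
square-zero extension, so `ψ` is not multiplicative, but `ψ(st) = ψ(s)ψ(t)` as soon as one factor is
even. Therefore `X' ∘ ψ = ψ ∘ X` on `ℱ` may be tested on coordinates (`psiRelated_of_coord`). This
yields local transports in both directions; uniqueness makes them agree on overlaps, and they glue.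
The transport exists for every even `D`, not only for those preserving `ℱ`. Since `ψ` is injective
on `ℱ` and `ψ ∘ pr = ψ`, the field `p(D)` is the unique element of `𝓛` with the same transport as
`D`, which is how `p` is obtained.

For even `X`, `Y` one has `(∇_X Y)(z_c) = X(Y z_c) + ∑ Y^b X^a Γ_ab^c`, where `X^a` and `Y^b` have
the parity of their index. After applying `ψ`, the symbol `Γ_ab^c` contributes `ψ(Γ_ab^c)` if `a`
and `b` are both even, only its degree-zero part if exactly one is odd, and nothing if both are odd
(`psiHom_mul_christoffel`). These values serve as Christoffel symbols of a connection over each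
trivializing open set of `E` (`isLocallyInduced_inducedNabla`).

For uniqueness, `∂/∂x_i` and `η_j ∂/∂η_j` lie in `𝓛` and correspond to `∂/∂x_i` and `y_j ∂/∂y_j`. An
induced connection is prescribed on the latter fields, and the factors `y_j` can be cancelled
because `y_j g = 0` forces `g = 0` for smooth `g` (`Frame.eq_zero_of_coord_mul`). Uniqueness on
overlaps replaces the transformation law of Christoffel symbols, so the local connections glue. The
formula with auxiliary functions is the Leibniz rule applied to `∇_{hX'}(kY')`. -/

theorem Sec.ext' {U : Opens X} {f g : O.Sec U} (h : ∀ x, f.1 x = g.1 x) : f = g :=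
  Subtype.ext (funext h)

theorem Sec.add_val {U : Opens X} (f g : O.Sec U) (x : U) : (f + g).1 x = f.1 x + g.1 x := rfl

theorem Sec.mul_val {U : Opens X} (f g : O.Sec U) (x : U) : (f * g).1 x = f.1 x * g.1 x := rfl

theorem Sec.sum_val {U : Opens X} {ι : Type*} (s : Finset ι) (f : ι → O.Sec U) (x : U) :
    (∑ i ∈ s, f i).1 x = ∑ i ∈ s, (f i).1 x := by
  classical
  induction s using Finset.induction_on with
  | empty => rfl
  | insert a s ha ih => rw [Finset.sum_insert ha, Finset.sum_insert ha, ← ih]; rfl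

theorem zmod_two_eq (p : ZMod 2) : p = 0 ∨ p = 1 := by
  revert p; decide

theorem koszul_zero_left (q : ZMod 2) : koszul 0 q = 1 := by simp [koszul]

theorem koszul_zero_right (q : ZMod 2) : koszul q 0 = 1 := by simp [koszul]

theorem Vect.ext' {U : Opens X} {D D' : O.Vect U}
    (h : ∀ (W : Opens X) (h : W ≤ U) (f : O.Sec W), app D h f = app D' h f) : D = D' :=
  Subtype.ext (funext fun W => LinearMap.ext fun f => h W.1 W.2 f)

theorem exists_homogeneous_parts {U : Opens X} (D : O.Vect U) :
    ∃ D₀ D₁ : O.Vect U, D₀.1 ∈ O.der U 0 ∧ D₁.1 ∈ O.der U 1 ∧ D = D₀ + D₁ := by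
  obtain ⟨a, ha, b, hb, h⟩ := Submodule.mem_sup.1 D.2
  exact ⟨⟨a, der_le_tan _ _ ha⟩, ⟨b, der_le_tan _ _ hb⟩, ha, hb, Subtype.ext h.symm⟩

theorem add_app {U W : Opens X} (D D' : O.Vect U) (h : W ≤ U) (f : O.Sec W) :
    app (D + D') h f = app D h f + app D' h f := rfl

theorem sub_app {U W : Opens X} (D D' : O.Vect U) (h : W ≤ U) (f : O.Sec W) :
    app (D - D') h f = app D h f - app D' h f := rfl

theorem smul_app {U W : Opens X} (c : ℝ) (D : O.Vect U) (h : W ≤ U) (f : O.Sec W) :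
    app (c • D) h f = c • app D h f := rfl

theorem zero_app {U W : Opens X} (h : W ≤ U) (f : O.Sec W) :
    app (0 : O.Vect U) h f = 0 := rfl

theorem sum_app {U W : Opens X} {ι : Type*} (s : Finset ι) (D : ι → O.Vect U) (h : W ≤ U)
    (f : O.Sec W) : app (∑ i ∈ s, D i) h f = ∑ i ∈ s, app (D i) h f := by
  classical
  induction s using Finset.induction_on with
  | empty => simp [zero_app]
  | insert a s ha ih => rw [Finset.sum_insert ha, Finset.sum_insert ha, add_app, ih]

theorem resVect_app {U W V : Opens X} (h : W ≤ U) (D : O.Vect U) (h' : V ≤ W) (f : O.Sec V) :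
    app (resVect h D) h' f = app D (h'.trans h) f := rfl

theorem res_self {U : Opens X} (h : U ≤ U) (f : O.Sec U) : O.res h f = f := rfl

theorem mulVect_app {U W : Opens X} (f : O.Sec U) (D : O.Vect U) (h : W ≤ U) (g : O.Sec W) :
    app (mulVect f D) h g = O.res h f * app D h g := rfl

theorem resVect_mulVect {U W : Opens X} (h : W ≤ U) (f : O.Sec U) (D : O.Vect U) :
    resVect h (mulVect f D) = mulVect (O.res h f) (resVect h D) := rfl

theorem mul_mulVect {U : Opens X} (f g : O.Sec U) (D : O.Vect U) :
    mulVect (f * g) D = mulVect f (mulVect g D) :=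
  Vect.ext' fun W h k => by simp only [mulVect_app, map_mul, mul_assoc]

theorem smul_mulVect {U : Opens X} (c : ℝ) (f : O.Sec U) (D : O.Vect U) :
    mulVect (c • f) D = c • mulVect f D :=
  Vect.ext' fun W h k => by simp only [mulVect_app, smul_app, map_smul, smul_mul_assoc]

theorem zero_mulVect {U : Opens X} (D : O.Vect U) : mulVect 0 D = 0 :=
  Vect.ext' fun W h k => by simp only [mulVect_app, zero_app, map_zero, zero_mul]

theorem one_mulVect {U : Opens X} (D : O.Vect U) : mulVect 1 D = D :=
  Vect.ext' fun W h k => by simp only [mulVect_app, map_one, one_mul]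

/-- Vector fields are compatible with restriction. -/
theorem res_app {U W V : Opens X} (D : O.Vect U) (h : W ≤ U) (h' : V ≤ W) (f : O.Sec W) :
    O.res h' (app D h f) = app D (h'.trans h) (O.res h' f) := by
  obtain ⟨D₀, D₁, h₀, h₁, rfl⟩ := exists_homogeneous_parts D
  rw [add_app, add_app, map_add]
  exact congrArg₂ (· + ·) (h₀.1 ⟨W, h⟩ ⟨V, h'.trans h⟩ h' f) (h₁.1 ⟨W, h⟩ ⟨V, h'.trans h⟩ h' f)

theorem app_mem_par {U W : Opens X} {p q : ZMod 2} {D : O.Vect U} (hD : D.1 ∈ O.der U p)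
    (h : W ≤ U) {f : O.Sec W} (hf : f ∈ O.par W q) : app D h f ∈ O.par W (p + q) :=
  hD.2.1 ⟨W, h⟩ q f hf

theorem app_mul {U W : Opens X} {p q : ZMod 2} {D : O.Vect U} (hD : D.1 ∈ O.der U p)
    (h : W ≤ U) {f : O.Sec W} (hf : f ∈ O.par W q) (g : O.Sec W) :
    app D h (f * g) = app D h f * g + koszul p q • (f * app D h g) :=
  hD.2.2 ⟨W, h⟩ q f hf g

/-- The Koszul sign is trivial for an even first factor, so no homogeneity of the vector field is
needed. This is the form of the Leibniz rule used for functions from the base. -/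
theorem app_mul_of_even_left {U W : Opens X} (D : O.Vect U)
    (h : W ≤ U) {f : O.Sec W} (hf : f ∈ O.par W 0) (g : O.Sec W) :
    app D h (f * g) = app D h f * g + f * app D h g := by
  obtain ⟨D₀, D₁, h₀, h₁, rfl⟩ := exists_homogeneous_parts D
  simp only [add_app, app_mul h₀ h hf, app_mul h₁ h hf, koszul_zero_right, one_smul, add_mul,
    mul_add]
  abel

theorem app_mul_of_even {U W : Opens X} {D : O.Vect U} (hD : D.1 ∈ O.der U 0)
    (h : W ≤ U) (f g : O.Sec W) : app D h (f * g) = app D h f * g + f * app D h g := by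
  obtain ⟨f₀, h₀, f₁, h₁, rfl⟩ := exists_parts f
  simp only [map_add, app_mul hD h h₀, app_mul hD h h₁, koszul_zero_left, one_smul, add_mul]
  abel

/-- Evenness of the unit is not an axiom of `SuperSheaf`. Write `1 = f₀ + f₁`. In `f₀ = f₀f₀ + f₀f₁`
the odd term must vanish; then `f₁ = f₁f₁` is both odd and even, hence zero. -/
theorem one_mem_par {U : Opens X} : (1 : O.Sec U) ∈ O.par U 0 := by
  obtain ⟨f₀, h₀, f₁, h₁, h⟩ := exists_parts (1 : O.Sec U)
  have h00 : f₀ * f₀ ∈ O.par U 0 := fun x =>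
    O.parity_mul_mem x 0 0 _ _ (h₀ x) (h₀ x)
  have h01 : f₀ * f₁ ∈ O.par U 1 := fun x =>
    O.parity_mul_mem x 0 1 _ _ (h₀ x) (h₁ x)
  have h11 : f₁ * f₁ ∈ O.par U 0 := fun x => O.parity_mul_mem x 1 1 _ _ (h₁ x) (h₁ x)
  have e0 : f₀ * f₀ + f₀ * f₁ = f₀ := by rw [← mul_add, ← h, mul_one]
  have hd : ∀ a ∈ O.par U 0, a ∈ O.par U 1 → a = 0 := fun a ha ha' =>
    Sec.ext' fun x => (Submodule.disjoint_def.1 (O.parity_disjoint x)) _ (ha x) (ha' x)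
  have e1 : f₀ * f₁ = 0 := by
    refine hd _ ?_ h01
    have : f₀ * f₁ = f₀ - f₀ * f₀ := eq_sub_of_add_eq' e0
    rw [this]
    exact Submodule.sub_mem _ h₀ h00
  have e2 : f₁ = f₁ * f₁ := by
    have : f₀ * f₁ + f₁ * f₁ = f₁ := by rw [← add_mul, ← h, one_mul]
    rw [e1, zero_add] at this
    exact this.symm
  have e3 : f₁ = 0 := hd _ (e2 ▸ h11) h₁
  rw [h, e3, add_zero]
  exact h₀

theorem app_one {U W : Opens X} (D : O.Vect U) (h : W ≤ U) : app D h (1 : O.Sec W) = 0 := by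
  have := app_mul_of_even_left D h (one_mem_par (O := O) (U := W)) 1
  simpa using this

theorem app_algebraMap {U W : Opens X} (D : O.Vect U) (h : W ≤ U) (c : ℝ) :
    app D h (algebraMap ℝ (O.Sec W) c) = 0 := by
  rw [Algebra.algebraMap_eq_smul_one, map_smul, app_one, smul_zero]

theorem res_mem_par {U W : Opens X} (h : W ≤ U) {p : ZMod 2} {f : O.Sec U} (hf : f ∈ O.par U p) :
    O.res h f ∈ O.par W p := fun x => hf ⟨x.1, h x.2⟩

theorem resVect_mem_der {U W : Opens X} (h : W ≤ U) {p : ZMod 2} {D : O.Vect U}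
    (hD : D.1 ∈ O.der U p) : (resVect h D).1 ∈ O.der W p := resOps_der h p hD

theorem mulVect_mem_der {U : Opens X} {p q : ZMod 2} {f : O.Sec U} (hf : f ∈ O.par U q)
    {D : O.Vect U} (hD : D.1 ∈ O.der U p) : (mulVect f D).1 ∈ O.der U (q + p) := mulOps_der hf p hD

theorem sum_mem_der {U : Opens X} {p : ZMod 2} {ι : Type*} (s : Finset ι) {D : ι → O.Vect U}
    (hD : ∀ i ∈ s, (D i).1 ∈ O.der U p) : (∑ i ∈ s, D i).1 ∈ O.der U p := by
  classical
  induction s using Finset.induction_on with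
  | empty => exact Submodule.zero_mem _
  | insert a s ha ih =>
    rw [Finset.sum_insert ha]
    exact Submodule.add_mem _ (hD a (Finset.mem_insert_self _ _))
      (ih fun i hi => hD i (Finset.mem_insert_of_mem hi))

/-- The value at a point only depends on the restriction to a neighbourhood. -/
theorem app_val_of_mem {U W V : Opens X} (D : O.Vect U) (h : W ≤ U) (h' : V ≤ W) (f : O.Sec W)
    (x : X) (hx : x ∈ V) :
    (app D h f).1 ⟨x, h' hx⟩ = (app D (h'.trans h) (O.res h' f)).1 ⟨x, hx⟩ := by
  rw [← res_app]
  rfl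

theorem Vect.eq_of_cover {U : Opens X} {D D' : O.Vect U}
    (H : ∀ x ∈ U, ∃ (W : Opens X) (h : W ≤ U), x ∈ W ∧ resVect h D = resVect h D') : D = D' := by
  refine Vect.ext' fun V hV f => Sec.ext' fun x => ?_
  obtain ⟨W, h, hx, e⟩ := H x.1 (hV x.2)
  rw [app_val_of_mem D hV (inf_le_left : V ⊓ W ≤ V) f x.1 ⟨x.2, hx⟩,
    app_val_of_mem D' hV (inf_le_left : V ⊓ W ≤ V) f x.1 ⟨x.2, hx⟩]
  have e' : app (resVect h D) (inf_le_right : V ⊓ W ≤ W) (O.res inf_le_left f) =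
      app (resVect h D') (inf_le_right : V ⊓ W ≤ W) (O.res inf_le_left f) := by rw [e]
  exact congrArg (fun s => s.1 ⟨x.1, ⟨x.2, hx⟩⟩) e'

/-- Homogeneous vector fields glue. -/
theorem exists_glue {U : Opens X} {ι : Type*} (p : ZMod 2) (W : ι → Opens X) (hW : ∀ i, W i ≤ U)
    (cov : ∀ x ∈ U, ∃ i, x ∈ W i) (D : ∀ i, O.Vect (W i)) (hD : ∀ i, (D i).1 ∈ O.der (W i) p)
    (compat : ∀ i j, resVect (inf_le_left : W i ⊓ W j ≤ W i) (D i) =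
      resVect (inf_le_right : W i ⊓ W j ≤ W j) (D j)) :
    ∃ Z : O.Vect U, Z.1 ∈ O.der U p ∧ ∀ i, resVect (hW i) Z = D i := by
  choose idx hidx using cov
  -- On the overlap of two members of the cover the fields agree, so the value at `x` does not
  -- depend on the member used to compute it.
  have indep : ∀ (V : Opens X) (f : O.Sec V) (x : X) (hx : x ∈ V) (i j : ι) (hi : x ∈ W i)
      (hj : x ∈ W j),
      (app (D i) (inf_le_right : V ⊓ W i ≤ W i) (O.res inf_le_left f)).1 ⟨x, hx, hi⟩ =
      (app (D j) (inf_le_right : V ⊓ W j ≤ W j) (O.res inf_le_left f)).1 ⟨x, hx, hj⟩ := by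
    intro V f x hx i j hi hj
    rw [app_val_of_mem (D i) _ (inf_le_inf_left V inf_le_left : V ⊓ (W i ⊓ W j) ≤ V ⊓ W i) _ x
        ⟨hx, hi, hj⟩,
      app_val_of_mem (D j) _ (inf_le_inf_left V inf_le_right : V ⊓ (W i ⊓ W j) ≤ V ⊓ W j) _ x
        ⟨hx, hi, hj⟩]
    have e := congrArg (fun Z => (app Z (inf_le_right : V ⊓ (W i ⊓ W j) ≤ W i ⊓ W j)
      (O.res inf_le_left f)).1 ⟨x, hx, hi, hj⟩) (compat i j)
    exact e
  let val : ∀ (V : Opens X) (_ : V ≤ U) (f : O.Sec V) (x : V), O.fiber x := fun V hV f x =>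
    (app (D (idx x.1 (hV x.2))) (inf_le_right : V ⊓ W (idx x.1 (hV x.2)) ≤ _)
      (O.res inf_le_left f)).1 ⟨x.1, x.2, hidx x.1 (hV x.2)⟩
  have val_eq : ∀ (V : Opens X) (hV : V ≤ U) (f : O.Sec V) (x : V) (i : ι) (hi : x.1 ∈ W i),
      val V hV f x = (app (D i) (inf_le_right : V ⊓ W i ≤ W i) (O.res inf_le_left f)).1
        ⟨x.1, x.2, hi⟩ := fun V hV f x i hi => indep V f x.1 x.2 _ i (hidx _ _) hi
  have val_mem : ∀ (V : Opens X) (hV : V ≤ U) (f : O.Sec V), val V hV f ∈ O.sec V := by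
    intro V hV f
    -- Near `x` a single member of the cover computes all values, so the pointwise definition is
    -- locally a section.
    refine O.locality V _ fun x => ⟨V ⊓ W (idx x.1 (hV x.2)), inf_le_left,
      ⟨x.2, hidx x.1 (hV x.2)⟩, ?_⟩
    convert (app (D (idx x.1 (hV x.2))) (inf_le_right : V ⊓ W (idx x.1 (hV x.2)) ≤ _)
      (O.res inf_le_left f)).2 using 1
    funext y
    exact val_eq V hV f ⟨y.1, y.2.1⟩ _ y.2.2
  let Z : O.Ops U := fun V =>
    { toFun := fun f => (⟨val V.1 V.2 f, val_mem V.1 V.2 f⟩ : O.sec V.1)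
      map_add' := fun f g => Sec.ext' fun x => by
        change val V.1 V.2 (f + g) x = val V.1 V.2 f x + val V.1 V.2 g x
        simp only [val, map_add]
        rfl
      map_smul' := fun c f => Sec.ext' fun x => by
        change val V.1 V.2 (c • f) x = c • val V.1 V.2 f x
        simp only [val, map_smul]
        rfl }
  have hZ : Z ∈ O.der U p := by
    refine ⟨fun V V' h f => Sec.ext' fun x => ?_, fun V q f hf x => ?_, fun V q f hf g =>
      Sec.ext' fun x => ?_⟩
    · change val V.1 V.2 f ⟨x.1, h x.2⟩ = val V'.1 V'.2 (O.res h f) x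
      rw [val_eq V.1 V.2 f ⟨x.1, h x.2⟩ (idx x.1 (V'.2 x.2)) (hidx _ _),
        app_val_of_mem _ _ (inf_le_inf_right _ h) _ _ ⟨x.2, hidx _ _⟩]
      rfl
    · exact app_mem_par (hD (idx x.1 (V.2 x.2)))
        (inf_le_right : V.1 ⊓ W (idx x.1 (V.2 x.2)) ≤ _)
        (res_mem_par inf_le_left hf) ⟨x.1, x.2, hidx x.1 (V.2 x.2)⟩
    · have := app_mul (hD (idx x.1 (V.2 x.2))) (inf_le_right : V.1 ⊓ W (idx x.1 (V.2 x.2)) ≤ _)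
        (res_mem_par inf_le_left hf) (O.res inf_le_left g)
      rw [← map_mul] at this
      exact congrArg (fun s : O.Sec (V.1 ⊓ W (idx x.1 (V.2 x.2))) =>
        s.1 ⟨x.1, x.2, hidx x.1 (V.2 x.2)⟩) this
  refine ⟨⟨Z, der_le_tan _ _ hZ⟩, hZ, fun i => Vect.ext' fun V hV f => Sec.ext' fun x => ?_⟩
  refine (val_eq V (hV.trans (hW i)) f x i (hV x.2)).trans ?_
  exact (app_val_of_mem (D i) hV (inf_le_left : V ⊓ W i ≤ V) f x.1 ⟨x.2, hV x.2⟩).symm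

/-! ### Frames: vector fields determined by their values on coordinates. -/

variable (O) in
/-- Homogeneous coordinates over `W` together with the dual frame of vector fields. -/
structure Frame (W : Opens X) (ι : Type*) where
  parity : ι → ZMod 2
  coord : ι → O.Sec W
  vect : ι → O.Vect W
  coord_mem : ∀ a, coord a ∈ O.par W (parity a)
  vect_mem : ∀ a, (vect a).1 ∈ O.der W (parity a)
  vect_coord : ∀ a, app (vect a) le_rfl (coord a) = 1
  vect_coord_of_ne : ∀ a b, a ≠ b → app (vect a) le_rfl (coord b) = 0
  -- Required on every smaller open set, so that frames restrict, and only for homogeneous fields,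
  -- so that the Leibniz rule has a definite sign.
  eq_zero : ∀ (U : Opens X) (h : U ≤ W) (p : ZMod 2) (D : O.Vect U), D.1 ∈ O.der U p →
    (∀ a, app D le_rfl (O.res h (coord a)) = 0) → D = 0

namespace Frame

variable {W : Opens X} {ι : Type*}

/-- Restriction of a frame to a smaller open set. -/
def restrict (R : O.Frame W ι) {U : Opens X} (h : U ≤ W) : O.Frame U ι where
  parity := R.parity
  coord a := O.res h (R.coord a)
  vect a := resVect h (R.vect a)
  coord_mem a := res_mem_par h (R.coord_mem a)
  vect_mem a := resVect_mem_der h (R.vect_mem a)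
  vect_coord a := by rw [resVect_app, ← res_app _ le_rfl, R.vect_coord, map_one]
  vect_coord_of_ne a b hab := by
    rw [resVect_app, ← res_app _ le_rfl, R.vect_coord_of_ne a b hab, map_zero]
  eq_zero V hV p D hD H := R.eq_zero V (hV.trans h) p D hD H

theorem vect_ext (R : O.Frame W ι) {p : ZMod 2} {D D' : O.Vect W} (hD : D.1 ∈ O.der W p)
    (hD' : D'.1 ∈ O.der W p) (H : ∀ a, app D le_rfl (R.coord a) = app D' le_rfl (R.coord a)) :
    D = D' :=
  sub_eq_zero.1 (R.eq_zero W le_rfl p (D - D') (Submodule.sub_mem _ hD hD') fun a => by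
    rw [res_self, sub_app, H, sub_self])

variable [Fintype ι]

/-- The vector field with given values on the coordinates. -/
def mk' (R : O.Frame W ι) (g : ι → O.Sec W) : O.Vect W := ∑ a, mulVect (g a) (R.vect a)

theorem mk'_coord (R : O.Frame W ι) (g : ι → O.Sec W) (a : ι) :
    app (R.mk' g) le_rfl (R.coord a) = g a := by
  classical
  rw [mk', sum_app, Finset.sum_eq_single a]
  · rw [mulVect_app, R.vect_coord, mul_one, res_self]
  · intro b _ hb
    rw [mulVect_app, R.vect_coord_of_ne b a hb, mul_zero]
  · simp

theorem mk'_mem (R : O.Frame W ι) {g : ι → O.Sec W} {p : ZMod 2}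
    (hg : ∀ a, g a ∈ O.par W (p + R.parity a)) : (R.mk' g).1 ∈ O.der W p := by
  refine sum_mem_der _ fun a _ => ?_
  have := mulVect_mem_der (hg a) (R.vect_mem a)
  rwa [add_assoc, CharTwo.add_self_eq_zero, add_zero] at this

theorem eq_mk' (R : O.Frame W ι) {p : ZMod 2} {D : O.Vect W} (hD : D.1 ∈ O.der W p) :
    D = R.mk' fun a => app D le_rfl (R.coord a) :=
  R.vect_ext hD (R.mk'_mem fun a => app_mem_par hD _ (R.coord_mem a)) fun a => by rw [mk'_coord]

end Frame

end SuperSheaf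

/-! ### Hadamard's lemma with smooth coefficients. -/

section Hadamard

variable {E : Type*} [NormedAddCommGroup E] [NormedSpace ℝ E] [FiniteDimensional ℝ E]

/-- Differentiation under the integral sign: in finite dimension the derivative is bounded on the
compact set `closedBall z 1 × [0,1]`, and the bound serves as dominating constant. -/
theorem hasFDerivAt_intervalIntegral_of_contDiff {G : E × ℝ → ℝ} (hG : ContDiff ℝ 1 G) (z : E) :
    HasFDerivAt (fun z => ∫ t in (0 : ℝ)..1, G (z, t))
      (∫ t in (0 : ℝ)..1, (fderiv ℝ G (z, t)).comp (ContinuousLinearMap.inl ℝ E ℝ)) z := by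
  have hc : Continuous fun q : E × ℝ =>
      (fderiv ℝ G q).comp (ContinuousLinearMap.inl ℝ E ℝ) :=
    (hG.continuous_fderiv one_ne_zero).clm_comp continuous_const
  obtain ⟨C, hC⟩ := ((isCompact_closedBall z 1).prod (isCompact_Icc (a := (0 : ℝ)) (b := 1)))
    |>.exists_bound_of_continuousOn hc.continuousOn
  refine intervalIntegral.hasFDerivAt_integral_of_dominated_of_fderiv_le
    (F := fun z t => G (z, t))
    (F' := fun z t => (fderiv ℝ G (z, t)).comp (ContinuousLinearMap.inl ℝ E ℝ))
    (bound := fun _ => C) (Metric.ball_mem_nhds z one_pos)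
    (Filter.Eventually.of_forall fun w => ?_) ?_ ?_ ?_ ?_ ?_
  · exact (hG.continuous.comp (by fun_prop : Continuous fun t : ℝ => (w, t))).aestronglyMeasurable
  · exact (hG.continuous.comp
      (by fun_prop : Continuous fun t : ℝ => (z, t))).intervalIntegrable _ _
  · exact (hc.comp (by fun_prop : Continuous fun t : ℝ => (z, t))).aestronglyMeasurable
  · refine Filter.Eventually.of_forall fun t ht w hw => hC (w, t) ⟨Metric.ball_subset_closedBall hw, ?_⟩
    rw [Set.uIoc_of_le zero_le_one] at ht
    exact Set.Ioc_subset_Icc_self ht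
  · exact intervalIntegrable_const
  · refine Filter.Eventually.of_forall fun t _ w _ => ?_
    exact ((hG.differentiable one_ne_zero (w, t)).hasFDerivAt).comp w
      (hasFDerivAt_prodMk_left w t)

/-- Each directional derivative of the parametric integral is again such an integral, with a smooth
integrand, so induction on the order of differentiability works when `G` is kept general. -/
theorem contDiff_intervalIntegral {G : E × ℝ → ℝ} (hG : ContDiff ℝ ∞ G) :
    ContDiff ℝ ∞ fun z => ∫ t in (0 : ℝ)..1, G (z, t) := by
  rw [contDiff_infty]
  intro n
  induction n generalizing G with
  | zero =>
    rw [Nat.cast_zero, contDiff_zero]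
    exact intervalIntegral.continuous_parametric_intervalIntegral_of_continuous'
      (f := fun z t => G (z, t)) hG.continuous 0 1
  | succ n ih =>
    have h1 : ContDiff ℝ 1 G := hG.of_le (by exact_mod_cast le_top)
    rw [show ((n + 1 : ℕ) : WithTop ℕ∞) = (n : WithTop ℕ∞) + 1 by push_cast; rfl,
      contDiff_succ_iff_fderiv_apply]
    refine ⟨fun z => (hasFDerivAt_intervalIntegral_of_contDiff h1 z).differentiableAt,
      by simp, fun v => ?_⟩
    have hd : ContDiff ℝ ∞ fun q : E × ℝ => fderiv ℝ G q (v, 0) :=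
      (hG.fderiv_right (m := ∞) (by simp)).clm_apply contDiff_const
    convert ih hd using 2 with z
    rw [(hasFDerivAt_intervalIntegral_of_contDiff h1 z).fderiv,
      ContinuousLinearMap.intervalIntegral_apply]
    · rfl
    · exact (((hG.continuous_fderiv (by simp)).clm_comp continuous_const).comp
        (by fun_prop : Continuous fun t : ℝ => (z, t))).intervalIntegrable _ _

/-- Hadamard's lemma. -/
theorem exists_hadamard {ι : Type*} [Fintype ι] (b : Module.Basis ι ℝ E) {f : E → ℝ}
    (hf : ContDiff ℝ ∞ f) (p : E) :
    ∃ g : ι → E → ℝ, (∀ i, ContDiff ℝ ∞ (g i)) ∧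
      ∀ z, f z = f p + ∑ i, (b.repr z i - b.repr p i) * g i z := by
  have hG : ∀ i, ContDiff ℝ ∞ fun q : E × ℝ => fderiv ℝ f (p + q.2 • (q.1 - p)) (b i) := fun i =>
    ((hf.fderiv_right (m := ∞) (by simp)).comp (by fun_prop)).clm_apply contDiff_const
  refine ⟨fun i z => ∫ t in (0 : ℝ)..1, fderiv ℝ f (p + t • (z - p)) (b i),
    fun i => contDiff_intervalIntegral (hG i), fun z => ?_⟩
  -- The coefficients come from integrating the derivative of `f` along the segment from `p` to `z`
  -- and expanding `z - p` in the basis.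
  have hd : ∀ t : ℝ, HasDerivAt (fun t : ℝ => f (p + t • (z - p)))
      (fderiv ℝ f (p + t • (z - p)) (z - p)) t := by
    intro t
    have h2 : HasDerivAt (fun t : ℝ => p + t • (z - p)) (z - p) t := by
      simpa using ((hasDerivAt_id t).smul_const (z - p)).const_add p
    exact ((hf.differentiable (by simp) _).hasFDerivAt).comp_hasDerivAt t h2
  have hcont : ∀ v, Continuous fun t : ℝ => fderiv ℝ f (p + t • (z - p)) v := fun v =>
    ((hf.continuous_fderiv (by simp)).comp (by fun_prop)).clm_apply continuous_const
  have hI := intervalIntegral.integral_eq_sub_of_hasDerivAt (fun t _ => hd t)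
    ((hcont (z - p)).intervalIntegrable 0 1)
  simp only [one_smul, add_sub_cancel, zero_smul, add_zero] at hI
  have hexp : ∀ t : ℝ, fderiv ℝ f (p + t • (z - p)) (z - p) =
      ∑ i, (b.repr z i - b.repr p i) * fderiv ℝ f (p + t • (z - p)) (b i) := by
    intro t
    generalize fderiv ℝ f (p + t • (z - p)) = L
    conv_lhs => rw [← b.sum_repr (z - p), map_sum]
    refine Finset.sum_congr rfl fun i _ => ?_
    rw [map_smul, map_sub, Finsupp.sub_apply, smul_eq_mul]
  simp only [hexp] at hI
  rw [intervalIntegral.integral_finsetSum fun i _ =>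
    ((hcont (b i)).const_mul _).intervalIntegrable _ _] at hI
  simp only [intervalIntegral.integral_const_mul] at hI
  linarith

/-- A function that is smooth near a point agrees near that point with a globally smooth function. -/
theorem exists_contDiff_eventuallyEq {f : E → ℝ} {p : E}
    (hf : ∀ᶠ z in nhds p, ContDiffAt ℝ ∞ f z) :
    ∃ g : E → ℝ, ContDiff ℝ ∞ g ∧ g =ᶠ[nhds p] f := by
  obtain ⟨r, hr, hball⟩ := Metric.eventually_nhds_iff_ball.1 hf
  -- The bump equals one near `p`, and its support, the closed ball of radius `r / 2`, stays inside
  -- the ball where `f` is smooth.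
  let β : ContDiffBump p := ⟨r / 4, r / 2, by positivity, by linarith⟩
  refine ⟨fun z => β z * f z, ?_, ?_⟩
  · refine contMDiff_iff_contDiff.1 (contMDiff_of_tsupport fun z hz => ?_)
    have hz' : z ∈ tsupport β := closure_mono (Function.support_mul_subset_left _ _) hz
    rw [β.tsupport_eq] at hz'
    exact ((β.contDiff.contDiffAt).mul (hball z (Metric.closedBall_subset_ball (by
      change r / 2 < r; linarith) hz'))).contMDiffAt
  · filter_upwards [β.eventuallyEq_one] with z hz
    rw [hz, Pi.one_apply, one_mul]

end Hadamard

/-! ### Smooth functions on a manifold and coordinate vector fields. -/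

namespace SuperSheaf

section SmoothFunctions

variable {E H : Type*} [NormedAddCommGroup E] [NormedSpace ℝ E] [TopologicalSpace H]
  {I : ModelWithCorners ℝ E H} {N : Type u} [TopologicalSpace N] [ChartedSpace H N]

/-- Smooth functions commute. -/
abbrev smoothCommRing (U : Opens N) : CommRing ((smoothFunctions I N).Sec U) where
  mul_comm f g := Subtype.ext (funext fun x => mul_comm (G := ℝ) (f.1 x) (g.1 x))

attribute [local instance] smoothCommRing

/-- Evaluation of smooth functions at a point. -/
def evalAt {U : Opens N} (x : U) : (smoothFunctions I N).Sec U →ₐ[ℝ] ℝ where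
  toFun f := f.1 x
  map_one' := rfl
  map_mul' _ _ := rfl
  map_zero' := rfl
  map_add' _ _ := rfl
  commutes' _ := rfl

theorem evalAt_res {U W : Opens N} (h : W ≤ U) (f : (smoothFunctions I N).Sec U) (x : W) :
    evalAt x ((smoothFunctions I N).res h f) = evalAt ⟨x.1, h x.2⟩ f := rfl

theorem evalAt_ext {U : Opens N} {f g : (smoothFunctions I N).Sec U}
    (h : ∀ x, evalAt x f = evalAt x g) : f = g := Sec.ext' h

theorem smooth_mem_par {U : Opens N} (f : (smoothFunctions I N).Sec U) :
    f ∈ (smoothFunctions I N).par U 0 := fun x => by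
  change (f.1 x : ℝ) ∈ (if (0 : ZMod 2) = 0 then (⊤ : Submodule ℝ ℝ) else ⊥)
  rw [if_pos rfl]
  trivial

theorem eq_zero_of_mem_par_one {U : Opens N} {f : (smoothFunctions I N).Sec U}
    (hf : f ∈ (smoothFunctions I N).par U 1) : f = 0 := Sec.ext' fun x => by
  have h : (f.1 x : ℝ) ∈ (if (1 : ZMod 2) = 0 then (⊤ : Submodule ℝ ℝ) else ⊥) := hf x
  rw [if_neg one_ne_zero] at h
  exact (Submodule.mem_bot ℝ).1 h

theorem eq_zero_of_mem_der_one {U : Opens N} {D : (smoothFunctions I N).Vect U}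
    (hD : D.1 ∈ (smoothFunctions I N).der U 1) : D = 0 :=
  Vect.ext' fun _ h f => eq_zero_of_mem_par_one (app_mem_par hD h (smooth_mem_par f))

/-- All sections are even, so an odd derivation maps everything to odd sections, which are zero.
Consequently all signs disappear on the side of `E`. -/
theorem smooth_mem_der {U : Opens N} (D : (smoothFunctions I N).Vect U) :
    D.1 ∈ (smoothFunctions I N).der U 0 := by
  obtain ⟨D₀, D₁, h₀, h₁, rfl⟩ := exists_homogeneous_parts D
  rw [eq_zero_of_mem_der_one h₁, add_zero]
  exact h₀

open Classical in
/-- Extension of a function on an open set by zero. -/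
def extFun {U : Opens N} (f : (smoothFunctions I N).Sec U) : N → ℝ :=
  fun x => if h : x ∈ U then f.1 ⟨x, h⟩ else 0

theorem extFun_of_mem {U : Opens N} (f : (smoothFunctions I N).Sec U) {x : N} (h : x ∈ U) :
    extFun f x = f.1 ⟨x, h⟩ := dif_pos h

theorem extFun_of_notMem {U : Opens N} (f : (smoothFunctions I N).Sec U) {x : N} (h : x ∉ U) :
    extFun f x = 0 := dif_neg h

theorem extFun_add {U : Opens N} (f g : (smoothFunctions I N).Sec U) (x : N) :
    extFun (f + g) x = extFun f x + extFun g x := by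
  by_cases h : x ∈ U
  · simp only [extFun_of_mem _ h]
    rfl
  · simp only [extFun_of_notMem _ h, add_zero]

theorem extFun_mul {U : Opens N} (f g : (smoothFunctions I N).Sec U) (x : N) :
    extFun (f * g) x = extFun f x * extFun g x := by
  by_cases h : x ∈ U
  · simp only [extFun_of_mem _ h]
    rfl
  · simp only [extFun_of_notMem _ h, mul_zero]

theorem extFun_smul {U : Opens N} (c : ℝ) (f : (smoothFunctions I N).Sec U) (x : N) :
    extFun (c • f) x = c • extFun f x := by
  by_cases h : x ∈ U
  · simp only [extFun_of_mem _ h]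
    rfl
  · simp only [extFun_of_notMem _ h, smul_zero]

theorem contMDiffAt_extFun {U : Opens N} (f : (smoothFunctions I N).Sec U) {x : N} (h : x ∈ U) :
    ContMDiffAt I 𝓘(ℝ, ℝ) ∞ (extFun f) x := by
  have h1 : ContMDiffAt I 𝓘(ℝ, ℝ) ∞ (fun y : U => (f.1 y : ℝ)) ⟨x, h⟩ := f.2 ⟨x, h⟩
  have h2 : (fun y : U => (f.1 y : ℝ)) = fun y : U => extFun f y :=
    funext fun y => (extFun_of_mem f y.2).symm
  rw [h2] at h1
  exact (contMDiffAt_subtype_iff (x := ⟨x, h⟩)).1 h1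

theorem extFun_res_eventuallyEq {U W : Opens N} (h : W ≤ U) (f : (smoothFunctions I N).Sec U)
    {x : N} (hx : x ∈ W) : extFun ((smoothFunctions I N).res h f) =ᶠ[nhds x] extFun f := by
  filter_upwards [W.2.mem_nhds hx] with y hy
  rw [extFun_of_mem _ hy, extFun_of_mem _ (h hy)]
  rfl

/-- The smooth function on an open set given by a function that is smooth at its points. -/
def mkSec {U : Opens N} (g : N → ℝ) (hg : ∀ x ∈ U, ContMDiffAt I 𝓘(ℝ, ℝ) ∞ g x) :
    (smoothFunctions I N).Sec U :=
  ⟨fun x => g x, fun x => (contMDiffAt_subtype_iff (f := g)).2 (hg x.1 x.2)⟩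

theorem evalAt_mkSec {U : Opens N} (g : N → ℝ) (hg : ∀ x ∈ U, ContMDiffAt I 𝓘(ℝ, ℝ) ∞ g x)
    (x : U) : evalAt x (mkSec g hg) = g x := rfl

variable (H) in
/-- The domain of the preferred chart at a point. -/
def chartDom (x₀ : N) : Opens N := ⟨(chartAt H x₀).source, (chartAt H x₀).open_source⟩

theorem mem_chartDom {x₀ x : N} (h : x ∈ chartDom H x₀) : x ∈ (extChartAt I x₀).source := by
  rw [extChartAt_source]; exact h

variable [IsManifold I ∞ N]

theorem eventually_symm_mem {x₀ x : N} (hx : x ∈ chartDom H x₀) {P : N → Prop}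
    (hP : ∀ᶠ z in nhds x, P z) :
    ∀ᶠ z in nhds (extChartAt I x₀ x), P ((extChartAt I x₀).symm z) := by
  have h : Filter.Tendsto (extChartAt I x₀).symm (nhds (extChartAt I x₀ x)) (nhds x) := by
    have := continuousAt_extChartAt_symm' (I := I) (mem_chartDom hx)
    rwa [ContinuousAt, (extChartAt I x₀).left_inv (mem_chartDom hx)] at this
  exact h.eventually hP

variable [I.Boundaryless]

theorem contDiffAt_extFun_symm {x₀ : N} {U : Opens N} (f : (smoothFunctions I N).Sec U) {x : N}
    (hx : x ∈ chartDom H x₀) (hU : x ∈ U) :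
    ContDiffAt ℝ ∞ (extFun f ∘ (extChartAt I x₀).symm) (extChartAt I x₀ x) := by
  have hs : ContMDiffAt 𝓘(ℝ, E) I ∞ (extChartAt I x₀).symm (extChartAt I x₀ x) :=
    (contMDiffOn_extChartAt_symm x₀).contMDiffAt
      ((isOpen_extChartAt_target x₀).mem_nhds ((extChartAt I x₀).map_source (mem_chartDom hx)))
  have hf : ContMDiffAt I 𝓘(ℝ, ℝ) ∞ (extFun f)
      ((extChartAt I x₀).symm (extChartAt I x₀ x)) := by
    rw [(extChartAt I x₀).left_inv (mem_chartDom hx)]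
    exact contMDiffAt_extFun f hU
  exact contMDiffAt_iff_contDiffAt.1 (hf.comp _ hs)

/-- The derivative of a smooth function in the direction `v` of the chart at `x₀`. -/
def chartDeriv (x₀ : N) (v : E) {U : Opens N} (f : (smoothFunctions I N).Sec U) (x : N) : ℝ :=
  fderiv ℝ (extFun f ∘ (extChartAt I x₀).symm) (extChartAt I x₀ x) v

theorem chartDeriv_congr {x₀ : N} (v : E) {U W : Opens N} (f : (smoothFunctions I N).Sec U)
    (g : (smoothFunctions I N).Sec W) {x : N} (hx : x ∈ chartDom H x₀)
    (h : extFun f =ᶠ[nhds x] extFun g) : chartDeriv x₀ v f x = chartDeriv x₀ v g x := by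
  have : extFun f ∘ (extChartAt I x₀).symm =ᶠ[nhds (extChartAt I x₀ x)]
      extFun g ∘ (extChartAt I x₀).symm := eventually_symm_mem hx h
  rw [chartDeriv, chartDeriv, this.fderiv_eq]

theorem contMDiffAt_chartDeriv {x₀ : N} (v : E) {U : Opens N} (f : (smoothFunctions I N).Sec U)
    {x : N} (hx : x ∈ chartDom H x₀) (hU : x ∈ U) :
    ContMDiffAt I 𝓘(ℝ, ℝ) ∞ (chartDeriv x₀ v f) x := by
  have h1 : ContDiffAt ℝ ∞ (fun z => fderiv ℝ (extFun f ∘ (extChartAt I x₀).symm) z v)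
      (extChartAt I x₀ x) :=
    ((contDiffAt_extFun_symm f hx hU).fderiv_right (m := ∞) (by simp)).clm_apply contDiffAt_const
  exact h1.contMDiffAt.comp x (contMDiffAt_extChartAt' hx)

/-- The coordinate vector field in the direction `v` of the chart at `x₀`. -/
def chartVect (x₀ : N) (v : E) : (smoothFunctions I N).Vect (chartDom H x₀) := by
  let D : (smoothFunctions I N).Ops (chartDom H x₀) := fun W =>
    { toFun := fun f => mkSec (chartDeriv x₀ v f)
        fun x hx => contMDiffAt_chartDeriv v f (W.2 hx) hx
      map_add' := fun f g => evalAt_ext fun x => by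
        rw [map_add]
        simp only [evalAt_mkSec]
        rw [chartDeriv, chartDeriv, chartDeriv, ← add_apply, ← fderiv_add
          ((contDiffAt_extFun_symm f (W.2 x.2) x.2).differentiableAt (by simp))
          ((contDiffAt_extFun_symm g (W.2 x.2) x.2).differentiableAt (by simp))]
        congr 2
        funext z
        exact extFun_add f g _
      map_smul' := fun c f => evalAt_ext fun x => by
        rw [map_smul, RingHom.id_apply]
        simp only [evalAt_mkSec]
        rw [chartDeriv, chartDeriv, ← smul_apply, ← fderiv_const_smul
          ((contDiffAt_extFun_symm f (W.2 x.2) x.2).differentiableAt (by simp))]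
        congr 2
        funext z
        exact extFun_smul c f _ }
  refine ⟨D, der_le_tan _ 0 ⟨fun W W' h f => evalAt_ext fun x => ?_, fun W q f hf => ?_,
    fun W q f hf g => evalAt_ext fun x => ?_⟩⟩
  · exact (chartDeriv_congr v _ _ (W'.2 x.2) (extFun_res_eventuallyEq h f x.2)).symm
  · rcases zmod_two_eq q with rfl | rfl
    · exact smooth_mem_par _
    · rw [eq_zero_of_mem_par_one hf, map_zero]
      exact Submodule.zero_mem _
  · rw [koszul_zero_left, one_smul]
    have hf := (contDiffAt_extFun_symm f (W.2 x.2) x.2).differentiableAt (by simp)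
    have hg := (contDiffAt_extFun_symm g (W.2 x.2) x.2).differentiableAt (by simp)
    change chartDeriv x₀ v (f * g) x = chartDeriv x₀ v f x * evalAt x g +
      evalAt x f * chartDeriv x₀ v g x
    have hmul : extFun (f * g) ∘ (extChartAt I x₀).symm =
        (extFun f ∘ (extChartAt I x₀).symm) * (extFun g ∘ (extChartAt I x₀).symm) := by
      funext z
      exact extFun_mul f g _
    have hval : ∀ k : (smoothFunctions I N).Sec W.1,
        (extFun k ∘ (extChartAt I x₀).symm) (extChartAt I x₀ x) = evalAt x k := fun k => by
      rw [Function.comp_apply, (extChartAt I x₀).left_inv (mem_chartDom (W.2 x.2)),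
        extFun_of_mem _ x.2]
      rfl
    rw [chartDeriv, hmul, fderiv_mul hf hg, hval, hval]
    simp only [add_apply, smul_apply, smul_eq_mul,
      chartDeriv]
    ring

theorem evalAt_chartVect (x₀ : N) (v : E) {W : Opens N} (h : W ≤ chartDom H x₀)
    (f : (smoothFunctions I N).Sec W) (x : W) :
    evalAt x (app (chartVect x₀ v) h f) = chartDeriv x₀ v f x := rfl

variable [FiniteDimensional ℝ E] {ι : Type*} [Fintype ι] (b : Module.Basis ι ℝ E)

variable (I) in
/-- The coordinates of the chart at `x₀` with respect to a basis of the model space. -/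
def chartCoord (x₀ : N) (i : ι) : (smoothFunctions I N).Sec (chartDom H x₀) :=
  mkSec (fun x => b.repr (extChartAt I x₀ x) i) fun x hx =>
    (LinearMap.toContinuousLinearMap (b.coord i)).contMDiff.contMDiffAt.comp x
      (contMDiffAt_extChartAt' hx)

theorem chartVect_chartCoord [DecidableEq ι] (x₀ : N) (i j : ι) :
    app (chartVect x₀ (b i)) le_rfl (chartCoord I b x₀ j) = if i = j then 1 else 0 := by
  refine evalAt_ext fun x => ?_
  rw [evalAt_chartVect, chartDeriv]
  have h : extFun (chartCoord I b x₀ j) ∘ (extChartAt I x₀).symm =ᶠ[nhds (extChartAt I x₀ x)]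
      LinearMap.toContinuousLinearMap (b.coord j) := by
    filter_upwards [(isOpen_extChartAt_target x₀).mem_nhds
      ((extChartAt I x₀).map_source (mem_chartDom x.2))] with z hz
    have hz' : (extChartAt I x₀).symm z ∈ chartDom H x₀ := by
      have := (extChartAt I x₀).map_target hz
      rwa [extChartAt_source] at this
    rw [Function.comp_apply, extFun_of_mem _ hz']
    change b.repr (extChartAt I x₀ ((extChartAt I x₀).symm z)) j = b.repr z j
    rw [(extChartAt I x₀).right_inv hz]
  rw [h.fderiv_eq, ContinuousLinearMap.fderiv]
  change b.repr (b i) j = _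
  rw [Module.Basis.repr_self, Finsupp.single_apply]
  split_ifs <;> simp

/-- The expansion holds only after shrinking to `V'`, which suffices because vector fields are
local. -/
theorem exists_hadamard_chart {x₀ : N} {V : Opens N} (hV : V ≤ chartDom H x₀)
    (f : (smoothFunctions I N).Sec V) (y : V) :
    ∃ (V' : Opens N) (h : V' ≤ V) (_ : y.1 ∈ V') (g : ι → (smoothFunctions I N).Sec V'),
      (smoothFunctions I N).res h f = algebraMap ℝ _ (evalAt y f) +
        ∑ i, ((smoothFunctions I N).res (h.trans hV) (chartCoord I b x₀ i) -
          algebraMap ℝ _ (evalAt ⟨y.1, hV y.2⟩ (chartCoord I b x₀ i))) * g i := by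
  classical
  set φ := extChartAt I x₀ with hφ
  have hy : y.1 ∈ φ.source := mem_chartDom (hV y.2)
  have hev : ∀ᶠ z in nhds (φ y), ContDiffAt ℝ ∞ (extFun f ∘ φ.symm) z := by
    have h1 := eventually_symm_mem (I := I) (hV y.2) (V.2.mem_nhds y.2)
    filter_upwards [h1, (isOpen_extChartAt_target x₀).mem_nhds (φ.map_source hy)] with z hz hzt
    have := contDiffAt_extFun_symm f (hV hz) hz
    rwa [φ.right_inv hzt] at this
  -- Hadamard's lemma asks for a function smooth on the whole model space; `V'` will be a
  -- neighbourhood on which the replacement agrees with `f`.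
  obtain ⟨F, hF, hFeq⟩ := exists_contDiff_eventuallyEq hev
  obtain ⟨g, hg, hfg⟩ := exists_hadamard b hF (φ y)
  have hnear : ∀ᶠ x in nhds y.1, F (φ x) = (extFun f ∘ φ.symm) (φ x) :=
    (continuousAt_extChartAt' (I := I) hy).eventually hFeq
  obtain ⟨T, hT, hTo, hyT⟩ := mem_nhds_iff.1 hnear
  refine ⟨V ⊓ ⟨T, hTo⟩, inf_le_left, ⟨y.2, hyT⟩, fun i => mkSec (fun x => g i (φ x)) fun x hx =>
    (hg i).contMDiff.contMDiffAt.comp x (contMDiffAt_extChartAt' (hV hx.1)), ?_⟩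
  refine evalAt_ext fun x => ?_
  have hxV : x.1 ∈ V := x.2.1
  have e1 : evalAt x ((smoothFunctions I N).res inf_le_left f) = F (φ x) := by
    rw [hT x.2.2, Function.comp_apply, φ.left_inv (mem_chartDom (hV hxV)), extFun_of_mem _ hxV]
    rfl
  have e2 : evalAt y f = F (φ y) := by
    rw [hFeq.self_of_nhds, Function.comp_apply, φ.left_inv hy, extFun_of_mem _ y.2]
    rfl
  rw [e1, hfg, e2, map_add, map_sum]
  congr 1

/-! ### The chain rule for functions pulled back from a manifold. -/

variable {X : Type*} [TopologicalSpace X]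

/-- A pullback of smooth functions on `N` to even sections of a sheaf over `X`, along a map
`X → N`. -/
structure EvenPullback (I : ModelWithCorners ℝ E H) {N : Type u} [TopologicalSpace N]
    [ChartedSpace H N] (O : SuperSheaf X) where
  proj : X → N
  preim : Opens N → Opens X
  mem_preim : ∀ V x, x ∈ preim V ↔ proj x ∈ V
  hom : ∀ V, (smoothFunctions I N).Sec V →ₐ[ℝ] O.Sec (preim V)
  hom_res : ∀ (V W : Opens N) (h : W ≤ V) (h' : preim W ≤ preim V) (f),
    O.res h' (hom V f) = hom W ((smoothFunctions I N).res h f)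
  hom_mem : ∀ V f, hom V f ∈ O.par (preim V) 0
  -- Vanishing is demanded in the whole fibre, nilpotent directions included. This is what removes
  -- the remainder terms when the Hadamard expansion is evaluated at a point.
  hom_val : ∀ V f (x : preim V), evalAt ⟨proj x.1, (mem_preim V x.1).1 x.2⟩ f = 0 →
    (hom V f).1 x = 0

theorem EvenPullback.mono {O : SuperSheaf X} (τ : EvenPullback I (N := N) O) {V W : Opens N}
    (h : W ≤ V) : τ.preim W ≤ τ.preim V := fun x hx =>
  (τ.mem_preim V x).2 (h ((τ.mem_preim W x).1 hx))

/-- The chain rule for the coordinates of a chart. -/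
theorem EvenPullback.app_hom {O : SuperSheaf X} (τ : EvenPullback I (N := N) O) {x₀ : N}
    {V : Opens N} (hV : V ≤ chartDom H x₀) (D : O.Vect (τ.preim V))
    (f : (smoothFunctions I N).Sec V) :
    app D le_rfl (τ.hom V f) =
      ∑ i, app D le_rfl (τ.hom V ((smoothFunctions I N).res hV (chartCoord I b x₀ i))) *
        τ.hom V (app (chartVect x₀ (b i)) hV f) := by
  classical
  refine Sec.ext' fun x => ?_
  have hxV : τ.proj x.1 ∈ V := (τ.mem_preim V x.1).1 x.2
  obtain ⟨V', h, hy, g, hfg⟩ := exists_hadamard_chart b hV f ⟨τ.proj x.1, hxV⟩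
  have hx' : x.1 ∈ τ.preim V' := (τ.mem_preim V' x.1).2 hy
  -- the coefficients of Hadamard's lemma have the partial derivatives as values
  have hgval : ∀ j, evalAt ⟨τ.proj x.1, hy⟩ (g j) =
      evalAt ⟨τ.proj x.1, hxV⟩ (app (chartVect x₀ (b j)) hV f) := by
    intro j
    have e := congrArg (fun s => evalAt ⟨τ.proj x.1, hy⟩
      (app (chartVect x₀ (b j)) (h.trans hV) s)) hfg
    simp only [map_add, map_sum, app_algebraMap, app_mul_of_even_left _ _ (smooth_mem_par _),
      map_sub, map_mul, ← res_app _ le_rfl, chartVect_chartCoord b, AlgHom.commutes] at e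
    rw [← res_app _ hV h] at e
    refine Eq.trans ?_ e.symm
    rw [map_zero (evalAt _), zero_add, Finset.sum_eq_single j]
    · simp [evalAt_res]
    · intro i _ hij
      rw [if_neg hij.symm]
      simp [evalAt_res]
    · simp
  -- Apply `D` to the Hadamard expansion at the image of `x`. The terms `(x_i - c_i) · D(g_i)`
  -- vanish at `x`, and in `D(x_i) · g_i` the coefficient has the value of the `i`-th partial
  -- derivative there.
  have hD := congrArg (fun s => app D (τ.mono h) (τ.hom V' s)) hfg
  simp only [map_add, map_sum, AlgHom.commutes, app_algebraMap, map_mul,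
    app_mul_of_even_left _ _ (τ.hom_mem _ _), zero_add] at hD
  rw [app_val_of_mem D le_rfl (τ.mono h) _ x.1 hx', τ.hom_res V V' h, hD, Sec.sum_val,
    Sec.sum_val]
  refine Finset.sum_congr rfl fun i _ => ?_
  have z1 : (τ.hom V' ((smoothFunctions I N).res (h.trans hV) (chartCoord I b x₀ i) -
      algebraMap ℝ _ (evalAt ⟨τ.proj x.1, hV hxV⟩ (chartCoord I b x₀ i)))).1 ⟨x.1, hx'⟩ = 0 :=
    τ.hom_val V' ((smoothFunctions I N).res (h.trans hV) (chartCoord I b x₀ i) -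
      algebraMap ℝ _ (evalAt ⟨τ.proj x.1, hV hxV⟩ (chartCoord I b x₀ i))) ⟨x.1, hx'⟩
      (by simp [evalAt_res])
  have z2 : (τ.hom V' (g i)).1 ⟨x.1, hx'⟩ =
      (τ.hom V (app (chartVect x₀ (b i)) hV f)).1 x := by
    have := τ.hom_val V' (g i - (smoothFunctions I N).res h (app (chartVect x₀ (b i)) hV f))
      ⟨x.1, hx'⟩ (by rw [map_sub, hgval i]; simp [evalAt_res])
    rw [map_sub, ← τ.hom_res V V' h (τ.mono h)] at this
    exact sub_eq_zero.1 this
  have z3 : (app D (τ.mono h) (τ.hom V' ((smoothFunctions I N).res (h.trans hV)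
      (chartCoord I b x₀ i) - algebraMap ℝ _ (evalAt ⟨τ.proj x.1, hV hxV⟩
      (chartCoord I b x₀ i))))).1 ⟨x.1, hx'⟩ = (app D le_rfl (τ.hom V
        ((smoothFunctions I N).res hV (chartCoord I b x₀ i)))).1 x := by
    rw [app_val_of_mem D le_rfl (τ.mono h) _ x.1 hx', τ.hom_res V V' h, map_sub, map_sub,
      AlgHom.commutes, app_algebraMap, sub_zero]
    rfl
  rw [Sec.add_val, Sec.mul_val, Sec.mul_val, Sec.mul_val, z1, z2, z3, zero_mul, add_zero]

variable (I) in
/-- Smooth functions as a pullback along the identity. -/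
def idPullback : EvenPullback I (N := N) (smoothFunctions I N) where
  proj := id
  preim := id
  mem_preim _ _ := Iff.rfl
  hom _ := AlgHom.id ℝ _
  hom_res _ _ _ _ _ := rfl
  hom_mem _ f := smooth_mem_par f
  hom_val _ _ _ h := h

variable (I) in
/-- The coordinate frame of a chart. -/
def chartFrame (x₀ : N) : (smoothFunctions I N).Frame (chartDom H x₀) ι where
  parity _ := 0
  coord := chartCoord I b x₀
  vect i := chartVect x₀ (b i)
  coord_mem _ := smooth_mem_par _
  vect_mem _ := smooth_mem_der _
  vect_coord i := by classical rw [chartVect_chartCoord, if_pos rfl]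
  vect_coord_of_ne i j h := by classical rw [chartVect_chartCoord, if_neg h]
  eq_zero U hU p D _ H := by
    refine Vect.ext' fun W hW f => ?_
    -- By the chain rule along the identity, a derivation that kills the coordinates kills every
    -- function.
    have := (idPullback I).app_hom b (hW.trans hU) (resVect hW D) f
    refine this.trans (Finset.sum_eq_zero fun i _ => ?_)
    have hi : app D hW ((smoothFunctions I N).res (hW.trans hU) (chartCoord I b x₀ i)) = 0 := by
      have := congrArg ((smoothFunctions I N).res hW) (H i)
      rw [res_app, map_zero] at this
      exact this
    exact (congrArg (fun s : (smoothFunctions I N).Sec W =>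
      s * app (chartVect x₀ (b i)) (hW.trans hU) f) hi).trans (zero_mul _)

end SmoothFunctions

end SuperSheaf

attribute [local instance] SuperSheaf.smoothCommRing

/-! ### Fibrewise affine coordinates on the total space. -/

section BundleCoordinates

open SuperSheaf

variable (B : Type*) [NormedAddCommGroup B] [NormedSpace ℝ B]
  (F : Type*) [NormedAddCommGroup F] [NormedSpace ℝ F] [FiniteDimensional ℝ F]
  {M : Type*} [TopologicalSpace M] [ChartedSpace B M]
  (V : M → Type*) [TopologicalSpace (TotalSpace F V)]
  [∀ x, AddCommGroup (V x)] [∀ x, Module ℝ (V x)] [∀ x, TopologicalSpace (V x)]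
  [FiberBundle F V] [VectorBundle ℝ F V]

theorem contMDiffAt_projAbove [IsManifold 𝓘(ℝ, B) ∞ M] {U : Opens M} (e : above F V U) :
    ContMDiffAt (𝓘(ℝ, B).prod 𝓘(ℝ, F)) 𝓘(ℝ, B) ∞ (fun e : above F V U => projAbove F V e) e := by
  rw [← ContMDiffAt.subtypeVal_comp_iff]
  exact (Bundle.contMDiffAt_proj V).comp e contMDiff_subtype_val.contMDiffAt

/-- The pullback of smooth functions on the base to the total space. -/
def totalPullback [IsManifold 𝓘(ℝ, B) ∞ M] :
    EvenPullback 𝓘(ℝ, B) (N := M) (totalFunctions B F V) where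
  proj := TotalSpace.proj
  preim := above F V
  mem_preim _ _ := Iff.rfl
  hom U :=
    { toFun := fun f => ⟨fun e => f.1 (projAbove F V e), fun e =>
        ContMDiffAt.comp (g := fun y : U => (f.1 y : ℝ)) e (f.2 _) (contMDiffAt_projAbove B F V e)⟩
      map_one' := rfl
      map_mul' := fun _ _ => rfl
      map_zero' := rfl
      map_add' := fun _ _ => rfl
      commutes' := fun _ => rfl }
  hom_res _ _ _ _ _ := rfl
  hom_mem _ _ := smooth_mem_par _
  hom_val _ _ _ h := h

/-- An open set over which there are both a chart and a local trivialization. -/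
def trivDom (x₀ : M) : Opens M :=
  ⟨(trivializationAt F V x₀).baseSet, (trivializationAt F V x₀).open_baseSet⟩ ⊓ chartDom B x₀

theorem mem_trivDom_self (x₀ : M) : x₀ ∈ trivDom B F V x₀ :=
  ⟨FiberBundle.mem_baseSet_trivializationAt' x₀, mem_chart_source B x₀⟩

/-- The index set of local coordinates. -/
abbrev CoordIdx : Type := Fin (Module.finrank ℝ B) ⊕ Fin (Module.finrank ℝ F)

theorem above_trivDom_le (x₀ : M) :
    above F V (trivDom B F V x₀) ≤
      chartDom (ModelProd B F) (⟨x₀, 0⟩ : TotalSpace F V) := by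
  intro e he
  change e ∈ (chartAt (ModelProd B F) (⟨x₀, 0⟩ : TotalSpace F V)).source
  have h1 : e.proj ∈ (trivializationAt F V x₀).baseSet := he.1
  have h2 : e.proj ∈ (chartAt B x₀).source := he.2
  rw [FiberBundle.chartedSpace_chartAt]
  simp [h1, h2, Trivialization.mem_source]

/-- The chart of the total space at the zero vector over `x₀` is the trivialization followed by the
base chart. Its coordinates are therefore pullbacks from the base and fibrewise linear functions. -/
theorem extChartAt_total {x₀ : M} {e : TotalSpace F V} (he : e.proj ∈ trivDom B F V x₀) :
    extChartAt (𝓘(ℝ, B).prod 𝓘(ℝ, F)) (⟨x₀, 0⟩ : TotalSpace F V) e =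
      (extChartAt 𝓘(ℝ, B) x₀ e.proj, (trivializationAt F V x₀ e).2) := by
  have h1 : e.proj ∈ (trivializationAt F V x₀).baseSet := he.1
  have h3 : (trivializationAt F V x₀ e).1 = e.proj := Trivialization.coe_fst' _ h1
  rw [FiberBundle.extChartAt]
  simp [h3]

variable [FiniteDimensional ℝ B] [IsManifold 𝓘(ℝ, B) ∞ M] [ContMDiffVectorBundle ∞ F V 𝓘(ℝ, B)]

/-- Fibrewise affine coordinates on the total space and the coordinate vector fields. -/
def totalFrame (x₀ : M) :
    (totalFunctions B F V).Frame (above F V (trivDom B F V x₀)) (CoordIdx B F) :=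
  (chartFrame (𝓘(ℝ, B).prod 𝓘(ℝ, F)) ((Module.finBasis ℝ B).prod (Module.finBasis ℝ F))
    (⟨x₀, 0⟩ : TotalSpace F V)).restrict (above_trivDom_le B F V x₀)

theorem totalFrame_coord_inl (x₀ : M) (i : Fin (Module.finrank ℝ B)) :
    (totalFrame B F V x₀).coord (Sum.inl i) = (totalPullback B F V).hom (trivDom B F V x₀)
      ((smoothFunctions 𝓘(ℝ, B) M).res inf_le_right
        (chartCoord 𝓘(ℝ, B) (Module.finBasis ℝ B) x₀ i)) := by
  refine evalAt_ext fun e => ?_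
  change ((Module.finBasis ℝ B).prod (Module.finBasis ℝ F)).repr
    (extChartAt (𝓘(ℝ, B).prod 𝓘(ℝ, F)) (⟨x₀, 0⟩ : TotalSpace F V) e.1) (Sum.inl i) =
      (Module.finBasis ℝ B).repr (extChartAt 𝓘(ℝ, B) x₀ e.1.proj) i
  rw [extChartAt_total B F V e.2, Module.Basis.prod_repr_inl]

theorem evalAt_totalFrame_coord_inr (x₀ : M) (j : Fin (Module.finrank ℝ F))
    (e : above F V (trivDom B F V x₀)) :
    evalAt e ((totalFrame B F V x₀).coord (Sum.inr j)) =
      (Module.finBasis ℝ F).repr (trivializationAt F V x₀ e.1).2 j := by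
  change ((Module.finBasis ℝ B).prod (Module.finBasis ℝ F)).repr
    (extChartAt (𝓘(ℝ, B).prod 𝓘(ℝ, F)) (⟨x₀, 0⟩ : TotalSpace F V) e.1) (Sum.inr j) = _
  rw [extChartAt_total B F V e.2, Module.Basis.prod_repr_inr]

end BundleCoordinates

/-! ### Parity, contraction and components of low degree in the exterior algebra. -/

section Exterior

variable {K : Type*} [AddCommGroup K] [Module ℝ K]

/-- Parity as an eigenvalue equation, with `koszul 1 q = ±1`. Trivializations commute with the grade
involution, so in this form parity can be tested on coefficients. -/
theorem mem_evenOdd_iff_involute (q : ZMod 2) (a : ExteriorAlgebra ℝ K) :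
    a ∈ CliffordAlgebra.evenOdd (0 : QuadraticForm ℝ K) q ↔
      CliffordAlgebra.involute (Q := (0 : QuadraticForm ℝ K)) a = koszul 1 q • a := by
  have h : a ∈ CliffordAlgebra.evenOdd (0 : QuadraticForm ℝ K) 0 ⊔
      CliffordAlgebra.evenOdd (0 : QuadraticForm ℝ K) 1 := by
    rw [(CliffordAlgebra.evenOdd_isCompl _).sup_eq_top]
    trivial
  obtain ⟨b, hb, c, hc, rfl⟩ := Submodule.mem_sup.1 h
  rw [map_add, CliffordAlgebra.involute_eq_of_mem_even hb,
    CliffordAlgebra.involute_eq_of_mem_odd hc]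
  have two : ∀ x : ExteriorAlgebra ℝ K, x + x = 0 → x = 0 := fun x hx => by
    rw [← two_smul ℝ] at hx
    exact (smul_eq_zero.1 hx).resolve_left two_ne_zero
  rcases SuperSheaf.zmod_two_eq q with rfl | rfl
  · rw [SuperSheaf.koszul_zero_right, one_smul]
    constructor
    · intro hm
      have hc0 : c ∈ CliffordAlgebra.evenOdd (0 : QuadraticForm ℝ K) 0 := by
        have := Submodule.sub_mem _ hm hb
        rwa [add_sub_cancel_left] at this
      have : c = 0 := Submodule.disjoint_def.1 (CliffordAlgebra.evenOdd_isCompl _).disjoint _ hc0 hc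
      rw [this, neg_zero]
    · intro he
      have : c = 0 := two c (by
        have := add_left_cancel he
        nth_rewrite 1 [← this]
        exact neg_add_cancel c)
      rw [this, add_zero]
      exact hb
  · have k1 : koszul 1 1 = -1 := by simp [koszul]
    rw [k1, neg_one_smul, neg_add]
    constructor
    · intro hm
      have hb1 : b ∈ CliffordAlgebra.evenOdd (0 : QuadraticForm ℝ K) 1 := by
        have := Submodule.sub_mem _ hm hc
        rwa [add_sub_cancel_right] at this
      have : b = 0 := Submodule.disjoint_def.1 (CliffordAlgebra.evenOdd_isCompl _).disjoint _ hb hb1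
      rw [this, neg_zero]
    · intro he
      have : b = 0 := two b (by
        have := add_right_cancel he
        nth_rewrite 1 [this]
        exact neg_add_cancel b)
      rw [this, zero_add]
      exact hc

/-- The contraction `∂/∂η` of the exterior algebra by a linear form. -/
def extContract (d : Module.Dual ℝ K) : ExteriorAlgebra ℝ K →ₗ[ℝ] ExteriorAlgebra ℝ K :=
  CliffordAlgebra.contractLeft (Q := (0 : QuadraticForm ℝ K)) d

/-- Contraction is an odd derivation: the involution supplies the sign for an arbitrary first
factor, and peeling generators off that factor proves the rule by induction. -/
theorem extContract_mul (d : Module.Dual ℝ K) (a b : ExteriorAlgebra ℝ K) :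
    extContract d (a * b) = extContract d a * b +
      CliffordAlgebra.involute (Q := (0 : QuadraticForm ℝ K)) a * extContract d b := by
  unfold extContract
  induction a using CliffordAlgebra.left_induction with
  | algebraMap r =>
    rw [CliffordAlgebra.contractLeft_algebraMap_mul, CliffordAlgebra.contractLeft_algebraMap,
      AlgHom.commutes, zero_mul, zero_add]
  | add x y hx hy => simp only [add_mul, map_add, hx, hy]; abel
  | ι_mul x m hx =>
    rw [mul_assoc, CliffordAlgebra.contractLeft_ι_mul, hx, CliffordAlgebra.contractLeft_ι_mul,
      map_mul, CliffordAlgebra.involute_ι]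
    simp only [mul_add, sub_mul, smul_mul_assoc, neg_mul, mul_assoc]
    abel

/-- Contraction lowers the degree by one, so it anticommutes with the involution; hence `∂/∂η_j` is
odd. -/
theorem involute_extContract (d : Module.Dual ℝ K) (a : ExteriorAlgebra ℝ K) :
    CliffordAlgebra.involute (Q := (0 : QuadraticForm ℝ K)) (extContract d a) =
      -extContract d (CliffordAlgebra.involute (Q := (0 : QuadraticForm ℝ K)) a) := by
  unfold extContract
  induction a using CliffordAlgebra.left_induction with
  | algebraMap r => rw [AlgHom.commutes, CliffordAlgebra.contractLeft_algebraMap, map_zero, neg_zero]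
  | add x y hx hy => simp only [map_add, hx, hy]; abel
  | ι_mul x m hx =>
    simp only [CliffordAlgebra.contractLeft_ι_mul, map_mul, CliffordAlgebra.involute_ι, map_sub,
      map_smul, hx, neg_mul, map_neg, mul_neg]
    abel

theorem extContract_ι (d : Module.Dual ℝ K) (m : K) :
    extContract d (ExteriorAlgebra.ι ℝ m) = algebraMap ℝ _ (d m) :=
  CliffordAlgebra.contractLeft_ι _ d m

theorem extContract_algebraMap (d : Module.Dual ℝ K) (r : ℝ) :
    extContract d (algebraMap ℝ (ExteriorAlgebra ℝ K) r) = 0 :=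
  CliffordAlgebra.contractLeft_algebraMap _ d r

theorem ιInv_algebraMap (r : ℝ) :
    ExteriorAlgebra.ιInv (algebraMap ℝ (ExteriorAlgebra ℝ K) r) = 0 := by
  -- The trivial square-zero extension needs a right action; this is the instance through which
  -- `ExteriorAlgebra.ιInv` is defined, so that `change` can unfold it.
  let _ : Module ℝᵐᵒᵖ K := Module.compHom _ ((RingHom.id ℝ).fromOpposite mul_comm)
  have _ : IsCentralScalar ℝ K := ⟨fun r m => rfl⟩
  change (ExteriorAlgebra.toTrivSqZeroExt (algebraMap ℝ (ExteriorAlgebra ℝ K) r)).snd = 0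
  rw [AlgHom.commutes]
  rfl

theorem algebraMapInv_ι (m : K) :
    ExteriorAlgebra.algebraMapInv (ExteriorAlgebra.ι ℝ m) = 0 := by
  simp [ExteriorAlgebra.algebraMapInv]

theorem algebraMapInv_algebraMap (r : ℝ) :
    ExteriorAlgebra.algebraMapInv (algebraMap ℝ (ExteriorAlgebra ℝ K) r) = r :=
  ExteriorAlgebra.algebraMap_leftInverse K r

theorem ιInv_ι (m : K) : ExteriorAlgebra.ιInv (ExteriorAlgebra.ι ℝ m) = m :=
  ExteriorAlgebra.ι_leftInverse m

/-- `ιInv` is the second component of the algebra map to the trivial square-zero extension, in which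
products of two degree-one elements vanish. -/
theorem ιInv_mul (a b : ExteriorAlgebra ℝ K) :
    ExteriorAlgebra.ιInv (a * b) =
      ExteriorAlgebra.algebraMapInv a • ExteriorAlgebra.ιInv b +
        ExteriorAlgebra.algebraMapInv b • ExteriorAlgebra.ιInv a := by
  let _ : Module ℝᵐᵒᵖ K := Module.compHom _ ((RingHom.id ℝ).fromOpposite mul_comm)
  have _ : IsCentralScalar ℝ K := ⟨fun r m => rfl⟩
  have h : (TrivSqZeroExt.fstHom ℝ ℝ K).comp ExteriorAlgebra.toTrivSqZeroExt =
      ExteriorAlgebra.algebraMapInv := by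
    apply ExteriorAlgebra.hom_ext
    ext m
    simp [ExteriorAlgebra.algebraMapInv]
  have h' : ∀ c : ExteriorAlgebra ℝ K, (ExteriorAlgebra.toTrivSqZeroExt c).fst =
      ExteriorAlgebra.algebraMapInv c := fun c => DFunLike.congr_fun h c
  change (ExteriorAlgebra.toTrivSqZeroExt (a * b)).snd = _
  rw [map_mul, TrivSqZeroExt.snd_mul, h', h']
  rfl

theorem algebraMapInv_involute (a : ExteriorAlgebra ℝ K) :
    ExteriorAlgebra.algebraMapInv (CliffordAlgebra.involute (Q := (0 : QuadraticForm ℝ K)) a) =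
      ExteriorAlgebra.algebraMapInv a := by
  have h : ExteriorAlgebra.algebraMapInv.comp
      (CliffordAlgebra.involute (Q := (0 : QuadraticForm ℝ K))) =
      (ExteriorAlgebra.algebraMapInv : ExteriorAlgebra ℝ K →ₐ[ℝ] ℝ) := by
    apply ExteriorAlgebra.hom_ext
    ext m
    have h2 : CliffordAlgebra.involute (ExteriorAlgebra.ι ℝ m) = -(ExteriorAlgebra.ι ℝ m) :=
      CliffordAlgebra.involute_ι m
    simp [h2, algebraMapInv_ι]
  exact DFunLike.congr_fun h a

theorem ιInv_involute (a : ExteriorAlgebra ℝ K) :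
    ExteriorAlgebra.ιInv (CliffordAlgebra.involute (Q := (0 : QuadraticForm ℝ K)) a) =
      -ExteriorAlgebra.ιInv a := by
  induction a using CliffordAlgebra.left_induction with
  | algebraMap r =>
    rw [AlgHom.commutes]
    exact (ιInv_algebraMap r).trans ((neg_zero).symm.trans (congrArg _ (ιInv_algebraMap r).symm))
  | add x y hx hy => rw [map_add, map_add, hx, hy, map_add, neg_add]
  | ι_mul x m hx =>
    have h2 : ExteriorAlgebra.algebraMapInv (CliffordAlgebra.ι (0 : QuadraticForm ℝ K) m) =
      (0 : ℝ) := algebraMapInv_ι m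
    rw [map_mul, CliffordAlgebra.involute_ι, ιInv_mul, ιInv_mul, hx, map_neg, h2,
      algebraMapInv_involute, map_neg]
    simp

/-- The involution leaves the scalar part unchanged and negates an odd element, so the scalar part
equals its own negative. -/
theorem algebraMapInv_eq_zero_of_odd {a : ExteriorAlgebra ℝ K}
    (ha : a ∈ CliffordAlgebra.evenOdd (0 : QuadraticForm ℝ K) 1) :
    ExteriorAlgebra.algebraMapInv a = 0 := by
  have h := algebraMapInv_involute a
  rw [CliffordAlgebra.involute_eq_of_mem_odd ha, map_neg] at h
  linarith

theorem ιInv_eq_zero_of_even {a : ExteriorAlgebra ℝ K}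
    (ha : a ∈ CliffordAlgebra.evenOdd (0 : QuadraticForm ℝ K) 0) :
    ExteriorAlgebra.ιInv a = 0 := by
  have h := ιInv_involute a
  rw [CliffordAlgebra.involute_eq_of_mem_even ha] at h
  rw [eq_neg_iff_add_eq_zero, ← two_smul ℝ] at h
  exact (smul_eq_zero.1 h).resolve_left two_ne_zero

end Exterior

/-! ### Superfunctions in a local trivialization. -/

section SuperCoordinates

open SuperSheaf

variable (B : Type*) [NormedAddCommGroup B] [NormedSpace ℝ B]
  (F : Type*) [NormedAddCommGroup F] [NormedSpace ℝ F] [FiniteDimensional ℝ F]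
  {M : Type*} [TopologicalSpace M] [ChartedSpace B M]
  (V : M → Type*) [TopologicalSpace (TotalSpace F V)]
  [∀ x, AddCommGroup (V x)] [∀ x, Module ℝ (V x)] [∀ x, TopologicalSpace (V x)]
  [FiberBundle F V] [VectorBundle ℝ F V]

variable {B F V} in
/-- Evaluation of superfunctions at a point of the base. -/
def superEval {U : Opens M} (x : U) : (superFunctions B F V).Sec U →ₐ[ℝ] ExtFiber V x.1 where
  toFun s := s.1 x
  map_one' := rfl
  map_mul' _ _ := rfl
  map_zero' := rfl
  map_add' _ _ := rfl
  commutes' _ := rfl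

variable {B F V} in
theorem superEval_ext {U : Opens M} {s t : (superFunctions B F V).Sec U}
    (h : ∀ x, superEval x s = superEval x t) : s = t := Sec.ext' h

variable {B F V} in
theorem mem_par_iff_involute {U : Opens M} {q : ZMod 2} {s : (superFunctions B F V).Sec U} :
    s ∈ (superFunctions B F V).par U q ↔ ∀ x : U, CliffordAlgebra.involute
      (Q := (0 : QuadraticForm ℝ (Module.Dual ℝ (V x.1)))) (superEval x s) =
        koszul 1 q • superEval x s :=
  forall_congr' fun _ => mem_evenOdd_iff_involute q _

/-- The sections of `Λ E*` of degree zero. -/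
def baseSec (U : Opens M) :
    (smoothFunctions 𝓘(ℝ, B) M).Sec U →ₐ[ℝ] (superFunctions B F V).Sec U where
  toFun f := ⟨fun x => algebraMap ℝ (ExtFiber V x.1) (evalAt x f), fun x₀ ℓ x hx => by
    have h : ContMDiffAt 𝓘(ℝ, B) 𝓘(ℝ, ℝ) ∞ (fun y : U => evalAt y f * ℓ 1) x :=
      ContMDiffAt.mul (f.2 x) contMDiffAt_const
    refine h.congr_of_eventuallyEq (Filter.Eventually.of_forall fun y => ?_)
    change ℓ (extTriv F V x₀ y (algebraMap ℝ (ExtFiber V y.1) (evalAt y f))) = _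
    rw [AlgHom.commutes, Algebra.algebraMap_eq_smul_one, map_smul, smul_eq_mul]⟩
  map_one' := Sec.ext' fun x => map_one (algebraMap ℝ (ExtFiber V x.1))
  map_mul' f g := Sec.ext' fun x => map_mul (algebraMap ℝ (ExtFiber V x.1)) (evalAt x f) (evalAt x g)
  map_zero' := Sec.ext' fun x => map_zero (algebraMap ℝ (ExtFiber V x.1))
  map_add' f g := Sec.ext' fun x => map_add (algebraMap ℝ (ExtFiber V x.1)) (evalAt x f) (evalAt x g)
  commutes' _ := rfl

theorem superEval_baseSec {U : Opens M} (f : (smoothFunctions 𝓘(ℝ, B) M).Sec U) (x : U) :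
    superEval x (baseSec B F V U f) = algebraMap ℝ (ExtFiber V x.1) (evalAt x f) := rfl

theorem baseSec_mem {U : Opens M} (f : (smoothFunctions 𝓘(ℝ, B) M).Sec U) :
    baseSec B F V U f ∈ (superFunctions B F V).par U 0 := fun x =>
  CliffordAlgebra.one_le_evenOdd_zero _ (Submodule.algebraMap_mem (evalAt x f))

/-- Inclusion of the smooth functions on the base into the superfunctions. -/
def superPullback : EvenPullback 𝓘(ℝ, B) (N := M) (superFunctions B F V) where
  proj x := x
  preim U := U
  mem_preim _ _ := Iff.rfl
  hom := baseSec B F V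
  hom_res _ _ _ _ _ := rfl
  hom_mem _ f := baseSec_mem B F V f
  hom_val V' f x h := by
    exact (congrArg (algebraMap ℝ (ExtFiber V x.1)) h).trans (map_zero _)

/-- The inverse of the local trivialization of `Λ E*`. -/
def extTrivSymm (x₀ x : M) : ExteriorAlgebra ℝ (Module.Dual ℝ F) →ₐ[ℝ] ExtFiber V x :=
  ExteriorAlgebra.map ((trivializationAt F V x₀).continuousLinearMapAt ℝ x).toLinearMap.dualMap

variable {F V} in
theorem extTriv_extTrivSymm {x₀ x : M} (hx : x ∈ (trivializationAt F V x₀).baseSet)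
    (a : ExteriorAlgebra ℝ (Module.Dual ℝ F)) :
    extTriv F V x₀ x (extTrivSymm F V x₀ x a) = a := by
  have h : (extTriv F V x₀ x).comp (extTrivSymm F V x₀ x) = AlgHom.id ℝ _ := by
    rw [extTriv, extTrivSymm, ExteriorAlgebra.map_comp_map,
      ← ExteriorAlgebra.map_id]
    congr 1
    ext φ w
    simp [Trivialization.continuousLinearMapAt_symmL _ hx]
  exact DFunLike.congr_fun h a

variable {F V} in
theorem extTrivSymm_extTriv {x₀ x : M} (hx : x ∈ (trivializationAt F V x₀).baseSet)
    (a : ExtFiber V x) : extTrivSymm F V x₀ x (extTriv F V x₀ x a) = a := by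
  have h : (extTrivSymm F V x₀ x).comp (extTriv F V x₀ x) = AlgHom.id ℝ _ := by
    rw [extTriv, extTrivSymm, ExteriorAlgebra.map_comp_map,
      ← ExteriorAlgebra.map_id]
    congr 1
    ext φ w
    exact congrArg φ (Trivialization.symmL_continuousLinearMapAt _ hx w)
  exact DFunLike.congr_fun h a

variable [FiniteDimensional ℝ B] [IsManifold 𝓘(ℝ, B) ∞ M] [ContMDiffVectorBundle ∞ F V 𝓘(ℝ, B)]

/-- Smooth fibrewise linear functions are smooth sections of the dual bundle. -/
theorem ι_mem_sec_of_fibreLinear {U : Opens M} (g : (totalFunctions B F V).Sec (above F V U))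
    (φ : ∀ x : U, Module.Dual ℝ (V x.1))
    (h : ∀ (x : U) (v : V x.1), g.1 ⟨⟨x.1, v⟩, x.2⟩ = φ x v) :
    (fun x : U => (ExteriorAlgebra.ι ℝ (φ x) : ExtFiber V x.1)) ∈
      (superFunctions B F V).sec U := by
  intro x₀ ℓ x hx
  set τ := trivializationAt F V x₀
  let b := Module.finBasis ℝ F
  -- For fixed `w` the local section `y ↦ (y, w)` of the trivialization is smooth, and composing `g`
  -- with it gives the component of `φ` along `w`.
  have hsm : ∀ w : F, ContMDiffAt 𝓘(ℝ, B) 𝓘(ℝ, ℝ) ∞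
      (fun y : M => extFun g (⟨y, τ.symmL ℝ y w⟩ : TotalSpace F V)) x.1 := by
    intro w
    have h1 : ContMDiffAt 𝓘(ℝ, B) (𝓘(ℝ, B).prod 𝓘(ℝ, F)) ∞ (fun y : M => (y, w)) x.1 :=
      contMDiffAt_id.prodMk contMDiffAt_const
    have ht : (x.1, w) ∈ τ.target := by rw [τ.mem_target]; exact hx
    have h2 : ContMDiffAt (𝓘(ℝ, B).prod 𝓘(ℝ, F)) (𝓘(ℝ, B).prod 𝓘(ℝ, F)) ∞
        τ.toOpenPartialHomeomorph.symm (x.1, w) :=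
      (τ.contMDiffOn_symm).contMDiffAt (τ.open_target.mem_nhds ht)
    have hpt : ∀ y : M, y ∈ τ.baseSet → τ.toOpenPartialHomeomorph.symm (y, w) =
        (⟨y, τ.symmL ℝ y w⟩ : TotalSpace F V) := by
      intro y hy
      rw [τ.symmL_apply hy]
      exact (τ.mk_symm hy w).symm
    have h3 : ContMDiffAt (𝓘(ℝ, B).prod 𝓘(ℝ, F)) 𝓘(ℝ, ℝ) ∞ (extFun g)
        (τ.toOpenPartialHomeomorph.symm (x.1, w)) := by
      rw [hpt x.1 hx]
      exact contMDiffAt_extFun g x.2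
    refine ((h3.comp (x.1, w) h2).comp x.1 h1).congr_of_eventuallyEq ?_
    filter_upwards [τ.open_baseSet.mem_nhds hx] with y hy
    simp only [Function.comp_apply, hpt y hy]
  have hsum : ContMDiffAt 𝓘(ℝ, B) 𝓘(ℝ, ℝ) ∞ (fun y : U => ∑ i,
      extFun g (⟨y.1, τ.symmL ℝ y.1 (b i)⟩ : TotalSpace F V) *
        ℓ (ExteriorAlgebra.ι ℝ (b.coord i))) x :=
    ContMDiffAt.sum fun i _ => ((contMDiffAt_subtype_iff
      (f := fun y : M => extFun g (⟨y, τ.symmL ℝ y (b i)⟩ : TotalSpace F V))).2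
        (hsm (b i))).mul contMDiffAt_const
  refine hsum.congr_of_eventuallyEq (Filter.Eventually.of_forall fun y => ?_)
  have e1 : extTriv F V x₀ y (ExteriorAlgebra.ι ℝ (φ y)) =
      ExteriorAlgebra.ι ℝ (∑ i, φ y (τ.symmL ℝ y.1 (b i)) • b.coord i) := by
    rw [extTriv, ExteriorAlgebra.map_apply_ι]
    congr 1
    refine b.ext fun j => ?_
    simp [LinearMap.sum_apply, Finsupp.single_apply, τ]
  change ℓ (extTriv F V x₀ y (ExteriorAlgebra.ι ℝ (φ y))) = _
  rw [e1, map_sum, map_sum]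
  refine Finset.sum_congr rfl fun i _ => ?_
  rw [map_smul, map_smul, smul_eq_mul, extFun_of_mem g (x := ⟨y.1, τ.symmL ℝ y.1 (b i)⟩) y.2, ← h y]

/-- Sums and products reduce smoothness of locally constant sections to degree one. There the
section, read as a function on `E`, is a combination of the fibre coordinates. -/
theorem extTrivSymm_mem_sec (x₀ : M) {U : Opens M} (hU : U ≤ trivDom B F V x₀)
    (a : ExteriorAlgebra ℝ (Module.Dual ℝ F)) :
    (fun x : U => extTrivSymm F V x₀ x.1 a) ∈ (superFunctions B F V).sec U := by
  induction a using ExteriorAlgebra.induction with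
  | algebraMap r =>
    exact (congrArg (· ∈ (superFunctions B F V).sec U)
      (funext fun x => AlgHom.commutes (extTrivSymm F V x₀ x.1) r)).mpr
      (Subalgebra.algebraMap_mem ((superFunctions B F V).sec U) r)
  | ι φ =>
    let g : (totalFunctions B F V).Sec (above F V U) :=
      ∑ j, φ (Module.finBasis ℝ F j) • (totalFunctions B F V).res (above_mono F V hU)
        ((totalFrame B F V x₀).coord (Sum.inr j))
    have hg := ι_mem_sec_of_fibreLinear B F V g (fun x => φ.comp
      ((trivializationAt F V x₀).continuousLinearMapAt ℝ x.1).toLinearMap) fun x v => by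
        have hx : x.1 ∈ (trivializationAt F V x₀).baseSet := (hU x.2).1
        change evalAt (⟨⟨x.1, v⟩, x.2⟩ : above F V U) g = _
        rw [map_sum]
        simp only [map_smul, evalAt_res, smul_eq_mul, evalAt_totalFrame_coord_inr]
        rw [LinearMap.comp_apply]
        conv_rhs => rw [ContinuousLinearMap.coe_coe,
          Trivialization.continuousLinearMapAt_apply_of_mem ℝ _ hx,
          ← (Module.finBasis ℝ F).sum_repr (trivializationAt F V x₀ ⟨x.1, v⟩).2, map_sum]
        refine Finset.sum_congr rfl fun j _ => ?_
        rw [map_smul, smul_eq_mul, mul_comm]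
    exact (congrArg (· ∈ (superFunctions B F V).sec U)
      (funext fun x => ExteriorAlgebra.map_apply_ι _ _)).mpr hg
  | mul a b ha hb =>
    exact (congrArg (· ∈ (superFunctions B F V).sec U)
      (funext fun x => map_mul (extTrivSymm F V x₀ x.1) a b)).mpr (Subalgebra.mul_mem _ ha hb)
  | add a b ha hb =>
    exact (congrArg (· ∈ (superFunctions B F V).sec U)
      (funext fun x => map_add (extTrivSymm F V x₀ x.1) a b)).mpr (Subalgebra.add_mem _ ha hb)

/-- The sections of `Λ E*` that are constant in a local trivialization. -/
def constSec (x₀ : M) {U : Opens M} (hU : U ≤ trivDom B F V x₀) :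
    ExteriorAlgebra ℝ (Module.Dual ℝ F) →ₐ[ℝ] (superFunctions B F V).Sec U where
  toFun a := ⟨fun x => extTrivSymm F V x₀ x.1 a, extTrivSymm_mem_sec B F V x₀ hU a⟩
  map_one' := Sec.ext' fun x => map_one (extTrivSymm F V x₀ x.1)
  map_mul' _ _ := Sec.ext' fun x => map_mul (extTrivSymm F V x₀ x.1) _ _
  map_zero' := Sec.ext' fun x => map_zero (extTrivSymm F V x₀ x.1)
  map_add' _ _ := Sec.ext' fun x => map_add (extTrivSymm F V x₀ x.1) _ _
  commutes' _ := Sec.ext' fun x => AlgHom.commutes (extTrivSymm F V x₀ x.1) _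

theorem superEval_constSec (x₀ : M) {U : Opens M} (hU : U ≤ trivDom B F V x₀)
    (a : ExteriorAlgebra ℝ (Module.Dual ℝ F)) (x : U) :
    superEval x (constSec B F V x₀ hU a) = extTrivSymm F V x₀ x.1 a := rfl

theorem mem_baseSet_of_le {x₀ : M} {U : Opens M} (hU : U ≤ trivDom B F V x₀) (x : U) :
    x.1 ∈ (trivializationAt F V x₀).baseSet := (hU x.2).1

theorem extTriv_constSec {x₀ : M} {U : Opens M} (hU : U ≤ trivDom B F V x₀)
    (a : ExteriorAlgebra ℝ (Module.Dual ℝ F)) (x : U) :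
    extTriv F V x₀ x.1 (superEval x (constSec B F V x₀ hU a)) = a :=
  extTriv_extTrivSymm (mem_baseSet_of_le B F V hU x) a

theorem constSec_mem {x₀ : M} {U : Opens M} (hU : U ≤ trivDom B F V x₀) {q : ZMod 2}
    {a : ExteriorAlgebra ℝ (Module.Dual ℝ F)}
    (ha : a ∈ CliffordAlgebra.evenOdd (0 : QuadraticForm ℝ (Module.Dual ℝ F)) q) :
    constSec B F V x₀ hU a ∈ (superFunctions B F V).par U q := by
  refine mem_par_iff_involute.2 fun x => ?_
  have hx := mem_baseSet_of_le B F V hU x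
  rw [← extTrivSymm_extTriv hx (CliffordAlgebra.involute _), extTriv_involute, extTriv_constSec,
    (mem_evenOdd_iff_involute q a).1 ha, map_smul, superEval_constSec]

/-- The coefficients of a superfunction in a local trivialization. -/
def coef {x₀ : M} {U : Opens M} (hU : U ≤ trivDom B F V x₀)
    (ℓ : Module.Dual ℝ (ExteriorAlgebra ℝ (Module.Dual ℝ F))) :
    (superFunctions B F V).Sec U →ₗ[ℝ] (smoothFunctions 𝓘(ℝ, B) M).Sec U where
  toFun s := ⟨fun x => ℓ (extTriv F V x₀ x.1 (superEval x s)), fun x =>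
    s.2 x₀ ℓ x (mem_baseSet_of_le B F V hU x)⟩
  map_add' s t := evalAt_ext fun x => by
    change ℓ (extTriv F V x₀ x.1 (superEval x (s + t))) =
      ℓ (extTriv F V x₀ x.1 (superEval x s)) + ℓ (extTriv F V x₀ x.1 (superEval x t))
    rw [map_add, map_add, map_add]
  map_smul' c s := evalAt_ext fun x => by
    change ℓ (extTriv F V x₀ x.1 (superEval x (c • s))) = c • ℓ (extTriv F V x₀ x.1 (superEval x s))
    rw [map_smul, map_smul, map_smul]

theorem evalAt_coef {x₀ : M} {U : Opens M} (hU : U ≤ trivDom B F V x₀)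
    (ℓ : Module.Dual ℝ (ExteriorAlgebra ℝ (Module.Dual ℝ F))) (s : (superFunctions B F V).Sec U)
    (x : U) : evalAt x (coef B F V hU ℓ s) = ℓ (extTriv F V x₀ x.1 (superEval x s)) := rfl

theorem coef_res {x₀ : M} {U W : Opens M} (hU : U ≤ trivDom B F V x₀) (h : W ≤ U)
    (ℓ : Module.Dual ℝ (ExteriorAlgebra ℝ (Module.Dual ℝ F))) (s : (superFunctions B F V).Sec U) :
    (smoothFunctions 𝓘(ℝ, B) M).res h (coef B F V hU ℓ s) =
      coef B F V (h.trans hU) ℓ ((superFunctions B F V).res h s) := rfl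

/-- Linear functionals separate points of the model fibre and the trivialization is injective, so
identities between superfunctions reduce to identities between smooth functions. -/
theorem coef_ext {x₀ : M} {U : Opens M} (hU : U ≤ trivDom B F V x₀)
    {s t : (superFunctions B F V).Sec U} (h : ∀ ℓ, coef B F V hU ℓ s = coef B F V hU ℓ t) :
    s = t := by
  refine superEval_ext fun x => ?_
  have hx := mem_baseSet_of_le B F V hU x
  apply Function.LeftInverse.injective (g := extTrivSymm F V x₀ x.1) (extTrivSymm_extTriv hx)
  refine sub_eq_zero.1 ((Module.forall_dual_apply_eq_zero_iff ℝ _).1 fun ℓ => ?_)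
  rw [map_sub, sub_eq_zero]
  exact congrArg (evalAt x) (h ℓ)

theorem coef_baseSec_mul {x₀ : M} {U : Opens M} (hU : U ≤ trivDom B F V x₀)
    (ℓ : Module.Dual ℝ (ExteriorAlgebra ℝ (Module.Dual ℝ F)))
    (f : (smoothFunctions 𝓘(ℝ, B) M).Sec U) (s : (superFunctions B F V).Sec U) :
    coef B F V hU ℓ (baseSec B F V U f * s) = f * coef B F V hU ℓ s := by
  refine evalAt_ext fun x => ?_
  rw [map_mul (evalAt x), evalAt_coef, evalAt_coef, map_mul, superEval_baseSec,
    ← Algebra.smul_def, map_smul, map_smul, smul_eq_mul]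

theorem coef_constSec {x₀ : M} {U : Opens M} (hU : U ≤ trivDom B F V x₀)
    (ℓ : Module.Dual ℝ (ExteriorAlgebra ℝ (Module.Dual ℝ F)))
    (a : ExteriorAlgebra ℝ (Module.Dual ℝ F)) :
    coef B F V hU ℓ (constSec B F V x₀ hU a) = algebraMap ℝ _ (ℓ a) := by
  refine evalAt_ext fun x => ?_
  rw [evalAt_coef, extTriv_constSec, AlgHom.commutes]
  rfl

/-- A basis of the model fibre of `Λ E*`. -/
abbrev extBasis : Module.Basis (Finset (Fin (Module.finrank ℝ (Module.Dual ℝ F)))) ℝ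
    (ExteriorAlgebra ℝ (Module.Dual ℝ F)) :=
  (Module.finBasis ℝ (Module.Dual ℝ F)).ExteriorAlgebra

theorem sum_coef_apply {x₀ : M} {U : Opens M} (hU : U ≤ trivDom B F V x₀)
    (ℓ : Module.Dual ℝ (ExteriorAlgebra ℝ (Module.Dual ℝ F)))
    (s : (superFunctions B F V).Sec U) :
    coef B F V hU ℓ s = ∑ J, ℓ (extBasis F J) • coef B F V hU ((extBasis F).coord J) s := by
  refine evalAt_ext fun x => ?_
  rw [map_sum]
  simp only [map_smul, evalAt_coef, smul_eq_mul]
  conv_lhs => rw [← (extBasis F).sum_repr (extTriv F V x₀ x.1 (superEval x s)), map_sum]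
  refine Finset.sum_congr rfl fun J _ => ?_
  rw [map_smul, smul_eq_mul, mul_comm]
  rfl

/-- The section with given coefficients. -/
theorem exists_sec_of_coef {x₀ : M} {U : Opens M} (hU : U ≤ trivDom B F V x₀)
    (s : (superFunctions B F V).Sec U) :
    s = ∑ J, baseSec B F V U (coef B F V hU ((extBasis F).coord J) s) *
      constSec B F V x₀ hU (extBasis F J) := by
  refine coef_ext B F V hU fun ℓ => ?_
  rw [map_sum, sum_coef_apply]
  refine Finset.sum_congr rfl fun J _ => ?_
  rw [coef_baseSec_mul, coef_constSec, mul_comm, Algebra.smul_def]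

/-- With parity expressed through coefficients, an operator that acts on coefficients is seen to
preserve or shift parity without inspecting the fibres. -/
theorem mem_par_iff_coef {x₀ : M} {U : Opens M} (hU : U ≤ trivDom B F V x₀) (q : ZMod 2)
    (s : (superFunctions B F V).Sec U) :
    s ∈ (superFunctions B F V).par U q ↔ ∀ ℓ : Module.Dual ℝ (ExteriorAlgebra ℝ (Module.Dual ℝ F)),
      coef B F V hU (ℓ ∘ₗ (CliffordAlgebra.involute
        (Q := (0 : QuadraticForm ℝ (Module.Dual ℝ F)))).toLinearMap) s =
      koszul 1 q • coef B F V hU ℓ s := by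
  have key : ∀ (x : U) (ℓ : Module.Dual ℝ (ExteriorAlgebra ℝ (Module.Dual ℝ F))),
      evalAt x (coef B F V hU (ℓ ∘ₗ (CliffordAlgebra.involute
        (Q := (0 : QuadraticForm ℝ (Module.Dual ℝ F)))).toLinearMap) s) =
      ℓ (extTriv F V x₀ x.1 (CliffordAlgebra.involute
        (Q := (0 : QuadraticForm ℝ (Module.Dual ℝ (V x.1)))) (superEval x s))) := fun x ℓ => by
    rw [evalAt_coef, extTriv_involute]
    rfl
  rw [mem_par_iff_involute]
  constructor
  · intro h ℓ
    refine evalAt_ext fun x => ?_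
    rw [key, h x, map_smul, map_smul, map_smul, evalAt_coef]
  · intro h x
    have hx := mem_baseSet_of_le B F V hU x
    apply Function.LeftInverse.injective (g := extTrivSymm F V x₀ x.1) (extTrivSymm_extTriv hx)
    refine sub_eq_zero.1 ((Module.forall_dual_apply_eq_zero_iff ℝ _).1 fun ℓ => ?_)
    rw [map_sub, sub_eq_zero, ← key, h ℓ, map_smul, map_smul, map_smul, evalAt_coef]

end SuperCoordinates

/-! ### The coordinate vector fields `∂/∂x_i` and `∂/∂η_j` on `Π E`. -/

section SuperFrame

open SuperSheaf

variable (B : Type*) [NormedAddCommGroup B] [NormedSpace ℝ B]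
  (F : Type*) [NormedAddCommGroup F] [NormedSpace ℝ F] [FiniteDimensional ℝ F]
  {M : Type*} [TopologicalSpace M] [ChartedSpace B M]
  (V : M → Type*) [TopologicalSpace (TotalSpace F V)]
  [∀ x, AddCommGroup (V x)] [∀ x, Module ℝ (V x)] [∀ x, TopologicalSpace (V x)]
  [FiberBundle F V] [VectorBundle ℝ F V]
  [FiniteDimensional ℝ B] [IsManifold 𝓘(ℝ, B) ∞ M] [ContMDiffVectorBundle ∞ F V 𝓘(ℝ, B)]

theorem trivDom_le_chartDom (x₀ : M) : trivDom B F V x₀ ≤ chartDom B x₀ := inf_le_right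

theorem baseSec_comm {U : Opens M} (f : (smoothFunctions 𝓘(ℝ, B) M).Sec U)
    (s : (superFunctions B F V).Sec U) :
    s * baseSec B F V U f = baseSec B F V U f * s :=
  superEval_ext fun x => by
    rw [map_mul (superEval x), map_mul (superEval x), superEval_baseSec]
    exact (Algebra.commutes _ _).symm

variable {B F V} in
/-- The action on coefficients of a vector field on the base, in a local trivialization. -/
def liftOp {x₀ : M} (D : (smoothFunctions 𝓘(ℝ, B) M).Vect (trivDom B F V x₀)) {W : Opens M}
    (h : W ≤ trivDom B F V x₀) : (superFunctions B F V).Sec W →ₗ[ℝ] (superFunctions B F V).Sec W :=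
  ∑ J, (LinearMap.mulRight ℝ (constSec B F V x₀ h (extBasis F J))) ∘ₗ
    (baseSec B F V W).toLinearMap ∘ₗ (app D h) ∘ₗ coef B F V h ((extBasis F).coord J)

section

variable {B F V} {x₀ : M} (D : (smoothFunctions 𝓘(ℝ, B) M).Vect (trivDom B F V x₀))
  {W : Opens M} (h : W ≤ trivDom B F V x₀)

/-- The operator is defined with a basis, but it acts by `D` on the coefficient along every
functional, because `D` is `ℝ`-linear. -/
theorem coef_liftOp (ℓ : Module.Dual ℝ (ExteriorAlgebra ℝ (Module.Dual ℝ F)))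
    (s : (superFunctions B F V).Sec W) :
    coef B F V h ℓ (liftOp D h s) = app D h (coef B F V h ℓ s) := by
  rw [liftOp, LinearMap.sum_apply, map_sum, sum_coef_apply B F V h ℓ s, map_sum]
  refine Finset.sum_congr rfl fun J _ => ?_
  change coef B F V h ℓ (baseSec B F V W (app D h (coef B F V h ((extBasis F).coord J) s)) *
    constSec B F V x₀ h (extBasis F J)) = _
  rw [coef_baseSec_mul, coef_constSec, mul_comm, ← Algebra.smul_def, map_smul]

theorem liftOp_baseSec_mul_constSec (f : (smoothFunctions 𝓘(ℝ, B) M).Sec W)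
    (a : ExteriorAlgebra ℝ (Module.Dual ℝ F)) :
    liftOp D h (baseSec B F V W f * constSec B F V x₀ h a) =
      baseSec B F V W (app D h f) * constSec B F V x₀ h a := by
  refine coef_ext B F V h fun ℓ => ?_
  rw [coef_liftOp, coef_baseSec_mul, coef_baseSec_mul, coef_constSec,
    app_mul_of_even (smooth_mem_der D), app_algebraMap, mul_zero, add_zero]

theorem res_liftOp {W' : Opens M} (h' : W' ≤ W) (s : (superFunctions B F V).Sec W) :
    (superFunctions B F V).res h' (liftOp D h s) =
      liftOp D (h'.trans h) ((superFunctions B F V).res h' s) :=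
  coef_ext B F V (h'.trans h) fun ℓ => by
    rw [coef_liftOp, ← coef_res B F V h h', coef_liftOp, res_app, coef_res]

theorem liftOp_mem_par {q : ZMod 2} {s : (superFunctions B F V).Sec W}
    (hs : s ∈ (superFunctions B F V).par W q) :
    liftOp D h s ∈ (superFunctions B F V).par W q := by
  rw [mem_par_iff_coef B F V h]
  intro ℓ
  rw [coef_liftOp, coef_liftOp, (mem_par_iff_coef B F V h q s).1 hs, map_smul]

/-- By bilinearity it is enough to treat products of a base function and a constant section. The
operator differentiates only the base functions, which commute with everything. -/
theorem liftOp_mul (s t : (superFunctions B F V).Sec W) :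
    liftOp D h (s * t) = liftOp D h s * t + s * liftOp D h t := by
  have key : ∀ (f g : (smoothFunctions 𝓘(ℝ, B) M).Sec W)
      (a b : ExteriorAlgebra ℝ (Module.Dual ℝ F)),
      liftOp D h ((baseSec B F V W f * constSec B F V x₀ h a) *
        (baseSec B F V W g * constSec B F V x₀ h b)) =
      liftOp D h (baseSec B F V W f * constSec B F V x₀ h a) *
        (baseSec B F V W g * constSec B F V x₀ h b) +
      (baseSec B F V W f * constSec B F V x₀ h a) *
        liftOp D h (baseSec B F V W g * constSec B F V x₀ h b) := by
    intro f g a b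
    have hmul : ∀ f g : (smoothFunctions 𝓘(ℝ, B) M).Sec W,
        (baseSec B F V W f * constSec B F V x₀ h a) *
        (baseSec B F V W g * constSec B F V x₀ h b) =
        baseSec B F V W (f * g) * constSec B F V x₀ h (a * b) := by
      intro f g
      rw [map_mul, map_mul, mul_assoc, ← mul_assoc (constSec B F V x₀ h a), baseSec_comm,
        mul_assoc, mul_assoc]
    rw [hmul, liftOp_baseSec_mul_constSec, liftOp_baseSec_mul_constSec,
      liftOp_baseSec_mul_constSec, hmul, hmul, app_mul_of_even (smooth_mem_der D), map_add,
      add_mul]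
  rw [exists_sec_of_coef B F V h s, exists_sec_of_coef B F V h t]
  simp only [Finset.sum_mul, Finset.mul_sum, map_sum, key, Finset.sum_add_distrib]

end

variable {B F V} in
theorem liftOp_mem_der {x₀ : M} (D : (smoothFunctions 𝓘(ℝ, B) M).Vect (trivDom B F V x₀)) :
    (fun W => liftOp D W.2 : (superFunctions B F V).Ops (trivDom B F V x₀)) ∈
      (superFunctions B F V).der (trivDom B F V x₀) 0 := by
  refine ⟨fun W W' h s => res_liftOp D W.2 h s, fun W q s hs => ?_, fun W q s _ t => ?_⟩
  · rw [zero_add]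
    exact liftOp_mem_par D W.2 hs
  · rw [koszul_zero_left, one_smul]
    exact liftOp_mul D W.2 s t

/-- The even vector field that acts on coefficients in a local trivialization. -/
def liftVect {x₀ : M} (D : (smoothFunctions 𝓘(ℝ, B) M).Vect (trivDom B F V x₀)) :
    (superFunctions B F V).Vect (trivDom B F V x₀) :=
  ⟨fun W => liftOp D W.2, der_le_tan _ 0 (liftOp_mem_der D)⟩

theorem liftVect_baseSec {x₀ : M} (D : (smoothFunctions 𝓘(ℝ, B) M).Vect (trivDom B F V x₀))
    {W : Opens M} (h : W ≤ trivDom B F V x₀) (f : (smoothFunctions 𝓘(ℝ, B) M).Sec W) :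
    app (liftVect B F V D) h (baseSec B F V W f) = baseSec B F V W (app D h f) := by
  have := liftOp_baseSec_mul_constSec D h f 1
  rwa [map_one, mul_one, mul_one] at this

theorem liftVect_constSec {x₀ : M} (D : (smoothFunctions 𝓘(ℝ, B) M).Vect (trivDom B F V x₀))
    {W : Opens M} (h : W ≤ trivDom B F V x₀) (a : ExteriorAlgebra ℝ (Module.Dual ℝ F)) :
    app (liftVect B F V D) h (constSec B F V x₀ h a) = 0 := by
  have := liftOp_baseSec_mul_constSec D h 1 a
  rwa [map_one, one_mul, app_one, map_zero, zero_mul] at this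

theorem koszul_one_add (q : ZMod 2) : koszul 1 (1 + q) = -koszul 1 q := by
  have h2 : (1 + 1 : ZMod 2) = 0 := by decide
  rcases zmod_two_eq q with rfl | rfl <;> simp [koszul, h2]

variable {B F V} in
/-- The fibrewise contraction by a vector of the model fibre, in a local trivialization. -/
def contractOp {x₀ : M} (d : Module.Dual ℝ (Module.Dual ℝ F)) {W : Opens M}
    (h : W ≤ trivDom B F V x₀) : (superFunctions B F V).Sec W →ₗ[ℝ] (superFunctions B F V).Sec W :=
  ∑ J, (LinearMap.mulRight ℝ (constSec B F V x₀ h (extContract d (extBasis F J)))) ∘ₗ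
    (baseSec B F V W).toLinearMap ∘ₗ coef B F V h ((extBasis F).coord J)

section

variable {B F V} {x₀ : M} (d : Module.Dual ℝ (Module.Dual ℝ F))
  {W : Opens M} (h : W ≤ trivDom B F V x₀)

/-- This removes the basis from the definition: the operator is contraction of the model fibre
conjugated by the trivialization, so its algebraic rules are inherited fibrewise. -/
theorem superEval_contractOp (s : (superFunctions B F V).Sec W) (x : W) :
    superEval x (contractOp d h s) =
      extTrivSymm F V x₀ x.1 (extContract d (extTriv F V x₀ x.1 (superEval x s))) := by
  conv_rhs => rw [← (extBasis F).sum_repr (extTriv F V x₀ x.1 (superEval x s)), map_sum, map_sum]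
  rw [contractOp, LinearMap.sum_apply, map_sum]
  refine Finset.sum_congr rfl fun J _ => ?_
  change superEval x (baseSec B F V W (coef B F V h ((extBasis F).coord J) s) *
    constSec B F V x₀ h (extContract d (extBasis F J))) = _
  rw [map_mul (superEval x), superEval_baseSec, superEval_constSec, evalAt_coef,
    ← Algebra.smul_def, map_smul, map_smul]
  rfl

theorem coef_contractOp (ℓ : Module.Dual ℝ (ExteriorAlgebra ℝ (Module.Dual ℝ F)))
    (s : (superFunctions B F V).Sec W) :
    coef B F V h ℓ (contractOp d h s) = coef B F V h (ℓ ∘ₗ extContract d) s := by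
  refine evalAt_ext fun x => ?_
  rw [evalAt_coef, evalAt_coef, superEval_contractOp,
    extTriv_extTrivSymm (mem_baseSet_of_le B F V h x)]
  rfl

theorem res_contractOp {W' : Opens M} (h' : W' ≤ W) (s : (superFunctions B F V).Sec W) :
    (superFunctions B F V).res h' (contractOp d h s) =
      contractOp d (h'.trans h) ((superFunctions B F V).res h' s) :=
  coef_ext B F V (h'.trans h) fun ℓ => by
    rw [coef_contractOp, ← coef_res B F V h h', coef_contractOp, coef_res]

theorem contractOp_mem_par {q : ZMod 2} {s : (superFunctions B F V).Sec W}
    (hs : s ∈ (superFunctions B F V).par W q) :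
    contractOp d h s ∈ (superFunctions B F V).par W (1 + q) := by
  rw [mem_par_iff_coef B F V h]
  intro ℓ
  have hcomp : (ℓ ∘ₗ (CliffordAlgebra.involute
      (Q := (0 : QuadraticForm ℝ (Module.Dual ℝ F)))).toLinearMap) ∘ₗ extContract d =
      -((ℓ ∘ₗ extContract d) ∘ₗ (CliffordAlgebra.involute
        (Q := (0 : QuadraticForm ℝ (Module.Dual ℝ F)))).toLinearMap) := by
    refine LinearMap.ext fun a => ?_
    change ℓ (CliffordAlgebra.involute (Q := (0 : QuadraticForm ℝ (Module.Dual ℝ F)))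
      (extContract d a)) = -ℓ (extContract d _)
    rw [involute_extContract, map_neg]
    rfl
  have hneg : ∀ m : Module.Dual ℝ (ExteriorAlgebra ℝ (Module.Dual ℝ F)),
      coef B F V h (-m) s = -coef B F V h m s := fun m => evalAt_ext fun x => by
    rw [map_neg]; rfl
  rw [coef_contractOp, coef_contractOp, hcomp, hneg, (mem_par_iff_coef B F V h q s).1 hs,
    koszul_one_add, neg_smul]

theorem contractOp_mul {q : ZMod 2} {s : (superFunctions B F V).Sec W}
    (hs : s ∈ (superFunctions B F V).par W q) (t : (superFunctions B F V).Sec W) :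
    contractOp d h (s * t) = contractOp d h s * t + koszul 1 q • (s * contractOp d h t) := by
  refine superEval_ext fun x => ?_
  have hx := mem_baseSet_of_le B F V h x
  have hs' := congrArg (extTriv F V x₀ x.1) (mem_par_iff_involute.1 hs x)
  rw [extTriv_involute, map_smul] at hs'
  rw [map_add (superEval x), map_smul (superEval x), map_mul (superEval x), map_mul (superEval x),
    superEval_contractOp, superEval_contractOp, superEval_contractOp, map_mul (superEval x),
    map_mul (extTriv F V x₀ x.1), extContract_mul, map_add, map_mul, map_mul, hs',
    extTrivSymm_extTriv hx, map_smul, extTrivSymm_extTriv hx, smul_mul_assoc]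

end

variable {B F V} in
theorem contractOp_mem_der (x₀ : M) (d : Module.Dual ℝ (Module.Dual ℝ F)) :
    (fun W => contractOp d W.2 : (superFunctions B F V).Ops (trivDom B F V x₀)) ∈
      (superFunctions B F V).der (trivDom B F V x₀) 1 :=
  ⟨fun W _ h s => res_contractOp d W.2 h s, fun W _ _ hs => contractOp_mem_par d W.2 hs,
    fun W _ _ hs t => contractOp_mul d W.2 hs t⟩

/-- The odd vector field given by contraction in a local trivialization. -/
def contractVect (x₀ : M) (d : Module.Dual ℝ (Module.Dual ℝ F)) :
    (superFunctions B F V).Vect (trivDom B F V x₀) :=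
  ⟨fun W => contractOp d W.2, der_le_tan _ 1 (contractOp_mem_der x₀ d)⟩

theorem contractVect_constSec (x₀ : M) (d : Module.Dual ℝ (Module.Dual ℝ F))
    {W : Opens M} (h : W ≤ trivDom B F V x₀) (a : ExteriorAlgebra ℝ (Module.Dual ℝ F)) :
    app (contractVect B F V x₀ d) h (constSec B F V x₀ h a) =
      constSec B F V x₀ h (extContract d a) := superEval_ext fun x => by
  rw [superEval_constSec]
  refine (superEval_contractOp d h _ x).trans ?_
  exact congrArg (fun b => extTrivSymm F V x₀ x.1 (extContract d b))
    (extTriv_constSec B F V h a x)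

theorem contractVect_baseSec (x₀ : M) (d : Module.Dual ℝ (Module.Dual ℝ F))
    {W : Opens M} (h : W ≤ trivDom B F V x₀) (f : (smoothFunctions 𝓘(ℝ, B) M).Sec W) :
    app (contractVect B F V x₀ d) h (baseSec B F V W f) = 0 := superEval_ext fun x => by
  rw [map_zero]
  refine (superEval_contractOp d h _ x).trans ?_
  rw [superEval_baseSec, AlgHom.commutes, extContract_algebraMap, map_zero]

theorem odd_ι (φ : Module.Dual ℝ F) : ExteriorAlgebra.ι ℝ φ ∈
    CliffordAlgebra.evenOdd (0 : QuadraticForm ℝ (Module.Dual ℝ F)) 1 :=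
  CliffordAlgebra.ι_mem_evenOdd_one _ φ

/-- Superfunctions over `W` of the form `η_j`. -/
def oddCoord (x₀ : M) {W : Opens M} (h : W ≤ trivDom B F V x₀) (j : Fin (Module.finrank ℝ F)) :
    (superFunctions B F V).Sec W :=
  constSec B F V x₀ h (ExteriorAlgebra.ι ℝ ((Module.finBasis ℝ F).coord j))

/-- The sections `η_j` generate the constant sections as an algebra. The graded Leibniz rule for the
homogeneous `D` carries the vanishing from generators to products. -/
theorem constSec_eq_zero {x₀ : M} {U : Opens M} (h : U ≤ trivDom B F V x₀) {p : ZMod 2}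
    {D : (superFunctions B F V).Vect U} (hD : D.1 ∈ (superFunctions B F V).der U p)
    (H : ∀ j, app D le_rfl (oddCoord B F V x₀ h j) = 0)
    (a : ExteriorAlgebra ℝ (Module.Dual ℝ F)) : app D le_rfl (constSec B F V x₀ h a) = 0 := by
  induction a using CliffordAlgebra.left_induction with
  | algebraMap r =>
    exact (congrArg (app D le_rfl) (AlgHom.commutes (constSec B F V x₀ h) r)).trans
      (app_algebraMap D _ r)
  | add a b ha hb => rw [map_add, map_add, ha, hb, add_zero]
  | ι_mul a m ha =>
    have hm : app D le_rfl (constSec B F V x₀ h (ExteriorAlgebra.ι ℝ m)) = 0 := by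
      have e : m = ∑ j, m (Module.finBasis ℝ F j) • (Module.finBasis ℝ F).coord j := by
        refine (Module.finBasis ℝ F).ext fun k => ?_
        simp
      rw [e]
      simp only [map_sum, map_smul]
      refine Finset.sum_eq_zero fun j _ => ?_
      have := H j
      rw [oddCoord] at this
      rw [this, smul_zero]
    have hmul := app_mul hD le_rfl (constSec_mem B F V h (odd_ι F m)) (constSec B F V x₀ h a)
    rw [← map_mul, hm, zero_mul, ha, mul_zero, smul_zero, add_zero] at hmul
    exact hmul

/-- The coordinates `x_i`, `η_j` of `Π E` over an open set with a chart and a trivialization,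
together with the coordinate vector fields. -/
def superFrame (x₀ : M) : (superFunctions B F V).Frame (trivDom B F V x₀) (CoordIdx B F) where
  parity := Sum.elim (fun _ => 0) fun _ => 1
  coord := Sum.elim
    (fun i => baseSec B F V _ ((smoothFunctions 𝓘(ℝ, B) M).res (trivDom_le_chartDom B F V x₀)
      (chartCoord 𝓘(ℝ, B) (Module.finBasis ℝ B) x₀ i)))
    fun j => oddCoord B F V x₀ le_rfl j
  vect := Sum.elim
    (fun i => liftVect B F V (resVect (trivDom_le_chartDom B F V x₀) (chartVect x₀ (Module.finBasis ℝ B i))))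
    fun j => contractVect B F V x₀ (Module.Dual.eval ℝ F (Module.finBasis ℝ F j))
  coord_mem a := by
    rcases a with i | j
    · exact baseSec_mem B F V _
    · exact constSec_mem B F V _ (odd_ι F _)
  vect_mem a := by
    rcases a with i | j
    · exact liftOp_mem_der _
    · exact contractOp_mem_der _ _
  vect_coord a := by
    classical
    rcases a with i | j
    · simp only [Sum.elim_inl]
      rw [liftVect_baseSec, resVect_app, ← res_app _ le_rfl, chartVect_chartCoord, if_pos rfl,
        map_one, map_one]
    · simp only [Sum.elim_inr]
      rw [oddCoord, contractVect_constSec, extContract_ι]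
      simp
  vect_coord_of_ne a b hab := by
    classical
    rcases a with i | j <;> rcases b with i' | j'
    · simp only [Sum.elim_inl]
      rw [liftVect_baseSec, resVect_app, ← res_app _ le_rfl, chartVect_chartCoord,
        if_neg (fun h => hab (congrArg _ h)), map_zero, map_zero]
    · exact liftVect_constSec B F V _ _ _
    · exact contractVect_baseSec B F V _ _ _ _
    · simp only [Sum.elim_inr]
      have hne : j ≠ j' := fun h => hab (congrArg _ h)
      rw [oddCoord, contractVect_constSec, extContract_ι]
      simp [hne]
  eq_zero U h p D hD H := by
    refine Vect.ext' fun W hW s => ?_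
    -- Functions from the base are covered by the chain rule, constant sections by generation from
    -- the `η_j`; every superfunction is a sum of products of the two kinds.
    have hbase : ∀ f, app D hW (baseSec B F V W f) = 0 := by
      intro f
      refine ((superPullback B F V).app_hom (Module.finBasis ℝ B)
        ((hW.trans h).trans (trivDom_le_chartDom B F V x₀)) (resVect hW D) f).trans
        (Finset.sum_eq_zero fun i _ => ?_)
      have hi := congrArg ((superFunctions B F V).res hW) (H (Sum.inl i))
      rw [res_app, map_zero] at hi
      exact (congrArg (fun t : (superFunctions B F V).Sec W => t * _) hi).trans (zero_mul _)
    have hconst : ∀ a, app D hW (constSec B F V x₀ (hW.trans h) a) = 0 := by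
      refine constSec_eq_zero B F V (hW.trans h) (resVect_mem_der hW hD) fun j => ?_
      have hj := congrArg ((superFunctions B F V).res hW) (H (Sum.inr j))
      rw [res_app, map_zero] at hj
      exact hj
    rw [zero_app, exists_sec_of_coef B F V (hW.trans h) s, map_sum]
    refine Finset.sum_eq_zero fun J _ => ?_
    rw [app_mul_of_even_left _ _ (baseSec_mem B F V _), hbase, hconst, zero_mul, mul_zero, add_zero]

end SuperFrame

/-! ### The affine function attached to an element of the exterior algebra. -/

section AffineValue

variable {K : Type*} [AddCommGroup K] [Module ℝ K]

/-- The value at `v` of the affine function given by the components of degrees zero and one. -/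
def affineValue (v : K) : ExteriorAlgebra ℝ (Module.Dual ℝ K) →ₗ[ℝ] ℝ :=
  ExteriorAlgebra.algebraMapInv.toLinearMap + LinearMap.applyₗ v ∘ₗ ExteriorAlgebra.ιInv

theorem affineValue_apply (v : K) (a : ExteriorAlgebra ℝ (Module.Dual ℝ K)) :
    affineValue v a = ExteriorAlgebra.algebraMapInv a +
      (ExteriorAlgebra.ιInv a : Module.Dual ℝ K) v := rfl

theorem affineValue_of_even (v : K) {a : ExteriorAlgebra ℝ (Module.Dual ℝ K)}
    (ha : a ∈ CliffordAlgebra.evenOdd (0 : QuadraticForm ℝ (Module.Dual ℝ K)) 0) :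
    affineValue v a = ExteriorAlgebra.algebraMapInv a := by
  rw [affineValue_apply, ιInv_eq_zero_of_even ha, LinearMap.zero_apply, add_zero]

theorem affineValue_of_odd (v : K) {a : ExteriorAlgebra ℝ (Module.Dual ℝ K)}
    (ha : a ∈ CliffordAlgebra.evenOdd (0 : QuadraticForm ℝ (Module.Dual ℝ K)) 1) :
    affineValue v a = (ExteriorAlgebra.ιInv a : Module.Dual ℝ K) v := by
  rw [affineValue_apply, algebraMapInv_eq_zero_of_odd ha, zero_add]

theorem affineValue_algebraMap (v : K) (c : ℝ) : affineValue v (algebraMap ℝ _ c) = c := by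
  rw [affineValue_apply, algebraMapInv_algebraMap, ιInv_algebraMap, LinearMap.zero_apply, add_zero]

theorem affineValue_algebraMap_add_ι (v : K) (c : ℝ) (φ : Module.Dual ℝ K) :
    affineValue v (algebraMap ℝ _ c + ExteriorAlgebra.ι ℝ φ) = c + φ v := by
  rw [affineValue_apply, map_add, map_add, algebraMapInv_algebraMap, algebraMapInv_ι,
    ιInv_algebraMap, ιInv_ι, add_zero, zero_add]

/-- Only degrees zero and one are seen, where the product rule is that of a square-zero extension.
The subtraction corrects for the product of the scalar parts, which occurs in both preceding terms.
-/
theorem affineValue_mul (v : K) (a b : ExteriorAlgebra ℝ (Module.Dual ℝ K)) :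
    affineValue v (a * b) = ExteriorAlgebra.algebraMapInv a * affineValue v b +
      ExteriorAlgebra.algebraMapInv b * affineValue v a -
      ExteriorAlgebra.algebraMapInv a * ExteriorAlgebra.algebraMapInv b := by
  rw [affineValue_apply, affineValue_apply, affineValue_apply, map_mul, ιInv_mul,
    LinearMap.add_apply, LinearMap.smul_apply, LinearMap.smul_apply, smul_eq_mul, smul_eq_mul]
  ring

/-- An affine function on the fibre determines its constant term by its value at zero, and then its
linear part. -/
theorem eq_of_affineValue_eq {a : ExteriorAlgebra ℝ (Module.Dual ℝ K)} {c : ℝ}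
    {φ : Module.Dual ℝ K} (h : ∀ v, c + φ v = affineValue v a) :
    algebraMap ℝ (ExteriorAlgebra ℝ (Module.Dual ℝ K)) c + ExteriorAlgebra.ι ℝ φ =
      algebraMap ℝ _ (ExteriorAlgebra.algebraMapInv a) +
        ExteriorAlgebra.ι ℝ (ExteriorAlgebra.ιInv a) := by
  have hc : c = ExteriorAlgebra.algebraMapInv a := by
    have := h 0
    rwa [affineValue_apply, map_zero, map_zero, add_zero, add_zero] at this
  have hφ : φ = ExteriorAlgebra.ιInv a := LinearMap.ext fun v => by
    have := h v
    rw [affineValue_apply, hc] at this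
    exact add_left_cancel this
  rw [hc, hφ]

end AffineValue

/-! ### The map `ψ`, its multiplicativity, and relatedness of vector fields. -/

section Transport

open SuperSheaf

variable (B : Type*) [NormedAddCommGroup B] [NormedSpace ℝ B]
  (F : Type*) [NormedAddCommGroup F] [NormedSpace ℝ F] [FiniteDimensional ℝ F]
  {M : Type*} [TopologicalSpace M] [ChartedSpace B M]
  (V : M → Type*) [TopologicalSpace (TotalSpace F V)]
  [∀ x, AddCommGroup (V x)] [∀ x, Module ℝ (V x)] [∀ x, TopologicalSpace (V x)]
  [FiberBundle F V] [VectorBundle ℝ F V]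
  [FiniteDimensional ℝ B] [IsManifold 𝓘(ℝ, B) ∞ M] [ContMDiffVectorBundle ∞ F V 𝓘(ℝ, B)]

/-- The superfunctions of degree at most one. -/
def degLeOne (U : Opens M) : Submodule ℝ ((superFunctions B F V).Sec U) where
  carrier := {s | IsDegLeOne B F V s}
  zero_mem' x := ⟨0, 0, by rw [map_zero, map_zero, add_zero]; rfl⟩
  add_mem' {s t} hs ht x := by
    obtain ⟨c, φ, h⟩ := hs x
    obtain ⟨c', φ', h'⟩ := ht x
    refine ⟨c + c', φ + φ', ?_⟩
    rw [Sec.add_val, h, h', map_add, map_add]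
    abel
  smul_mem' r s hs x := by
    obtain ⟨c, φ, h⟩ := hs x
    refine ⟨r * c, r • φ, ?_⟩
    refine (congrArg (fun a : ExtFiber V x.1 => r • a) h).trans ?_
    rw [smul_add, map_mul, map_smul, Algebra.smul_def r (algebraMap ℝ _ c)]

theorem IsDegLeOne.res {U W : Opens M} (h : W ≤ U) {s : (superFunctions B F V).Sec U}
    (hs : IsDegLeOne B F V s) : IsDegLeOne B F V ((superFunctions B F V).res h s) :=
  fun x => hs ⟨x.1, h x.2⟩

theorem isDegLeOne_baseSec {U : Opens M} (f : (smoothFunctions 𝓘(ℝ, B) M).Sec U) :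
    IsDegLeOne B F V (baseSec B F V U f) :=
  fun x => ⟨evalAt x f, 0, by rw [map_zero, add_zero]; rfl⟩

theorem IsDegLeOne.baseSec_mul {U : Opens M} (f : (smoothFunctions 𝓘(ℝ, B) M).Sec U)
    {s : (superFunctions B F V).Sec U} (hs : IsDegLeOne B F V s) :
    IsDegLeOne B F V (baseSec B F V U f * s) := fun x => by
  obtain ⟨c, φ, h⟩ := hs x
  refine ⟨evalAt x f * c, evalAt x f • φ, ?_⟩
  refine (congrArg (fun a : ExtFiber V x.1 => superEval x (baseSec B F V U f) * a) h).trans ?_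
  rw [superEval_baseSec, mul_add, map_mul, map_smul, Algebra.smul_def (evalAt x f)]

/-- The transport of superfunctions to the total space is linear. -/
def psiHom (U : Opens M) :
    (superFunctions B F V).Sec U →ₗ[ℝ] (totalFunctions B F V).Sec (above F V U) where
  toFun := psi B F V
  map_add' s t := evalAt_ext fun e =>
    map_add (affineValue e.1.snd) (superEval (projAbove F V e) s) (superEval (projAbove F V e) t)
  map_smul' c s := evalAt_ext fun e =>
    map_smul (affineValue e.1.snd) c (superEval (projAbove F V e) s)

theorem psiHom_apply {U : Opens M} (s : (superFunctions B F V).Sec U) :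
    psiHom B F V U s = psi B F V s := rfl

theorem evalAt_psiHom {U : Opens M} (s : (superFunctions B F V).Sec U) (e : above F V U) :
    evalAt e (psiHom B F V U s) = affineValue e.1.snd (superEval (projAbove F V e) s) := rfl

theorem psiHom_res {U W : Opens M} (h : W ≤ U) (s : (superFunctions B F V).Sec U) :
    (totalFunctions B F V).res (above_mono F V h) (psiHom B F V U s) =
      psiHom B F V W ((superFunctions B F V).res h s) := rfl

/-- The pullback of functions on the base to functions on the total space. -/
abbrev totalHom (U : Opens M) :
    (smoothFunctions 𝓘(ℝ, B) M).Sec U →ₐ[ℝ] (totalFunctions B F V).Sec (above F V U) :=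
  (totalPullback B F V).hom U

theorem evalAt_totalHom {U : Opens M} (f : (smoothFunctions 𝓘(ℝ, B) M).Sec U) (e : above F V U) :
    evalAt e (totalHom B F V U f) = evalAt (projAbove F V e) f := rfl

theorem psiHom_baseSec {U : Opens M} (f : (smoothFunctions 𝓘(ℝ, B) M).Sec U) :
    psiHom B F V U (baseSec B F V U f) = totalHom B F V U f := evalAt_ext fun e =>
  affineValue_algebraMap e.1.snd (evalAt (projAbove F V e) f)

/-- The part of degree zero of a superfunction. -/
def basePart {U : Opens M} (s : (superFunctions B F V).Sec U) :
    (smoothFunctions 𝓘(ℝ, B) M).Sec U :=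
  ⟨fun x => (ExteriorAlgebra.algebraMapInv (superEval x s) : ℝ), fun x => by
    have h := s.2 x.1 (ExteriorAlgebra.algebraMapInv (R := ℝ) (M := Module.Dual ℝ F)).toLinearMap x
      (FiberBundle.mem_baseSet_trivializationAt' x.1)
    refine h.congr_of_eventuallyEq (Filter.Eventually.of_forall fun y => ?_)
    exact (algebraMapInv_extTriv F V x.1 y.1 (superEval y s)).symm⟩

theorem evalAt_basePart {U : Opens M} (s : (superFunctions B F V).Sec U) (x : U) :
    evalAt x (basePart B F V s) = ExteriorAlgebra.algebraMapInv (superEval x s) := rfl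

theorem basePart_eq_zero_of_odd {U : Opens M} {s : (superFunctions B F V).Sec U}
    (hs : s ∈ (superFunctions B F V).par U 1) : basePart B F V s = 0 :=
  evalAt_ext fun x => algebraMapInv_eq_zero_of_odd (hs x)

theorem psiHom_mul {U : Opens M} (s t : (superFunctions B F V).Sec U) :
    psiHom B F V U (s * t) = totalHom B F V U (basePart B F V s) * psiHom B F V U t +
      totalHom B F V U (basePart B F V t) * psiHom B F V U s -
      totalHom B F V U (basePart B F V s) * totalHom B F V U (basePart B F V t) :=
  evalAt_ext fun e => by
    rw [map_sub, map_add, map_mul (evalAt e), map_mul (evalAt e), map_mul (evalAt e),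
      evalAt_psiHom, evalAt_psiHom, evalAt_psiHom, evalAt_totalHom, evalAt_totalHom,
      evalAt_basePart, evalAt_basePart, map_mul (superEval _)]
    exact affineValue_mul _ _ _

theorem psiHom_of_even {U : Opens M} {s : (superFunctions B F V).Sec U}
    (hs : s ∈ (superFunctions B F V).par U 0) :
    psiHom B F V U s = totalHom B F V U (basePart B F V s) := evalAt_ext fun e =>
  affineValue_of_even e.1.snd (hs (projAbove F V e))

/-- Transport is multiplicative when one factor is even. -/
theorem psiHom_mul_of_even {U : Opens M} {s : (superFunctions B F V).Sec U}
    (hs : s ∈ (superFunctions B F V).par U 0) (t : (superFunctions B F V).Sec U) :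
    psiHom B F V U (s * t) = psiHom B F V U s * psiHom B F V U t := by
  rw [psiHom_mul, psiHom_of_even B F V hs]
  ring

/-- The odd factor starts in degree one, so only the degree-zero part of the other factor survives
modulo degree two. -/
theorem psiHom_mul_of_odd {U : Opens M} {s : (superFunctions B F V).Sec U}
    (hs : s ∈ (superFunctions B F V).par U 1) (t : (superFunctions B F V).Sec U) :
    psiHom B F V U (s * t) = psiHom B F V U s * totalHom B F V U (basePart B F V t) := by
  rw [psiHom_mul, basePart_eq_zero_of_odd B F V hs, map_zero]
  ring

theorem isBasic_psiHom {U : Opens M} {s : (superFunctions B F V).Sec U}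
    (hs : s ∈ (superFunctions B F V).par U 0) : IsBasic B F V (psiHom B F V U s) := by
  rw [psiHom_of_even B F V hs]
  exact ⟨basePart B F V s, fun _ => rfl⟩

theorem isFibreLinear_psiHom {U : Opens M} {s : (superFunctions B F V).Sec U}
    (hs : s ∈ (superFunctions B F V).par U 1) : IsFibreLinear B F V (psiHom B F V U s) :=
  fun x => ⟨ExteriorAlgebra.ιInv (superEval x s), fun v => affineValue_of_odd v (hs x)⟩

theorem IsBasic.exists_eq {U : Opens M} {g : (totalFunctions B F V).Sec (above F V U)}
    (hg : IsBasic B F V g) : ∃ w, g = psiHom B F V U (baseSec B F V U w) := by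
  obtain ⟨w, hw⟩ := hg
  exact ⟨w, by rw [psiHom_baseSec]; exact Sec.ext' hw⟩

theorem IsFibreLinear.exists_eq {U : Opens M} {g : (totalFunctions B F V).Sec (above F V U)}
    (hg : IsFibreLinear B F V g) : ∃ s, s ∈ (superFunctions B F V).par U 1 ∧ IsDegLeOne B F V s ∧
      g = psiHom B F V U s := by
  choose φ hφ using hg
  refine ⟨⟨_, ι_mem_sec_of_fibreLinear B F V g φ hφ⟩, fun x => ?_, fun x => ⟨0, φ x, ?_⟩,
    evalAt_ext fun e => ?_⟩
  · exact CliffordAlgebra.ι_mem_evenOdd_one _ (φ x)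
  · rw [map_zero, zero_add]
  · refine (hφ (projAbove F V e) e.1.snd).trans (Eq.symm ?_)
    have h := affineValue_algebraMap_add_ι e.1.snd 0 (φ (projAbove F V e))
    rw [map_zero, zero_add, zero_add] at h
    exact h

theorem evalAt_psiHom_of_eq {U : Opens M} {s : (superFunctions B F V).Sec U} {x : U} {c : ℝ}
    {φ : Module.Dual ℝ (V x.1)}
    (h : s.1 x = algebraMap ℝ (ExtFiber V x.1) c + ExteriorAlgebra.ι ℝ φ) (v : V x.1) :
    evalAt (⟨⟨x.1, v⟩, x.2⟩ : above F V U) (psiHom B F V U s) = c + φ v :=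
  (congrArg (affineValue v) h).trans (affineValue_algebraMap_add_ι v c φ)

/-- `ψ` factors through `pr` and is injective in degrees at most one, so the projection can be
replaced by an equation between functions on `E`. -/
theorem prFiber_eq_iff {U : Opens M} {s t : (superFunctions B F V).Sec U}
    (ht : IsDegLeOne B F V t) :
    (∀ x : U, t.1 x = prFiber V x.1 (s.1 x)) ↔ psiHom B F V U t = psiHom B F V U s := by
  constructor
  · intro h
    refine evalAt_ext fun e => ?_
    exact (evalAt_psiHom_of_eq B F V (x := projAbove F V e) (h _) e.1.snd).trans
      (affineValue_apply _ _).symm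
  · intro h x
    obtain ⟨c, φ, h1⟩ := ht x
    refine h1.trans (eq_of_affineValue_eq fun v => ?_)
    exact (evalAt_psiHom_of_eq B F V h1 v).symm.trans
      (congrArg (evalAt (⟨⟨x.1, v⟩, x.2⟩ : above F V U)) h)

theorem IsDegLeOne.eq_of_psiHom_eq {U : Opens M} {s t : (superFunctions B F V).Sec U}
    (hs : IsDegLeOne B F V s) (ht : IsDegLeOne B F V t)
    (h : psiHom B F V U s = psiHom B F V U t) : s = t := Sec.ext' fun x =>
  ((prFiber_eq_iff B F V hs).2 h x).trans ((prFiber_eq_iff B F V ht).2 rfl x).symm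

theorem IsDegLeOne.eq_baseSec {U : Opens M} {s : (superFunctions B F V).Sec U}
    (hs : IsDegLeOne B F V s) (h : s ∈ (superFunctions B F V).par U 0) :
    s = baseSec B F V U (basePart B F V s) :=
  hs.eq_of_psiHom_eq B F V (isDegLeOne_baseSec B F V _) (by
    rw [psiHom_of_even B F V h, psiHom_baseSec])

/-- Because `ψ ∘ pr = ψ`, a field of `𝓛` is the projection of `D` exactly when it has the same
transport as `D`. This turns statements about `p` into statements about `Ψ`. -/
theorem isProjOf_iff {U : Opens M} {Z D : (superFunctions B F V).Vect U}
    {D' : (totalFunctions B F V).Vect (above F V U)} (hD : PsiRelated B F V D D')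
    (hZ : IsEvenLinear B F V Z) : IsProjOf B F V Z D ↔ PsiRelated B F V Z D' := by
  constructor
  · intro h W hW s hs
    exact (hD W hW s hs).trans ((prFiber_eq_iff B F V (hZ.2 W hW s hs)).1 (h.2 W hW s hs)).symm
  · intro h
    exact ⟨hZ, fun W hW s hs => (prFiber_eq_iff B F V (hZ.2 W hW s hs)).2
      ((h W hW s hs).symm.trans (hD W hW s hs))⟩

theorem IsProjOf.psiRelated_iff {U : Opens M} {Z D : (superFunctions B F V).Vect U}
    {D' : (totalFunctions B F V).Vect (above F V U)} (h : IsProjOf B F V Z D) :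
    PsiRelated B F V Z D' ↔ PsiRelated B F V D D' := by
  refine ⟨fun h' W hW s hs => ?_, fun h' => (isProjOf_iff B F V h' h.1).1 h⟩
  exact (h' W hW s hs).trans ((prFiber_eq_iff B F V (h.1.2 W hW s hs)).1 (h.2 W hW s hs))

/-- Only evenness of `D` matters: `ψ` sends even superfunctions to basic functions and odd ones to
fibrewise linear functions, whatever their higher-degree terms. -/
theorem PsiRelated.isEvenLinearAbove {U : Opens M} {D : (superFunctions B F V).Vect U}
    (hD : D.1 ∈ (superFunctions B F V).der U 0)
    {D' : (totalFunctions B F V).Vect (above F V U)} (h : PsiRelated B F V D D') :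
    IsEvenLinearAbove B F V D' := by
  refine fun W hW g => ⟨fun hg => ?_, fun hg => ?_⟩
  · obtain ⟨w, rfl⟩ := hg.exists_eq B F V
    rw [psiHom_apply, h W hW _ (isDegLeOne_baseSec B F V w)]
    have := app_mem_par hD hW (baseSec_mem B F V w)
    exact isBasic_psiHom B F V this
  · obtain ⟨s, hs, hs1, rfl⟩ := hg.exists_eq B F V
    rw [psiHom_apply, h W hW _ hs1]
    have := app_mem_par hD hW hs
    rw [zero_add] at this
    exact isFibreLinear_psiHom B F V this

theorem PsiRelated.res {U W : Opens M} (h : W ≤ U) {D : (superFunctions B F V).Vect U}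
    {D' : (totalFunctions B F V).Vect (above F V U)} (hD : PsiRelated B F V D D') :
    PsiRelated B F V (resVect h D) (resVect (above_mono F V h) D') :=
  fun W' h' s hs => hD W' (h'.trans h) s hs

theorem IsEvenLinear.res {U W : Opens M} (h : W ≤ U) {D : (superFunctions B F V).Vect U}
    (hD : IsEvenLinear B F V D) : IsEvenLinear B F V (resVect h D) :=
  ⟨resVect_mem_der h hD.1, fun W' h' s hs => hD.2 W' (h'.trans h) s hs⟩

theorem PsiRelated.of_cover {U : Opens M} {D : (superFunctions B F V).Vect U}
    {D' : (totalFunctions B F V).Vect (above F V U)}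
    (H : ∀ x ∈ U, ∃ (W : Opens M) (h : W ≤ U), x ∈ W ∧
      PsiRelated B F V (resVect h D) (resVect (above_mono F V h) D')) :
    PsiRelated B F V D D' := fun W hW s hs => Sec.ext' fun e => by
  obtain ⟨T, h, hx, hT⟩ := H e.1.proj (hW e.2)
  have := hT (W ⊓ T) inf_le_right _ (hs.res B F V (inf_le_left : W ⊓ T ≤ W))
  rw [resVect_app, resVect_app, ← res_app D hW inf_le_left] at this
  exact (app_val_of_mem D' (above_mono F V hW) (above_mono F V (inf_le_left : W ⊓ T ≤ W))
    (psi B F V s) e.1 ⟨e.2, hx⟩).trans (congrArg (fun t => t.1 ⟨e.1, e.2, hx⟩) this)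

theorem IsEvenLinear.of_cover {U : Opens M} {D : (superFunctions B F V).Vect U}
    (hD : D.1 ∈ (superFunctions B F V).der U 0)
    (H : ∀ x ∈ U, ∃ (W : Opens M) (h : W ≤ U), x ∈ W ∧ IsEvenLinear B F V (resVect h D)) :
    IsEvenLinear B F V D := ⟨hD, fun W hW s hs x => by
  obtain ⟨T, h, hx, hT⟩ := H x.1 (hW x.2)
  obtain ⟨c, φ, e⟩ := hT.2 (W ⊓ T) inf_le_right _ (hs.res B F V (inf_le_left : W ⊓ T ≤ W))
    ⟨x.1, x.2, hx⟩
  exact ⟨c, φ, (app_val_of_mem D hW (inf_le_left : W ⊓ T ≤ W) s x.1 ⟨x.2, hx⟩).trans e⟩⟩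

end Transport

/-! ### Existence and uniqueness of the transport `Ψ` and of the projection `p`. -/

section LocalTransport

open SuperSheaf

variable (B : Type*) [NormedAddCommGroup B] [NormedSpace ℝ B]
  (F : Type*) [NormedAddCommGroup F] [NormedSpace ℝ F] [FiniteDimensional ℝ F]
  {M : Type*} [TopologicalSpace M] [ChartedSpace B M]
  (V : M → Type*) [TopologicalSpace (TotalSpace F V)]
  [∀ x, AddCommGroup (V x)] [∀ x, Module ℝ (V x)] [∀ x, TopologicalSpace (V x)]
  [FiberBundle F V] [VectorBundle ℝ F V]
  [FiniteDimensional ℝ B] [IsManifold 𝓘(ℝ, B) ∞ M] [ContMDiffVectorBundle ∞ F V 𝓘(ℝ, B)]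

/-- The coefficients of the coordinates `η_j` in a superfunction. -/
def linCoef {x₀ : M} {U : Opens M} (hU : U ≤ trivDom B F V x₀) (j : Fin (Module.finrank ℝ F))
    (s : (superFunctions B F V).Sec U) : (smoothFunctions 𝓘(ℝ, B) M).Sec U :=
  coef B F V hU (LinearMap.applyₗ (Module.finBasis ℝ F j) ∘ₗ ExteriorAlgebra.ιInv) s

theorem IsDegLeOne.eq_sum {x₀ : M} {U : Opens M} (hU : U ≤ trivDom B F V x₀)
    {s : (superFunctions B F V).Sec U} (hs : IsDegLeOne B F V s) :
    s = baseSec B F V U (basePart B F V s) +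
      ∑ j, baseSec B F V U (linCoef B F V hU j s) * oddCoord B F V x₀ hU j := by
  refine coef_ext B F V hU fun ℓ => evalAt_ext fun x => ?_
  obtain ⟨c, φ, h⟩ := hs x
  set φ' : Module.Dual ℝ F :=
    ((trivializationAt F V x₀).symmL ℝ x.1).toLinearMap.dualMap φ with hφ'
  have ht : extTriv F V x₀ x.1 (superEval x s) = algebraMap ℝ _ c + ExteriorAlgebra.ι ℝ φ' := by
    refine (congrArg (extTriv F V x₀ x.1) h).trans ?_
    rw [map_add, AlgHom.commutes, extTriv, ExteriorAlgebra.map_apply_ι]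
  have hc : evalAt x (basePart B F V s) = c := by
    refine (congrArg (ExteriorAlgebra.algebraMapInv (R := ℝ) (M := Module.Dual ℝ (V x.1)))
      h).trans ?_
    rw [map_add, algebraMapInv_algebraMap, algebraMapInv_ι, add_zero]
  have hl : ∀ j, evalAt x (linCoef B F V hU j s) = φ' (Module.finBasis ℝ F j) := fun j => by
    rw [linCoef, evalAt_coef, ht, LinearMap.comp_apply, map_add, ιInv_algebraMap, ιInv_ι, zero_add]
    rfl
  have he : φ' = ∑ j, φ' (Module.finBasis ℝ F j) • (Module.finBasis ℝ F).coord j := by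
    refine (Module.finBasis ℝ F).ext fun k => ?_
    simp
  rw [map_add, map_add, map_sum, map_sum]
  simp only [oddCoord, coef_baseSec_mul, coef_constSec, map_mul (evalAt x), AlgHom.commutes, hl]
  rw [evalAt_coef, ht, evalAt_coef, superEval_baseSec, AlgHom.commutes, hc, map_add]
  congr 1
  conv_lhs => rw [he, map_sum, map_sum]
  refine Finset.sum_congr rfl fun j _ => ?_
  rw [map_smul, map_smul]
  rfl

theorem superFrame_coord_inl (x₀ : M) (i : Fin (Module.finrank ℝ B)) :
    (superFrame B F V x₀).coord (Sum.inl i) = baseSec B F V _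
      ((smoothFunctions 𝓘(ℝ, B) M).res (trivDom_le_chartDom B F V x₀)
        (chartCoord 𝓘(ℝ, B) (Module.finBasis ℝ B) x₀ i)) := rfl

/-- The two coordinate systems match: `ψ` fixes the `x_i` and turns the odd coordinate `η_j` into
the `j`-th fibre coordinate. -/
theorem psiHom_superFrame_coord (x₀ : M) (a : CoordIdx B F) :
    psiHom B F V _ ((superFrame B F V x₀).coord a) = (totalFrame B F V x₀).coord a := by
  rcases a with i | j
  · rw [superFrame_coord_inl, psiHom_baseSec, totalFrame_coord_inl]
    rfl
  · refine evalAt_ext fun e => ?_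
    rw [evalAt_totalFrame_coord_inr]
    have hx : e.1.proj ∈ (trivializationAt F V x₀).baseSet :=
      mem_baseSet_of_le B F V le_rfl (projAbove F V e)
    have h := evalAt_psiHom_of_eq B F V (s := oddCoord B F V x₀ le_rfl j) (x := projAbove F V e)
      (c := 0) (φ := ((trivializationAt F V x₀).continuousLinearMapAt ℝ
        e.1.proj).toLinearMap.dualMap ((Module.finBasis ℝ F).coord j)) (by
          rw [map_zero, zero_add]
          exact ExteriorAlgebra.map_apply_ι _ _) e.1.snd
    refine h.trans ((zero_add _).trans ?_)
    change (Module.finBasis ℝ F).repr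
      ((trivializationAt F V x₀).continuousLinearMapAt ℝ e.1.proj e.1.snd) j = _
    rw [Trivialization.continuousLinearMapAt_apply_of_mem ℝ _ hx]

theorem isDegLeOne_superFrame_coord (x₀ : M) (a : CoordIdx B F) :
    IsDegLeOne B F V ((superFrame B F V x₀).coord a) := by
  rcases a with i | j
  · exact isDegLeOne_baseSec B F V _
  · intro x
    refine ⟨0, ((trivializationAt F V x₀).continuousLinearMapAt ℝ
        x.1).toLinearMap.dualMap ((Module.finBasis ℝ F).coord j), ?_⟩
    rw [map_zero, zero_add]
    exact ExteriorAlgebra.map_apply_ι _ _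

/-- The fibrewise affine coordinates, restricted to an open set. -/
abbrev totalFrameOn {x₀ : M} {U : Opens M} (hU : U ≤ trivDom B F V x₀) :
    (totalFunctions B F V).Frame (above F V U) (CoordIdx B F) :=
  (totalFrame B F V x₀).restrict (above_mono F V hU)

/-- The super coordinates, restricted to an open set. -/
abbrev superFrameOn {x₀ : M} {U : Opens M} (hU : U ≤ trivDom B F V x₀) :
    (superFunctions B F V).Frame U (CoordIdx B F) :=
  (superFrame B F V x₀).restrict hU

section

variable {x₀ : M} {U : Opens M} (hU : U ≤ trivDom B F V x₀)

theorem psiHom_superFrameOn_coord (a : CoordIdx B F) :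
    psiHom B F V U ((superFrameOn B F V hU).coord a) = (totalFrameOn B F V hU).coord a :=
  congrArg ((totalFunctions B F V).res (above_mono F V hU)) (psiHom_superFrame_coord B F V x₀ a)

theorem isDegLeOne_superFrameOn_coord (a : CoordIdx B F) :
    IsDegLeOne B F V ((superFrameOn B F V hU).coord a) :=
  (isDegLeOne_superFrame_coord B F V x₀ a).res B F V hU

theorem app_baseSec (D : (superFunctions B F V).Vect U) (f : (smoothFunctions 𝓘(ℝ, B) M).Sec U) :
    app D le_rfl (baseSec B F V U f) =
      ∑ i, app D le_rfl ((superFrameOn B F V hU).coord (Sum.inl i)) *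
        baseSec B F V U (app (chartVect x₀ (Module.finBasis ℝ B i))
          (hU.trans (trivDom_le_chartDom B F V x₀)) f) :=
  (superPullback B F V).app_hom (Module.finBasis ℝ B) (hU.trans (trivDom_le_chartDom B F V x₀)) D f

theorem app_totalHom (D : (totalFunctions B F V).Vect (above F V U))
    (f : (smoothFunctions 𝓘(ℝ, B) M).Sec U) :
    app D le_rfl (totalHom B F V U f) =
      ∑ i, app D le_rfl ((totalFrameOn B F V hU).coord (Sum.inl i)) *
        totalHom B F V U (app (chartVect x₀ (Module.finBasis ℝ B i))
          (hU.trans (trivDom_le_chartDom B F V x₀)) f) := by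
  simp only [← psiHom_superFrameOn_coord]
  refine ((totalPullback B F V).app_hom (Module.finBasis ℝ B)
    (hU.trans (trivDom_le_chartDom B F V x₀)) D f).trans (Finset.sum_congr rfl fun i _ => ?_)
  congr 2
  exact (psiHom_baseSec B F V _).symm

theorem app_baseSec_mem_even {D : (superFunctions B F V).Vect U}
    (hD : ∀ i, app D le_rfl ((superFrameOn B F V hU).coord (Sum.inl i)) ∈
      (superFunctions B F V).par U 0) (f : (smoothFunctions 𝓘(ℝ, B) M).Sec U) :
    app D le_rfl (baseSec B F V U f) ∈ (superFunctions B F V).par U 0 := by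
  rw [app_baseSec B F V hU]
  refine Submodule.sum_mem _ fun i _ => ?_
  intro x
  exact (superFunctions B F V).parity_mul_mem x.1 0 0 _ _ (hD i x) (baseSec_mem B F V _ x)

/-- On base functions both fields obey the chain rule with the same partial derivatives, and `ψ`
respects the products because the `D(x_i)` are even. A section of `ℱ` has the form `s₀ + ∑ s_j η_j`,
and in the Leibniz rule for it each product again has an even factor. -/
theorem app_psiHom_of_coord {D : (superFunctions B F V).Vect U}
    {D' : (totalFunctions B F V).Vect (above F V U)}
    (hD : ∀ i, app D le_rfl ((superFrameOn B F V hU).coord (Sum.inl i)) ∈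
      (superFunctions B F V).par U 0)
    (H : ∀ a, app D' le_rfl ((totalFrameOn B F V hU).coord a) =
      psiHom B F V U (app D le_rfl ((superFrameOn B F V hU).coord a)))
    {s : (superFunctions B F V).Sec U} (hs : IsDegLeOne B F V s) :
    app D' le_rfl (psiHom B F V U s) = psiHom B F V U (app D le_rfl s) := by
  have hbase : ∀ f, app D' le_rfl (totalHom B F V U f) =
      psiHom B F V U (app D le_rfl (baseSec B F V U f)) := fun f => by
    rw [app_totalHom B F V hU, app_baseSec B F V hU, map_sum]
    refine Finset.sum_congr rfl fun i _ => ?_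
    rw [psiHom_mul_of_even B F V (hD i), psiHom_baseSec, H]
  rw [hs.eq_sum B F V hU]
  simp only [map_add, map_sum, psiHom_mul_of_even B F V (baseSec_mem B F V _), psiHom_baseSec,
    app_mul_of_even_left _ _ (baseSec_mem B F V _),
    app_mul_of_even_left _ _ (smooth_mem_par _), hbase,
    psiHom_mul_of_even B F V (app_baseSec_mem_even B F V hU hD _)]
  congr 1
  refine Finset.sum_congr rfl fun j _ => ?_
  congr 2
  exact (congrArg (app D' le_rfl) (psiHom_superFrameOn_coord B F V hU (Sum.inr j))).trans
    (H (Sum.inr j))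

theorem psiRelated_of_coord {D : (superFunctions B F V).Vect U}
    {D' : (totalFunctions B F V).Vect (above F V U)}
    (hD : ∀ i, app D le_rfl ((superFrameOn B F V hU).coord (Sum.inl i)) ∈
      (superFunctions B F V).par U 0)
    (H : ∀ a, app D' le_rfl ((totalFrameOn B F V hU).coord a) =
      psiHom B F V U (app D le_rfl ((superFrameOn B F V hU).coord a))) :
    PsiRelated B F V D D' := by
  intro W h s hs
  refine app_psiHom_of_coord B F V (h.trans hU) (D := resVect h D)
    (D' := resVect (above_mono F V h) D') (fun i => ?_) (fun a => ?_) hs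
  · have := res_mem_par h (hD i)
    rwa [res_app] at this
  · have := congrArg ((totalFunctions B F V).res (above_mono F V h)) (H a)
    rw [res_app, psiHom_res B F V h, res_app] at this
    exact this

/-- Each `D(x_i)` is even of degree at most one, hence a base function; so `D` maps base functions
to base functions. The Leibniz rule on `s₀ + ∑ s_j η_j` then stays in degree at most one. -/
theorem isDegLeOne_app_of_coord {D : (superFunctions B F V).Vect U}
    (hD : D.1 ∈ (superFunctions B F V).der U 0)
    (H : ∀ a, IsDegLeOne B F V (app D le_rfl ((superFrameOn B F V hU).coord a)))
    {s : (superFunctions B F V).Sec U} (hs : IsDegLeOne B F V s) :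
    IsDegLeOne B F V (app D le_rfl s) := by
  have hi : ∀ i, app D le_rfl ((superFrameOn B F V hU).coord (Sum.inl i)) ∈
      (superFunctions B F V).par U 0 := fun i => by
    have := app_mem_par hD le_rfl ((superFrameOn B F V hU).coord_mem (Sum.inl i))
    exact this
  have hbase : ∀ f, ∃ g, app D le_rfl (baseSec B F V U f) = baseSec B F V U g := fun f => by
    rw [app_baseSec B F V hU]
    refine ⟨∑ i, basePart B F V (app D le_rfl ((superFrameOn B F V hU).coord (Sum.inl i))) *
      app (chartVect x₀ (Module.finBasis ℝ B i))
          (hU.trans (trivDom_le_chartDom B F V x₀)) f, ?_⟩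
    rw [map_sum]
    refine Finset.sum_congr rfl fun i _ => ?_
    rw [map_mul, ← (H _).eq_baseSec B F V (hi i)]
  rw [hs.eq_sum B F V hU, map_add, map_sum]
  obtain ⟨g, hg⟩ := hbase (basePart B F V s)
  rw [hg]
  refine Submodule.add_mem (degLeOne B F V U) (isDegLeOne_baseSec B F V g)
    (Submodule.sum_mem _ fun j _ => ?_)
  obtain ⟨g, hg⟩ := hbase (linCoef B F V hU j s)
  rw [app_mul_of_even_left _ _ (baseSec_mem B F V _), hg]
  exact Submodule.add_mem _
    ((isDegLeOne_superFrameOn_coord B F V hU (Sum.inr j)).baseSec_mul B F V g)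
    ((H (Sum.inr j)).baseSec_mul B F V _)

theorem isEvenLinear_of_coord {D : (superFunctions B F V).Vect U}
    (hD : D.1 ∈ (superFunctions B F V).der U 0)
    (H : ∀ a, IsDegLeOne B F V (app D le_rfl ((superFrameOn B F V hU).coord a))) :
    IsEvenLinear B F V D := by
  refine ⟨hD, fun W h s hs => ?_⟩
  refine isDegLeOne_app_of_coord B F V (h.trans hU) (D := resVect h D) (resVect_mem_der h hD)
    (fun a => ?_) hs
  have := (H a).res B F V h
  rwa [res_app] at this

end

theorem PsiRelated.eq_right {U : Opens M} {D : (superFunctions B F V).Vect U}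
    {D' D'' : (totalFunctions B F V).Vect (above F V U)} (h' : PsiRelated B F V D D')
    (h'' : PsiRelated B F V D D'') : D' = D'' := by
  refine Vect.eq_of_cover fun e he => ?_
  have hle : U ⊓ trivDom B F V e.proj ≤ U := inf_le_left
  refine ⟨above F V (U ⊓ trivDom B F V e.proj), above_mono F V hle,
    ⟨he, mem_trivDom_self B F V e.proj⟩, ?_⟩
  refine (totalFrameOn B F V (inf_le_right : U ⊓ trivDom B F V e.proj ≤ _)).vect_ext
    (smooth_mem_der _) (smooth_mem_der _) fun a => ?_
  have hc := isDegLeOne_superFrameOn_coord B F V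
    (inf_le_right : U ⊓ trivDom B F V e.proj ≤ _) a
  rw [← psiHom_superFrameOn_coord]
  exact (h' _ hle _ hc).trans (h'' _ hle _ hc).symm

/-- Both fields must preserve degree at most one, since `ψ` recovers their values on the coordinates
only in that range. -/
theorem PsiRelated.eq_left {U : Opens M} {D₁ D₂ : (superFunctions B F V).Vect U}
    {D' : (totalFunctions B F V).Vect (above F V U)} (hD₁ : IsEvenLinear B F V D₁)
    (hD₂ : IsEvenLinear B F V D₂) (h₁ : PsiRelated B F V D₁ D')
    (h₂ : PsiRelated B F V D₂ D') : D₁ = D₂ := by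
  refine Vect.eq_of_cover fun x hx => ?_
  have hle : U ⊓ trivDom B F V x ≤ U := inf_le_left
  refine ⟨U ⊓ trivDom B F V x, hle, ⟨hx, mem_trivDom_self B F V x⟩, ?_⟩
  refine (superFrameOn B F V (inf_le_right : U ⊓ trivDom B F V x ≤ _)).vect_ext
    (resVect_mem_der hle hD₁.1) (resVect_mem_der hle hD₂.1) fun a => ?_
  have hc := isDegLeOne_superFrameOn_coord B F V (inf_le_right : U ⊓ trivDom B F V x ≤ _) a
  exact (hD₁.2 _ hle _ hc).eq_of_psiHom_eq B F V (hD₂.2 _ hle _ hc)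
    ((h₁ _ hle _ hc).symm.trans (h₂ _ hle _ hc))

/-- Every even superderivation is transported to a vector field on the total space. -/
theorem exists_psiRelated {U : Opens M} {D : (superFunctions B F V).Vect U}
    (hD : D.1 ∈ (superFunctions B F V).der U 0) : ∃ D', PsiRelated B F V D D' := by
  have hloc : ∀ x : U, ∃ D' : (totalFunctions B F V).Vect (above F V (U ⊓ trivDom B F V x.1)),
      PsiRelated B F V (resVect inf_le_left D) D' := fun x => by
    have hle : U ⊓ trivDom B F V x.1 ≤ U := inf_le_left
    have hT : U ⊓ trivDom B F V x.1 ≤ trivDom B F V x.1 := inf_le_right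
    -- On `E` the values on coordinates are unrestricted, so the transport is defined by applying
    -- `ψ` to the values of `D`.
    refine ⟨(totalFrameOn B F V hT).mk' fun a => psiHom B F V _
      (app (resVect hle D) le_rfl ((superFrameOn B F V hT).coord a)),
      psiRelated_of_coord B F V hT (fun i => ?_) fun a => by rw [Frame.mk'_coord]⟩
    have := app_mem_par (resVect_mem_der hle hD) le_rfl
      ((superFrameOn B F V hT).coord_mem (Sum.inl i))
    exact this
  choose D' hD' using hloc
  -- Compatibility on overlaps is the uniqueness of the transport; no change of coordinates is
  -- computed.
  obtain ⟨Z, -, hZ⟩ := exists_glue (O := totalFunctions B F V) (U := above F V U) 0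
    (fun x : U => above F V (U ⊓ trivDom B F V x.1)) (fun x => above_mono F V inf_le_left)
    (fun e he => ⟨⟨e.proj, he⟩, he, mem_trivDom_self B F V e.proj⟩) D'
    (fun x => smooth_mem_der _) fun x y =>
      PsiRelated.eq_right B F V (U := (U ⊓ trivDom B F V x.1) ⊓ (U ⊓ trivDom B F V y.1))
        ((hD' x).res B F V inf_le_left) ((hD' y).res B F V inf_le_right)
  exact ⟨Z, PsiRelated.of_cover B F V fun x hx => ⟨U ⊓ trivDom B F V x, inf_le_left,
    ⟨hx, mem_trivDom_self B F V x⟩, by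
      have := hD' ⟨x, hx⟩
      rwa [← hZ ⟨x, hx⟩] at this⟩⟩

/-- Every vector field on the total space that preserves the fibrewise affine functions and their
parity comes from the base supermanifold. -/
theorem exists_isEvenLinear_psiRelated {U : Opens M}
    {D' : (totalFunctions B F V).Vect (above F V U)} (hD' : IsEvenLinearAbove B F V D') :
    ∃ D, IsEvenLinear B F V D ∧ PsiRelated B F V D D' := by
  have hloc : ∀ x : U, ∃ D : (superFunctions B F V).Vect (U ⊓ trivDom B F V x.1),
      IsEvenLinear B F V D ∧
        PsiRelated B F V D (resVect (above_mono F V inf_le_left) D') := fun x => by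
    have hle : U ⊓ trivDom B F V x.1 ≤ U := inf_le_left
    have hT : U ⊓ trivDom B F V x.1 ≤ trivDom B F V x.1 := inf_le_right
    -- `D'` keeps basic functions basic and fibrewise linear ones linear, so its values on
    -- coordinates come, through `ψ`, from superfunctions of degree at most one with the parity
    -- required for an even field.
    have hex : ∀ a, ∃ s, s ∈ (superFunctions B F V).par _ ((superFrameOn B F V hT).parity a) ∧
        IsDegLeOne B F V s ∧
        app D' (above_mono F V hle) ((totalFrameOn B F V hT).coord a) = psiHom B F V _ s := by
      intro a
      rcases a with i | j
      · obtain ⟨w, hw⟩ := ((hD' _ hle _).1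
          (isBasic_psiHom B F V ((superFrameOn B F V hT).coord_mem (Sum.inl i)))).exists_eq B F V
        rw [psiHom_superFrameOn_coord] at hw
        exact ⟨_, baseSec_mem B F V w, isDegLeOne_baseSec B F V w, hw⟩
      · have := ((hD' _ hle _).2
          (isFibreLinear_psiHom B F V
            ((superFrameOn B F V hT).coord_mem (Sum.inr j)))).exists_eq B F V
        rwa [psiHom_superFrameOn_coord] at this
    choose t ht ht1 hD't using hex
    have hmem : ((superFrameOn B F V hT).mk' t).1 ∈ (superFunctions B F V).der _ 0 :=
      (superFrameOn B F V hT).mk'_mem fun a => by rw [zero_add]; exact ht a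
    refine ⟨(superFrameOn B F V hT).mk' t, isEvenLinear_of_coord B F V hT hmem fun a => ?_,
      psiRelated_of_coord B F V hT (fun i => ?_) fun a => ?_⟩
    · rw [Frame.mk'_coord]
      exact ht1 a
    · rw [Frame.mk'_coord]
      exact ht (Sum.inl i)
    · rw [Frame.mk'_coord]
      exact hD't a
  choose D hD hrel using hloc
  obtain ⟨Z, hZ0, hZ⟩ := exists_glue (O := superFunctions B F V) (U := U) 0
    (fun x : U => U ⊓ trivDom B F V x.1) (fun x => inf_le_left)
    (fun x hx => ⟨⟨x, hx⟩, hx, mem_trivDom_self B F V x⟩) D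
    (fun x => (hD x).1) fun x y =>
      PsiRelated.eq_left B F V ((hD x).res B F V inf_le_left) ((hD y).res B F V inf_le_right)
        ((hrel x).res B F V inf_le_left) ((hrel y).res B F V inf_le_right)
  refine ⟨Z, IsEvenLinear.of_cover B F V hZ0 fun x hx => ⟨U ⊓ trivDom B F V x, inf_le_left,
    ⟨hx, mem_trivDom_self B F V x⟩, ?_⟩, PsiRelated.of_cover B F V fun x hx =>
      ⟨U ⊓ trivDom B F V x, inf_le_left, ⟨hx, mem_trivDom_self B F V x⟩, ?_⟩⟩
  · rw [hZ ⟨x, hx⟩]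
    exact hD ⟨x, hx⟩
  · rw [hZ ⟨x, hx⟩]
    exact hrel ⟨x, hx⟩

theorem existsUnique_psiRelated {U : Opens M} {X : (superFunctions B F V).Vect U}
    (hX : IsEvenLinear B F V X) : ∃! X' : (totalFunctions B F V).Vect (above F V U),
      IsEvenLinearAbove B F V X' ∧ PsiRelated B F V X X' := by
  obtain ⟨X', h⟩ := exists_psiRelated B F V hX.1
  exact ⟨X', ⟨h.isEvenLinearAbove B F V hX.1, h⟩, fun Y' hY => hY.2.eq_right B F V h⟩

theorem existsUnique_isEvenLinear {U : Opens M}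
    {X' : (totalFunctions B F V).Vect (above F V U)} (hX : IsEvenLinearAbove B F V X') :
    ∃! X : (superFunctions B F V).Vect U, IsEvenLinear B F V X ∧ PsiRelated B F V X X' := by
  obtain ⟨X, h, h'⟩ := exists_isEvenLinear_psiRelated B F V hX
  exact ⟨X, ⟨h, h'⟩, fun Y hY => PsiRelated.eq_left B F V hY.1 h hY.2 h'⟩

/-- Transport `D` to `E`, losing everything of degree two and higher, and return by the inverse of
`Ψ` to a field of `𝓛`. -/
theorem existsUnique_isProjOf {U : Opens M} {D : (superFunctions B F V).Vect U}
    (hD : D.1 ∈ (superFunctions B F V).der U 0) :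
    ∃! Z : (superFunctions B F V).Vect U, IsProjOf B F V Z D := by
  obtain ⟨D', h⟩ := exists_psiRelated B F V hD
  obtain ⟨Z, hZ, hZ'⟩ := exists_isEvenLinear_psiRelated B F V (h.isEvenLinearAbove B F V hD)
  exact ⟨Z, (isProjOf_iff B F V h hZ).2 hZ', fun Y hY =>
    PsiRelated.eq_left B F V hY.1 hZ ((hY.psiRelated_iff B F V).2 h) hZ'⟩

end LocalTransport

/-! ### Connections in a coordinate frame: Christoffel symbols and cancellation of coordinates. -/

namespace SuperSheaf

section LocalConnection

variable {E H : Type*} [NormedAddCommGroup E] [NormedSpace ℝ E] [TopologicalSpace H]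
  {I : ModelWithCorners ℝ E H} {N : Type u} [TopologicalSpace N] [ChartedSpace H N]

/-- Connections on the tangent sheaf of an open set, as families of operations on all of its open
subsets. -/
structure IsLocalConnection (W : Opens N)
    (nabla : ∀ O : Opens N, O ≤ W → (smoothFunctions I N).Vect O → (smoothFunctions I N).Vect O →
      (smoothFunctions I N).Vect O) : Prop where
  add_left : ∀ O h D₁ D₂ D', nabla O h (D₁ + D₂) D' = nabla O h D₁ D' + nabla O h D₂ D'
  add_right : ∀ O h D D₁ D₂, nabla O h D (D₁ + D₂) = nabla O h D D₁ + nabla O h D D₂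
  res_nabla : ∀ O O' h (h' : O' ≤ O) D D',
    resVect h' (nabla O h D D') = nabla O' (h'.trans h) (resVect h' D) (resVect h' D')
  mul_left : ∀ O h f D D', nabla O h (mulVect f D) D' = mulVect f (nabla O h D D')
  leibniz : ∀ O h f D D', nabla O h D (mulVect f D') =
    mulVect (app D le_rfl f) D' + mulVect f (nabla O h D D')

variable {W : Opens N}
  {nabla nabla' : ∀ O : Opens N, O ≤ W → (smoothFunctions I N).Vect O →
    (smoothFunctions I N).Vect O → (smoothFunctions I N).Vect O}

theorem IsLocalConnection.sum_left (hn : IsLocalConnection W nabla) {O : Opens N} (h : O ≤ W)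
    {κ : Type*} (s : Finset κ) (D : κ → (smoothFunctions I N).Vect O)
    (D' : (smoothFunctions I N).Vect O) :
    nabla O h (∑ k ∈ s, D k) D' = ∑ k ∈ s, nabla O h (D k) D' :=
  map_sum (AddMonoidHom.mk' (fun Z => nabla O h Z D') fun _ _ => hn.add_left _ _ _ _ _) D s

theorem IsLocalConnection.sum_right (hn : IsLocalConnection W nabla) {O : Opens N} (h : O ≤ W)
    {κ : Type*} (s : Finset κ) (D : (smoothFunctions I N).Vect O)
    (D' : κ → (smoothFunctions I N).Vect O) :
    nabla O h D (∑ k ∈ s, D' k) = ∑ k ∈ s, nabla O h D (D' k) :=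
  map_sum (AddMonoidHom.mk' (fun Z => nabla O h D Z) fun _ _ => hn.add_right _ _ _ _ _) D' s

theorem IsLocalConnection.restrict {W' : Opens N} (h : W' ≤ W)
    (hn : IsLocalConnection W nabla) :
    IsLocalConnection W' fun O hO D D' => nabla O (hO.trans h) D D' where
  add_left _ _ := hn.add_left _ _
  add_right _ _ := hn.add_right _ _
  res_nabla _ _ _ h' := hn.res_nabla _ _ _ h'
  mul_left _ _ := hn.mul_left _ _
  leibniz _ _ := hn.leibniz _ _

variable {ι : Type*} (R : (smoothFunctions I N).Frame W ι)

/-- A coordinate `y` is not a zero divisor. Differentiating `y g = 0` along its dual field gives `g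
+ y g' = 0`; multiplying by `g` and using `y g = 0` again gives `g² = 0`. -/
theorem Frame.eq_zero_of_coord_mul {O : Opens N} (h : O ≤ W) (a : ι)
    {g : (smoothFunctions I N).Sec O} (hg : (R.restrict h).coord a * g = 0) : g = 0 := by
  have h1 := congrArg (app ((R.restrict h).vect a) le_rfl) hg
  rw [app_mul_of_even (smooth_mem_der _), Frame.vect_coord, one_mul, map_zero] at h1
  have h2 : g * g = 0 := by
    have : g * g = g * (g + (R.restrict h).coord a * app ((R.restrict h).vect a) le_rfl g) -
        ((R.restrict h).coord a * g) * app ((R.restrict h).vect a) le_rfl g := by ring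
    rw [this, h1, hg]
    ring
  refine evalAt_ext fun x => ?_
  have h3 := congrArg (evalAt x) h2
  rw [map_mul, map_zero] at h3
  rw [map_zero]
  exact mul_self_eq_zero.1 h3

theorem Frame.eq_zero_of_mulVect_coord {O : Opens N} (h : O ≤ W) (a : ι)
    {Z : (smoothFunctions I N).Vect O} (hZ : mulVect ((R.restrict h).coord a) Z = 0) : Z = 0 :=
  Vect.ext' fun O' h' f => R.eq_zero_of_coord_mul (h'.trans h) a (by
    have := congrArg (fun D => app D h' f) hZ
    exact this)

variable [Fintype ι]

theorem IsLocalConnection.eq_sum (hn : IsLocalConnection W nabla) {O : Opens N} (h : O ≤ W)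
    (D D' : (smoothFunctions I N).Vect O) :
    nabla O h D D' = ∑ b, (mulVect (app D le_rfl (app D' le_rfl ((R.restrict h).coord b)))
      ((R.restrict h).vect b) + mulVect (app D' le_rfl ((R.restrict h).coord b))
        (∑ a, mulVect (app D le_rfl ((R.restrict h).coord a))
          (resVect h (nabla W le_rfl (R.vect a) (R.vect b))))) := by
  have hb : ∀ b, nabla O h D ((R.restrict h).vect b) =
      ∑ a, mulVect (app D le_rfl ((R.restrict h).coord a))
          (resVect h (nabla W le_rfl (R.vect a) (R.vect b))) := fun b => by
    conv_lhs => rw [(R.restrict h).eq_mk' (smooth_mem_der D), Frame.mk', hn.sum_left]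
    simp only [hn.mul_left, hn.res_nabla]
    rfl
  conv_lhs => rw [(R.restrict h).eq_mk' (smooth_mem_der D'), Frame.mk', hn.sum_right]
  simp only [hn.leibniz, hb]

/-- Linearity and the Leibniz rule express a connection through its values on the frame;
compatibility with restriction carries these values to smaller open sets. -/
theorem IsLocalConnection.ext (hn : IsLocalConnection W nabla) (hn' : IsLocalConnection W nabla')
    (H : ∀ a b, nabla W le_rfl (R.vect a) (R.vect b) = nabla' W le_rfl (R.vect a) (R.vect b))
    {O : Opens N} (h : O ≤ W) (D D' : (smoothFunctions I N).Vect O) :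
    nabla O h D D' = nabla' O h D D' := by
  rw [hn.eq_sum R h, hn'.eq_sum R h]
  simp only [H]

/-- The connection with given Christoffel symbols. -/
def christoffelNabla (G : ι → ι → ι → (smoothFunctions I N).Sec W) (O : Opens N) (h : O ≤ W)
    (D D' : (smoothFunctions I N).Vect O) : (smoothFunctions I N).Vect O :=
  (R.restrict h).mk' fun c => app D le_rfl (app D' le_rfl ((R.restrict h).coord c)) +
    ∑ b, ∑ a, app D' le_rfl ((R.restrict h).coord b) *
      (app D le_rfl ((R.restrict h).coord a) * (smoothFunctions I N).res h (G a b c))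

theorem christoffelNabla_coord (G : ι → ι → ι → (smoothFunctions I N).Sec W) {O : Opens N}
    (h : O ≤ W) (D D' : (smoothFunctions I N).Vect O) (c : ι) :
    app (christoffelNabla R G O h D D') le_rfl ((R.restrict h).coord c) =
      app D le_rfl (app D' le_rfl ((R.restrict h).coord c)) +
    ∑ b, ∑ a, app D' le_rfl ((R.restrict h).coord b) *
      (app D le_rfl ((R.restrict h).coord a) * (smoothFunctions I N).res h (G a b c)) :=
  Frame.mk'_coord _ _ _

theorem isLocalConnection_christoffelNabla (G : ι → ι → ι → (smoothFunctions I N).Sec W) :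
    IsLocalConnection W (christoffelNabla R G) where
  add_left O h D₁ D₂ D' := by
    refine (R.restrict h).vect_ext (smooth_mem_der _) (smooth_mem_der _) fun c => ?_
    simp only [add_app, christoffelNabla_coord, add_mul, mul_add, Finset.sum_add_distrib]
    abel
  add_right O h D D₁ D₂ := by
    refine (R.restrict h).vect_ext (smooth_mem_der _) (smooth_mem_der _) fun c => ?_
    simp only [add_app, christoffelNabla_coord, add_mul, map_add, Finset.sum_add_distrib]
    abel
  res_nabla O O' h h' D D' := by
    refine (R.restrict (h'.trans h)).vect_ext (smooth_mem_der _) (smooth_mem_der _) fun c => ?_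
    rw [christoffelNabla_coord]
    have := congrArg ((smoothFunctions I N).res h') (christoffelNabla_coord R G h D D' c)
    simp only [map_add, map_sum, map_mul, res_app] at this
    exact this
  mul_left O h f D D' := by
    refine (R.restrict h).vect_ext (smooth_mem_der _) (smooth_mem_der _) fun c => ?_
    simp only [mulVect_app, christoffelNabla_coord, res_self, mul_add, Finset.mul_sum]
    congr 1
    refine Finset.sum_congr rfl fun b _ => Finset.sum_congr rfl fun a _ => ?_
    ring
  leibniz O h f D D' := by
    refine (R.restrict h).vect_ext (smooth_mem_der _) (smooth_mem_der _) fun c => ?_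
    simp only [mulVect_app, add_app, christoffelNabla_coord, res_self, mul_add, Finset.mul_sum,
      app_mul_of_even (smooth_mem_der _)]
    rw [add_assoc]
    congr 2
    refine Finset.sum_congr rfl fun b _ => Finset.sum_congr rfl fun a _ => ?_
    ring

end LocalConnection

end SuperSheaf

/-! ### The induced connection over a trivializing open set. -/

section InducedConnection

open SuperSheaf

variable (B : Type*) [NormedAddCommGroup B] [NormedSpace ℝ B]
  (F : Type*) [NormedAddCommGroup F] [NormedSpace ℝ F] [FiniteDimensional ℝ F]
  {M : Type*} [TopologicalSpace M] [ChartedSpace B M]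
  (V : M → Type*) [TopologicalSpace (TotalSpace F V)]
  [∀ x, AddCommGroup (V x)] [∀ x, Module ℝ (V x)] [∀ x, TopologicalSpace (V x)]
  [FiberBundle F V] [VectorBundle ℝ F V]
  [FiniteDimensional ℝ B] [IsManifold 𝓘(ℝ, B) ∞ M] [ContMDiffVectorBundle ∞ F V 𝓘(ℝ, B)]

/-- A connection over an open subset of the total space is induced by a connection on `Π E`. -/
def IsLocallyInduced (conn : (superFunctions B F V).Connection) (T : Opens M)
    (nabla : ∀ O : Opens (TotalSpace F V), O ≤ above F V T → (totalFunctions B F V).Vect O →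
      (totalFunctions B F V).Vect O → (totalFunctions B F V).Vect O) : Prop :=
  ∀ (U : Opens M) (h : U ≤ T) (X Y : (superFunctions B F V).Vect U)
    (X' Y' : (totalFunctions B F V).Vect (above F V U)),
    IsEvenLinear B F V X → IsEvenLinear B F V Y →
    PsiRelated B F V X X' → PsiRelated B F V Y Y' →
    PsiRelated B F V (conn.1 U X Y) (nabla (above F V U) (above_mono F V h) X' Y')

/-- The Christoffel symbols of a connection on `Π E`. -/
def superChristoffel (conn : (superFunctions B F V).Connection) (x₀ : M) (a b c : CoordIdx B F) :
    (superFunctions B F V).Sec (trivDom B F V x₀) :=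
  app (conn.1 _ ((superFrame B F V x₀).vect a) ((superFrame B F V x₀).vect b)) le_rfl
    ((superFrame B F V x₀).coord c)

/-- The Christoffel symbols of the induced connection. -/
def inducedChristoffel (conn : (superFunctions B F V).Connection) (x₀ : M)
    (a b c : CoordIdx B F) : (totalFunctions B F V).Sec (above F V (trivDom B F V x₀)) :=
  -- A coefficient with odd index starts in degree one. One such factor leaves only the degree-zero
  -- part of the symbol, and two of them give degree at least two, which `ψ` discards.
  match a, b with
  | Sum.inl _, Sum.inl _ => psiHom B F V _ (superChristoffel B F V conn x₀ a b c)
  | Sum.inl _, Sum.inr _ => totalHom B F V _ (basePart B F V (superChristoffel B F V conn x₀ a b c))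
  | Sum.inr _, Sum.inl _ => totalHom B F V _ (basePart B F V (superChristoffel B F V conn x₀ a b c))
  | Sum.inr _, Sum.inr _ => 0

theorem basePart_mul {U : Opens M} (s t : (superFunctions B F V).Sec U) :
    basePart B F V (s * t) = basePart B F V s * basePart B F V t := evalAt_ext fun x => by
  rw [map_mul (evalAt x), evalAt_basePart, evalAt_basePart, evalAt_basePart,
    map_mul (superEval x), map_mul]

/-- This identity dictates the case distinction in `inducedChristoffel`: with these symbols `ψ`
passes through the product although it is not multiplicative. -/
theorem psiHom_mul_christoffel (conn : (superFunctions B F V).Connection) {x₀ : M} {U : Opens M}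
    (hU : U ≤ trivDom B F V x₀) (a b c : CoordIdx B F) {s t : (superFunctions B F V).Sec U}
    (hs : s ∈ (superFunctions B F V).par U ((superFrame B F V x₀).parity a))
    (ht : t ∈ (superFunctions B F V).par U ((superFrame B F V x₀).parity b)) :
    psiHom B F V U (t * (s * (superFunctions B F V).res hU
      (superChristoffel B F V conn x₀ a b c))) =
    psiHom B F V U t * (psiHom B F V U s * (totalFunctions B F V).res (above_mono F V hU)
      (inducedChristoffel B F V conn x₀ a b c)) := by
  rcases b with i | j
  · rw [psiHom_mul_of_even B F V ht]
    rcases a with i' | j'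
    · rw [psiHom_mul_of_even B F V hs]
      rfl
    · rw [psiHom_mul_of_odd B F V hs]
      rfl
  · rw [psiHom_mul_of_odd B F V ht, basePart_mul, map_mul]
    rcases a with i' | j'
    · rw [← psiHom_of_even B F V hs]
      rfl
    · rw [basePart_eq_zero_of_odd B F V hs, map_zero, zero_mul]
      change _ = psiHom B F V U t * (psiHom B F V U s *
        (totalFunctions B F V).res (above_mono F V hU) 0)
      rw [map_zero, mul_zero, mul_zero, mul_zero]

/-- The connection in coordinates, for even vector fields. -/
theorem connection_app_coord (conn : (superFunctions B F V).Connection) {x₀ : M} {U : Opens M}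
    (hU : U ≤ trivDom B F V x₀) {X Y : (superFunctions B F V).Vect U}
    (hX : X.1 ∈ (superFunctions B F V).der U 0) (hY : Y.1 ∈ (superFunctions B F V).der U 0)
    (c : CoordIdx B F) :
    app (conn.1 U X Y) le_rfl ((superFrameOn B F V hU).coord c) =
      app X le_rfl (app Y le_rfl ((superFrameOn B F V hU).coord c)) +
      ∑ b, ∑ a, app Y le_rfl ((superFrameOn B F V hU).coord b) *
        (app X le_rfl ((superFrameOn B F V hU).coord a) *
          (superFunctions B F V).res hU (superChristoffel B F V conn x₀ a b c)) := by
  classical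
  have hb : ∀ b, conn.1 U X ((superFrameOn B F V hU).vect b) =
      ∑ a, mulVect (app X le_rfl ((superFrameOn B F V hU).coord a))
          (resVect hU (conn.1 _ ((superFrame B F V x₀).vect a)
            ((superFrame B F V x₀).vect b))) := fun b => by
    conv_lhs => rw [(superFrameOn B F V hU).eq_mk' hX, Frame.mk', map_sum, LinearMap.sum_apply]
    refine Finset.sum_congr rfl fun a _ => ?_
    rw [conn.2.mul_left, conn.2.res_nabla]
    rfl
  have hYe := (superFrameOn B F V hU).eq_mk' hY
  have key : conn.1 U X Y = ∑ b, (mulVect (app X le_rfl (app Y le_rfl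
      ((superFrameOn B F V hU).coord b))) ((superFrameOn B F V hU).vect b) +
      mulVect (app Y le_rfl ((superFrameOn B F V hU).coord b))
        (conn.1 U X ((superFrameOn B F V hU).vect b))) := by
    conv_lhs => rw [hYe, Frame.mk', map_sum]
    refine Finset.sum_congr rfl fun b _ => ?_
    -- As `X` is even, no sign appears even though the coefficient of `Y` may be odd.
    rw [conn.2.leibniz U 0 _ _ _ _ hX (app_mem_par hY le_rfl ((superFrameOn B F V hU).coord_mem b)),
      koszul_zero_left, one_smul]
  rw [key, sum_app]
  simp only [add_app, mulVect_app, res_self, Finset.sum_add_distrib, hb, sum_app, Finset.mul_sum]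
  congr 1
  · rw [Finset.sum_eq_single c]
    · rw [Frame.vect_coord, mul_one]
    · intro b _ hbc
      rw [Frame.vect_coord_of_ne _ b c hbc, mul_zero]
    · simp
  · refine Finset.sum_congr rfl fun b _ => Finset.sum_congr rfl fun a _ => ?_
    congr 2
    exact (res_app _ le_rfl hU _).symm

/-- The induced connection in a local trivialization. -/
abbrev inducedNabla (conn : (superFunctions B F V).Connection) (x₀ : M) :=
  christoffelNabla (totalFrame B F V x₀) (inducedChristoffel B F V conn x₀)

/-- The coordinate formulas for both connections correspond term by term. For `X(Y z_c)` one needs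
`Y z_c` to have degree at most one, which is where `Y ∈ 𝓛` enters; the other terms are covered by
the choice of symbols. -/
theorem isLocallyInduced_inducedNabla (conn : (superFunctions B F V).Connection) (x₀ : M) :
    IsLocallyInduced B F V conn (trivDom B F V x₀) (inducedNabla B F V conn x₀) := by
  intro U hU X Y X' Y' hX hY hXX' hYY'
  have hmem : (conn.1 U X Y).1 ∈ (superFunctions B F V).der U 0 := conn.2.even U 0 0 X Y hX.1 hY.1
  have hX' : ∀ a, app X' le_rfl ((totalFrameOn B F V hU).coord a) =
      psiHom B F V U (app X le_rfl ((superFrameOn B F V hU).coord a)) := fun a => by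
    rw [← psiHom_superFrameOn_coord]
    exact hXX' U le_rfl _ (isDegLeOne_superFrameOn_coord B F V hU a)
  have hY' : ∀ a, app Y' le_rfl ((totalFrameOn B F V hU).coord a) =
      psiHom B F V U (app Y le_rfl ((superFrameOn B F V hU).coord a)) := fun a => by
    rw [← psiHom_superFrameOn_coord]
    exact hYY' U le_rfl _ (isDegLeOne_superFrameOn_coord B F V hU a)
  refine psiRelated_of_coord B F V hU (fun i => ?_) fun c => ?_
  · have := app_mem_par hmem le_rfl ((superFrameOn B F V hU).coord_mem (Sum.inl i))
    exact this
  · rw [connection_app_coord B F V conn hU hX.1 hY.1]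
    refine (christoffelNabla_coord _ _ _ X' Y' c).trans ?_
    rw [map_add, map_sum]
    congr 1
    · refine (congrArg (app X' le_rfl) (hY' c)).trans ?_
      exact hXX' U le_rfl _ (hY.2 U le_rfl _ (isDegLeOne_superFrameOn_coord B F V hU c))
    · refine Finset.sum_congr rfl fun b _ => ?_
      rw [map_sum]
      refine Finset.sum_congr rfl fun a _ => ?_
      have ha := app_mem_par hX.1 le_rfl ((superFrameOn B F V hU).coord_mem a)
      have hb := app_mem_par hY.1 le_rfl ((superFrameOn B F V hU).coord_mem b)
      rw [zero_add] at ha hb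
      rw [psiHom_mul_christoffel B F V conn hU a b c ha hb, ← hX', ← hY']

/-- Factors that make the coordinate vector fields even and linear. -/
def evenFactor (x₀ : M) : CoordIdx B F → (superFunctions B F V).Sec (trivDom B F V x₀) :=
  Sum.elim (fun _ => 1) fun j => (superFrame B F V x₀).coord (Sum.inr j)

/-- The transport of `evenFactor` to the total space. -/
def totalFactor (x₀ : M) :
    CoordIdx B F → (totalFunctions B F V).Sec (above F V (trivDom B F V x₀)) :=
  Sum.elim (fun _ => 1) fun j => (totalFrame B F V x₀).coord (Sum.inr j)

theorem psiHom_evenFactor (x₀ : M) (a : CoordIdx B F) :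
    psiHom B F V _ (evenFactor B F V x₀ a) = totalFactor B F V x₀ a := by
  rcases a with i | j
  · have h := psiHom_baseSec B F V (1 : (smoothFunctions 𝓘(ℝ, B) M).Sec (trivDom B F V x₀))
    rwa [map_one, map_one (totalHom B F V _)] at h
  · exact psiHom_superFrame_coord B F V x₀ (Sum.inr j)

theorem evenFactor_mem (x₀ : M) (a : CoordIdx B F) : evenFactor B F V x₀ a ∈
    (superFunctions B F V).par _ ((superFrame B F V x₀).parity a) := by
  rcases a with i | j
  · exact one_mem_par
  · exact (superFrame B F V x₀).coord_mem (Sum.inr j)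

theorem isDegLeOne_evenFactor (x₀ : M) (a : CoordIdx B F) :
    IsDegLeOne B F V (evenFactor B F V x₀ a) := by
  rcases a with i | j
  · have := isDegLeOne_baseSec B F V (1 : (smoothFunctions 𝓘(ℝ, B) M).Sec (trivDom B F V x₀))
    rwa [map_one] at this
  · exact isDegLeOne_superFrame_coord B F V x₀ (Sum.inr j)

theorem eq_zero_of_mulVect_totalFactor {x₀ : M} {T : Opens M} (hT : T ≤ trivDom B F V x₀)
    (a : CoordIdx B F) {Z : (totalFunctions B F V).Vect (above F V T)}
    (hZ : mulVect ((totalFunctions B F V).res (above_mono F V hT) (totalFactor B F V x₀ a)) Z = 0) :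
    Z = 0 := by
  rcases a with i | j
  · rw [totalFactor, Sum.elim_inl, map_one, one_mulVect] at hZ
    exact hZ
  · exact (totalFrame B F V x₀).eq_zero_of_mulVect_coord (above_mono F V hT) (Sum.inr j) hZ

/-- The vector fields `∂/∂x_i` and `η_j ∂/∂η_j`. -/
def evenLinearVect (x₀ : M) (a : CoordIdx B F) :
    (superFunctions B F V).Vect (trivDom B F V x₀) :=
  mulVect (evenFactor B F V x₀ a) ((superFrame B F V x₀).vect a)

theorem evenLinearVect_mem (x₀ : M) (a : CoordIdx B F) :
    (evenLinearVect B F V x₀ a).1 ∈ (superFunctions B F V).der _ 0 := by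
  have := mulVect_mem_der (evenFactor_mem B F V x₀ a) ((superFrame B F V x₀).vect_mem a)
  rwa [CharTwo.add_self_eq_zero] at this

theorem evenLinearVect_coord (x₀ : M) (a c : CoordIdx B F) :
    app (evenLinearVect B F V x₀ a) le_rfl ((superFrame B F V x₀).coord c) =
      if a = c then evenFactor B F V x₀ a else 0 := by
  rw [evenLinearVect, mulVect_app, res_self]
  split_ifs with h
  · rw [h, Frame.vect_coord, mul_one]
  · rw [Frame.vect_coord_of_ne _ _ _ h, mul_zero]

theorem isEvenLinear_evenLinearVect (x₀ : M) (a : CoordIdx B F) :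
    IsEvenLinear B F V (evenLinearVect B F V x₀ a) := by
  refine isEvenLinear_of_coord B F V le_rfl (evenLinearVect_mem B F V x₀ a) fun c => ?_
  refine (congrArg (IsDegLeOne B F V) (evenLinearVect_coord B F V x₀ a c)).mpr ?_
  split_ifs
  · exact isDegLeOne_evenFactor B F V x₀ a
  · exact (degLeOne B F V _).zero_mem

theorem psiRelated_evenLinearVect (x₀ : M) (a : CoordIdx B F) :
    PsiRelated B F V (evenLinearVect B F V x₀ a)
      (mulVect (totalFactor B F V x₀ a) ((totalFrame B F V x₀).vect a)) := by
  refine psiRelated_of_coord B F V le_rfl (fun i => ?_) fun c => ?_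
  · have := app_mem_par (evenLinearVect_mem B F V x₀ a) le_rfl
      ((superFrame B F V x₀).coord_mem (Sum.inl i))
    exact this
  · refine Eq.trans ?_ (congrArg (psiHom B F V _) (evenLinearVect_coord B F V x₀ a c)).symm
    change app (mulVect (totalFactor B F V x₀ a) ((totalFrame B F V x₀).vect a)) le_rfl
      ((totalFrame B F V x₀).coord c) = _
    rw [mulVect_app, res_self]
    split_ifs with h
    · rw [h, Frame.vect_coord, mul_one, psiHom_evenFactor]
    · rw [Frame.vect_coord_of_ne _ _ _ h, mul_zero, map_zero]

/-- Induced connections are unique over the domain of a local trivialization. -/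
theorem IsLocallyInduced.eq (conn : (superFunctions B F V).Connection) {x₀ : M} {T : Opens M}
    (hT : T ≤ trivDom B F V x₀)
    {nabla nabla' : ∀ O : Opens (TotalSpace F V), O ≤ above F V T →
      (totalFunctions B F V).Vect O → (totalFunctions B F V).Vect O →
      (totalFunctions B F V).Vect O}
    (hn : IsLocalConnection (above F V T) nabla) (hn' : IsLocalConnection (above F V T) nabla')
    (hi : IsLocallyInduced B F V conn T nabla) (hi' : IsLocallyInduced B F V conn T nabla')
    {O : Opens (TotalSpace F V)} (h : O ≤ above F V T) (D D' : (totalFunctions B F V).Vect O) :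
    nabla O h D D' = nabla' O h D D' := by
  refine hn.ext (totalFrameOn B F V hT) hn' (fun a b => ?_) h D D'
  have hlin : ∀ a, IsEvenLinear B F V (resVect hT (evenLinearVect B F V x₀ a)) := fun a =>
    (isEvenLinear_evenLinearVect B F V x₀ a).res B F V hT
  have hrel : ∀ a, PsiRelated B F V (resVect hT (evenLinearVect B F V x₀ a))
      (mulVect ((totalFunctions B F V).res (above_mono F V hT) (totalFactor B F V x₀ a))
        ((totalFrameOn B F V hT).vect a)) := fun a =>
    (psiRelated_evenLinearVect B F V x₀ a).res B F V hT
  -- Both connections, applied to the fields `∂/∂x_i` and `y_j ∂/∂y_j`, give the transport of the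
  -- same superfield.
  have h1 := PsiRelated.eq_right B F V
    (hi T le_rfl _ _ _ _ (hlin a) (hlin b) (hrel a) (hrel b))
    (hi' T le_rfl _ _ _ _ (hlin a) (hlin b) (hrel a) (hrel b))
  -- The derivative terms of the Leibniz rule do not involve the connection and cancel. What remains
  -- is the difference on frame fields multiplied by both factors, which are not zero divisors.
  rw [hn.mul_left, hn'.mul_left, hn.leibniz, hn'.leibniz, map_add, map_add] at h1
  have h2 := add_left_cancel h1
  refine sub_eq_zero.1 (eq_zero_of_mulVect_totalFactor B F V hT b
    (eq_zero_of_mulVect_totalFactor B F V hT a ?_))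
  rw [map_sub, map_sub]
  exact sub_eq_zero.2 h2

end InducedConnection

/-! ### Gluing the induced connection and proving its uniqueness. -/

section GlobalConnection

open SuperSheaf

variable (B : Type*) [NormedAddCommGroup B] [NormedSpace ℝ B]
  (F : Type*) [NormedAddCommGroup F] [NormedSpace ℝ F] [FiniteDimensional ℝ F]
  {M : Type*} [TopologicalSpace M] [ChartedSpace B M]
  (V : M → Type*) [TopologicalSpace (TotalSpace F V)]
  [∀ x, AddCommGroup (V x)] [∀ x, Module ℝ (V x)] [∀ x, TopologicalSpace (V x)]
  [FiberBundle F V] [VectorBundle ℝ F V]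
  [FiniteDimensional ℝ B] [IsManifold 𝓘(ℝ, B) ∞ M] [ContMDiffVectorBundle ∞ F V 𝓘(ℝ, B)]

theorem smooth_leibniz (conn : (totalFunctions B F V).Connection) {O : Opens (TotalSpace F V)}
    (f : (totalFunctions B F V).Sec O) (D D' : (totalFunctions B F V).Vect O) :
    conn.1 O D (mulVect f D') = mulVect (app D le_rfl f) D' + mulVect f (conn.1 O D D') := by
  rw [conn.2.leibniz O 0 0 f D D' (smooth_mem_der D) (smooth_mem_par f), koszul_zero_left,
    one_smul]

theorem isLocalConnection_of_connection (conn : (totalFunctions B F V).Connection)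
    (W : Opens (TotalSpace F V)) : IsLocalConnection W fun O _ D D' => conn.1 O D D' where
  add_left O _ D₁ D₂ D' := by rw [map_add, LinearMap.add_apply]
  add_right O _ D D₁ D₂ := map_add _ _ _
  res_nabla O O' _ h' D D' := conn.2.res_nabla O O' h' D D'
  mul_left O _ f D D' := conn.2.mul_left O f D D'
  leibniz O _ f D D' := smooth_leibniz B F V conn f D D'

theorem IsLocallyInduced.restrict {conn : (superFunctions B F V).Connection} {T T' : Opens M}
    (h : T' ≤ T) {nabla : ∀ O : Opens (TotalSpace F V), O ≤ above F V T →
      (totalFunctions B F V).Vect O → (totalFunctions B F V).Vect O →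
      (totalFunctions B F V).Vect O} (hi : IsLocallyInduced B F V conn T nabla) :
    IsLocallyInduced B F V conn T' fun O hO D D' => nabla O (hO.trans (above_mono F V h)) D D' :=
  fun U hU => hi U (hU.trans h)

/-- The projection `p` can be dropped from the condition, since a field and its projection have the
same transport. -/
theorem IsInducedBy.isLocallyInduced {conn' : (totalFunctions B F V).Connection}
    {conn : (superFunctions B F V).Connection} (h : IsInducedBy B F V conn' conn) (T : Opens M) :
    IsLocallyInduced B F V conn T fun O _ D D' => conn'.1 O D D' := by
  intro U _ X Y X' Y' hX hY hXX' hYY'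
  obtain ⟨Z, hZ, -⟩ := existsUnique_isProjOf B F V (conn.2.even U 0 0 X Y hX.1 hY.1)
  exact (hZ.psiRelated_iff B F V).1 (h U X Y Z X' Y' hX hY (hXX'.isEvenLinearAbove B F V hX.1)
    (hYY'.isEvenLinearAbove B F V hY.1) hXX' hYY' hZ).2

theorem isInducedBy_of_isLocallyInduced {conn' : (totalFunctions B F V).Connection}
    {conn : (superFunctions B F V).Connection}
    (h : ∀ x₀, IsLocallyInduced B F V conn (trivDom B F V x₀) fun O _ D D' => conn'.1 O D D') :
    IsInducedBy B F V conn' conn := by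
  intro U X Y Z X' Y' hX hY _ _ hXX' hYY' hZ
  have hrel : PsiRelated B F V (conn.1 U X Y) (conn'.1 (above F V U) X' Y') :=
    PsiRelated.of_cover B F V fun x hx => by
      have hle : U ⊓ trivDom B F V x ≤ U := inf_le_left
      refine ⟨U ⊓ trivDom B F V x, hle, ⟨hx, mem_trivDom_self B F V x⟩, ?_⟩
      rw [conn.2.res_nabla, conn'.2.res_nabla]
      exact h x _ inf_le_right _ _ _ _ (hX.res B F V hle) (hY.res B F V hle)
        (hXX'.res B F V hle) (hYY'.res B F V hle)
  exact ⟨hrel.isEvenLinearAbove B F V (conn.2.even U 0 0 X Y hX.1 hY.1),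
    (hZ.psiRelated_iff B F V).2 hrel⟩

section Glue

variable (conn : (superFunctions B F V).Connection)

/-- The value of the induced connection over `O ∩ π⁻¹(T)`, `T` the domain of a local
trivialization. -/
abbrev inducedNablaOn (x₀ : M) {O : Opens (TotalSpace F V)}
    (D D' : (totalFunctions B F V).Vect O) :
    (totalFunctions B F V).Vect (O ⊓ above F V (trivDom B F V x₀)) :=
  inducedNabla B F V conn x₀ _ inf_le_right (resVect inf_le_left D) (resVect inf_le_left D')

/-- On the overlap both are connections induced by `conn`, so local uniqueness identifies them; the
Christoffel symbols themselves are never transformed. -/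
theorem inducedNabla_eq (x₀ x₁ : M) {O : Opens (TotalSpace F V)}
    (h₀ : O ≤ above F V (trivDom B F V x₀)) (h₁ : O ≤ above F V (trivDom B F V x₁))
    (D D' : (totalFunctions B F V).Vect O) :
    inducedNabla B F V conn x₀ O h₀ D D' = inducedNabla B F V conn x₁ O h₁ D D' :=
  IsLocallyInduced.eq B F V conn
    (inf_le_left : trivDom B F V x₀ ⊓ trivDom B F V x₁ ≤ trivDom B F V x₀)
    ((isLocalConnection_christoffelNabla _ _).restrict (above_mono F V inf_le_left))
    ((isLocalConnection_christoffelNabla _ _).restrict (above_mono F V inf_le_right))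
    ((isLocallyInduced_inducedNabla B F V conn x₀).restrict B F V inf_le_left)
    ((isLocallyInduced_inducedNabla B F V conn x₁).restrict B F V inf_le_right)
    (fun _ he => ⟨h₀ he, h₁ he⟩) D D'

theorem exists_globalNabla {O : Opens (TotalSpace F V)} (D D' : (totalFunctions B F V).Vect O) :
    ∃ Z : (totalFunctions B F V).Vect O, ∀ x₀ : M,
      resVect inf_le_left Z = inducedNablaOn B F V conn x₀ D D' := by
  obtain ⟨Z, -, hZ⟩ := exists_glue (O := totalFunctions B F V) (U := O) 0
    (fun x₀ : M => O ⊓ above F V (trivDom B F V x₀)) (fun _ => inf_le_left)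
    (fun e he => ⟨e.proj, he, mem_trivDom_self B F V e.proj⟩)
    (fun x₀ => inducedNablaOn B F V conn x₀ D D') (fun _ => smooth_mem_der _) fun x₀ x₁ => by
      rw [(isLocalConnection_christoffelNabla _ _).res_nabla,
        (isLocalConnection_christoffelNabla _ _).res_nabla]
      exact inducedNabla_eq B F V conn x₀ x₁ _ _ _ _
  exact ⟨Z, hZ⟩

/-- The induced connection on vector fields over an open subset of the total space. -/
def globalNabla {O : Opens (TotalSpace F V)} (D D' : (totalFunctions B F V).Vect O) :
    (totalFunctions B F V).Vect O := (exists_globalNabla B F V conn D D').choose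

/-- The global field is obtained by choice, and this description of its restrictions is all that the
verification of the connection axioms needs. -/
theorem resVect_globalNabla {O O' : Opens (TotalSpace F V)} (h : O' ≤ O) (x₀ : M)
    (h' : O' ≤ above F V (trivDom B F V x₀)) (D D' : (totalFunctions B F V).Vect O) :
    resVect h (globalNabla B F V conn D D') =
      inducedNabla B F V conn x₀ O' h' (resVect h D) (resVect h D') := by
  have hle : O' ≤ O ⊓ above F V (trivDom B F V x₀) := le_inf h h'
  have := congrArg (resVect hle) ((exists_globalNabla B F V conn D D').choose_spec x₀)
  rw [(isLocalConnection_christoffelNabla _ _).res_nabla] at this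
  exact this

theorem vect_eq_of_trivDom {O : Opens (TotalSpace F V)} {D D' : (totalFunctions B F V).Vect O}
    (H : ∀ (x₀ : M) (O' : Opens (TotalSpace F V)) (h : O' ≤ O)
      (_ : O' ≤ above F V (trivDom B F V x₀)), resVect h D = resVect h D') : D = D' :=
  Vect.eq_of_cover fun e he => ⟨O ⊓ above F V (trivDom B F V e.proj), inf_le_left,
    ⟨he, mem_trivDom_self B F V e.proj⟩, H e.proj _ _ inf_le_right⟩

/-- The connection on the total space that is induced by a connection on `Π E`. -/
def inducedConnection : (totalFunctions B F V).Connection := by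
  have hl : ∀ x₀, IsLocalConnection (above F V (trivDom B F V x₀)) (inducedNabla B F V conn x₀) :=
    fun x₀ => isLocalConnection_christoffelNabla _ _
  have leib : ∀ (O : Opens (TotalSpace F V)) (f : (totalFunctions B F V).Sec O) (D D'),
      globalNabla B F V conn D (mulVect f D') =
        mulVect (app D le_rfl f) D' + mulVect f (globalNabla B F V conn D D') := by
    intro O f D D'
    refine vect_eq_of_trivDom B F V fun x₀ O' h h' => ?_
    rw [map_add, resVect_mulVect, resVect_mulVect, resVect_globalNabla B F V conn h x₀ h',
      resVect_globalNabla B F V conn h x₀ h', resVect_mulVect, (hl x₀).leibniz, res_app D le_rfl h]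
    rfl
  have left : ∀ (O : Opens (TotalSpace F V)) (f : (totalFunctions B F V).Sec O) (D D'),
      globalNabla B F V conn (mulVect f D) D' = mulVect f (globalNabla B F V conn D D') := by
    intro O f D D'
    refine vect_eq_of_trivDom B F V fun x₀ O' h h' => ?_
    rw [resVect_mulVect, resVect_globalNabla B F V conn h x₀ h',
      resVect_globalNabla B F V conn h x₀ h', resVect_mulVect, (hl x₀).mul_left]
  -- Real scalars are constant functions, so homogeneity over `ℝ` follows from function-linearity in
  -- the first argument and from the Leibniz rule in the second, as derivations kill constants.
  have hsmul : ∀ (O : Opens (TotalSpace F V)) (c : ℝ) (D : (totalFunctions B F V).Vect O),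
      c • D = mulVect (c • 1) D := fun O c D => by rw [smul_mulVect, one_mulVect]
  refine ⟨fun O => LinearMap.mk₂ ℝ (globalNabla B F V conn) (fun D₁ D₂ D' => ?_)
    (fun c D D' => ?_) (fun D D₁ D₂ => ?_) (fun c D D' => ?_), ?_⟩
  · refine vect_eq_of_trivDom B F V fun x₀ O' h h' => ?_
    rw [map_add, resVect_globalNabla B F V conn h x₀ h', resVect_globalNabla B F V conn h x₀ h',
      resVect_globalNabla B F V conn h x₀ h', map_add, (hl x₀).add_left]
  · rw [hsmul, left, ← hsmul]
  · refine vect_eq_of_trivDom B F V fun x₀ O' h h' => ?_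
    rw [map_add, resVect_globalNabla B F V conn h x₀ h', resVect_globalNabla B F V conn h x₀ h',
      resVect_globalNabla B F V conn h x₀ h', map_add, (hl x₀).add_right]
  · rw [hsmul, leib, ← hsmul, map_smul, app_one, smul_zero, zero_mulVect, zero_add]
  · refine ⟨fun U W h D D' => ?_, fun U p q D D' hD hD' => ?_, left, fun U p q f D D' hD hf => ?_⟩
    · refine vect_eq_of_trivDom B F V fun x₀ O' hO h' => ?_
      exact (resVect_globalNabla B F V conn (hO.trans h) x₀ h' D D').trans
        (resVect_globalNabla B F V conn hO x₀ h' (resVect h D) (resVect h D')).symm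
    · rcases zmod_two_eq p with rfl | rfl
      · rcases zmod_two_eq q with rfl | rfl
        · exact smooth_mem_der _
        · rw [eq_zero_of_mem_der_one hD', map_zero]
          exact Submodule.zero_mem _
      · rw [eq_zero_of_mem_der_one hD, map_zero]
        exact Submodule.zero_mem _
    · refine (leib U f D D').trans ?_
      rcases zmod_two_eq p with rfl | rfl
      · rw [koszul_zero_left, one_smul]
        rfl
      · rcases zmod_two_eq q with rfl | rfl
        · rw [koszul_zero_right, one_smul]
          rfl
        · rw [eq_zero_of_mem_par_one hf, zero_mulVect, zero_mulVect, smul_zero]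

theorem resVect_inducedConnection {O O' : Opens (TotalSpace F V)} (h : O' ≤ O) (x₀ : M)
    (h' : O' ≤ above F V (trivDom B F V x₀)) (D D' : (totalFunctions B F V).Vect O) :
    resVect h ((inducedConnection B F V conn).1 O D D') =
      inducedNabla B F V conn x₀ O' h' (resVect h D) (resVect h D') :=
  resVect_globalNabla B F V conn h x₀ h' D D'

theorem isInducedBy_inducedConnection :
    IsInducedBy B F V (inducedConnection B F V conn) conn :=
  isInducedBy_of_isLocallyInduced B F V fun x₀ U hU X Y X' Y' hX hY hXX' hYY' => by
    have h := isLocallyInduced_inducedNabla B F V conn x₀ U hU X Y X' Y' hX hY hXX' hYY'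
    exact (congrArg (PsiRelated B F V (conn.1 U X Y)) (resVect_inducedConnection B F V conn le_rfl x₀
      (above_mono F V hU) X' Y')).mpr h

theorem IsInducedBy.eq_inducedConnection {conn' : (totalFunctions B F V).Connection}
    (h : IsInducedBy B F V conn' conn) : conn' = inducedConnection B F V conn := by
  refine Subtype.ext (funext fun O => LinearMap.ext fun D => LinearMap.ext fun D' => ?_)
  refine vect_eq_of_trivDom B F V fun x₀ O' hO h' => ?_
  rw [resVect_inducedConnection B F V conn hO x₀ h', conn'.2.res_nabla]
  exact IsLocallyInduced.eq B F V conn le_rfl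
    (isLocalConnection_of_connection B F V conn' _) (isLocalConnection_christoffelNabla _ _)
    (h.isLocallyInduced B F V _) (isLocallyInduced_inducedNabla B F V conn x₀) h' _ _

theorem IsInducedBy.mulVect_eq {conn' : (totalFunctions B F V).Connection}
    (hind : IsInducedBy B F V conn' conn) {U : Opens M}
    {X' Y' Z' : (totalFunctions B F V).Vect (above F V U)}
    {h k : (totalFunctions B F V).Sec (above F V U)} {X Y Z : (superFunctions B F V).Vect U}
    (hX' : IsEvenLinearAbove B F V (mulVect h X')) (hY' : IsEvenLinearAbove B F V (mulVect k Y'))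
    (hX : IsEvenLinear B F V X) (hXX' : PsiRelated B F V X (mulVect h X'))
    (hY : IsEvenLinear B F V Y) (hYY' : PsiRelated B F V Y (mulVect k Y'))
    (hZ : IsProjOf B F V Z (conn.1 U X Y)) (hZZ' : PsiRelated B F V Z Z') :
    mulVect (h * k) (conn'.1 (above F V U) X' Y') =
      Z' - mulVect (h * app X' le_rfl k) Y' := by
  -- Both `∇'_{hX'}(kY')` and `Z'` are transports of `Z`, hence equal; expanding the left side by
  -- linearity and the Leibniz rule gives the formula.
  have e := (hind U X Y Z _ _ hX hY hX' hY' hXX' hYY' hZ).2.eq_right B F V hZZ'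
  rw [← e, conn'.2.mul_left, smooth_leibniz, map_add, mul_mulVect, mul_mulVect,
    add_sub_cancel_left]

end Glue

end GlobalConnection

end

theorem proposition3p3
    (B : Type*) [NormedAddCommGroup B] [NormedSpace ℝ B] [FiniteDimensional ℝ B]
    (F : Type*) [NormedAddCommGroup F] [NormedSpace ℝ F] [FiniteDimensional ℝ F]
    {M : Type*} [TopologicalSpace M] [T2Space M] [SecondCountableTopology M]
    [ChartedSpace B M] [IsManifold 𝓘(ℝ, B) ∞ M]
    (V : M → Type*) [TopologicalSpace (TotalSpace F V)]
    [∀ x, AddCommGroup (V x)] [∀ x, Module ℝ (V x)] [∀ x, TopologicalSpace (V x)]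
    [FiberBundle F V] [VectorBundle ℝ F V] [ContMDiffVectorBundle ∞ F V 𝓘(ℝ, B)]
    (conn : (superFunctions B F V).Connection) :
    -- the transport `Ψ` is a well-defined bijection
    (∀ (U : Opens M) (X : (superFunctions B F V).Vect U), IsEvenLinear B F V X →
      ∃! X' : (totalFunctions B F V).Vect (above F V U),
        IsEvenLinearAbove B F V X' ∧ PsiRelated B F V X X') ∧
    (∀ (U : Opens M) (X' : (totalFunctions B F V).Vect (above F V U)),
      IsEvenLinearAbove B F V X' →
      ∃! X : (superFunctions B F V).Vect U, IsEvenLinear B F V X ∧ PsiRelated B F V X X') ∧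
    -- the projection `p` is well defined on even superderivations
    (∀ (U : Opens M) (D : (superFunctions B F V).Vect U), D.1 ∈ (superFunctions B F V).der U 0 →
      ∃! Z : (superFunctions B F V).Vect U, IsProjOf B F V Z D) ∧
    -- there is exactly one induced connection; auxiliary functions determine it on other fields
    ∃ conn' : (totalFunctions B F V).Connection,
      IsInducedBy B F V conn' conn ∧
      (∀ conn'' : (totalFunctions B F V).Connection,
        IsInducedBy B F V conn'' conn → conn'' = conn') ∧
      ∀ (U : Opens M) (X' Y' : (totalFunctions B F V).Vect (above F V U))
        (h k : (totalFunctions B F V).Sec (above F V U))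
        (X Y Z : (superFunctions B F V).Vect U)
        (Z' : (totalFunctions B F V).Vect (above F V U)),
        IsEvenLinearAbove B F V (SuperSheaf.mulVect h X') →
        IsEvenLinearAbove B F V (SuperSheaf.mulVect k Y') →
        IsEvenLinear B F V X → PsiRelated B F V X (SuperSheaf.mulVect h X') →
        IsEvenLinear B F V Y → PsiRelated B F V Y (SuperSheaf.mulVect k Y') →
        IsProjOf B F V Z (conn.1 U X Y) →
        IsEvenLinearAbove B F V Z' → PsiRelated B F V Z Z' →
        SuperSheaf.mulVect (h * k) (conn'.1 (above F V U) X' Y') =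
          Z' - SuperSheaf.mulVect (h * SuperSheaf.app X' le_rfl k) Y' := by
  refine ⟨fun U X hX => existsUnique_psiRelated B F V hX,
    fun U X' hX' => existsUnique_isEvenLinear B F V hX',
    fun U D hD => existsUnique_isProjOf B F V hD, inducedConnection B F V conn,
    isInducedBy_inducedConnection B F V conn, fun conn'' h => h.eq_inducedConnection B F V conn,
    fun U X' Y' h k X Y Z Z' hX' hY' hX hXX' hY hYY' hZ _ hZZ' => ?_⟩
  exact (isInducedBy_inducedConnection B F V conn).mulVect_eq B F V conn hX' hY' hX hXX' hY hYY'
    hZ hZZ'
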